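/- **Setting.** Let $d\ge 2$, let $\Omega\subseteq\mathbb{R}^d$ be open, let $D\subseteq\partial\Omega$ be closed, and put $\Gamma:=\partial\Omega\setminus D$ and $\Xi:=\mathbb{R}^d\setminus\overline{\Gamma}$. The distance $\operatorname{dist}(A,B)=\inf\{|a-b|: a\in A,\ b\in B\}$ of two sets is $\infty$ if one of them is empty, and $1/\infty=0$. For $x,y\in\Xi$ let $$\mathrm{k}_\Xi(x,y):=\inf_\gamma\int_\gamma\frac{1}{\operatorname{dist}(z,\partial\Xi)}\,|\mathrm{d}z|\in[0,\infty],$$ where the infimum is taken over all rectifiable curves $\gamma$ in $\Xi$ joining $x$ and $y$, and let $\mathrm{k}_\Xi(x,\Omega):=\inf_{y\in\Omega}\mathrm{k}_\Xi(x,y)$. Assume that there are $\varepsilon\in(0,1]$, $\delta\in(0,\infty]$ and $K>0$ such that any $x,y\in\Omega$ with $|x-y|<\delta$ are joined by a rectifiable curve $\gamma$ with values in $\Xi$ that satisfies $\operatorname{length}(\gamma)\le\varepsilon^{-1}|x-y|$ and, for all $z\in\gamma$, $$\operatorname{dist}(z,\Gamma)\ge\varepsilon\,\frac{|x-z|\,|y-z|}{|x-y|}\qquad\text{and}\qquad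 \mathrm{k}_\Xi(z,\Omega)\le K$$ (the first of these two conditions is void if $x=y$). Assume further that there is $\lambda>0$ such that every connected component $\Omega_m$ of $\Omega$ with $\partial\Omega_m\cap\Gamma\ne\emptyset$ satisfies $\operatorname{diam}(\Omega_m)\ge\lambda\delta$. Let $k\ge 0$ be an integer and $1\le p<\infty$. Let $\mathrm{W}^{k,p}(\Omega)$ be the space of all (real- or complex-valued) functions in $\mathrm{L}^p(\Omega)$ whose weak derivatives up to order $k$ exist and lie in $\mathrm{L}^p(\Omega)$, with its usual norm. For an open set $U\subseteq\mathbb{R}^d$ with $D\subseteq\overline{U}$ let $\mathrm{C}^\infty_D(U):=\{f\in\mathrm{C}^\infty(U):\operatorname{dist}(\operatorname{supp} f,D)>0\}$, and let $\mathrm{W}^{k,p}_D(\Omega)$ be the closure of $\mathrm{C}^\infty_D(\Omega)\cap\mathrm{W}^{k,p}(\Omega)$ in $\mathrm{W}^{k,p}(\Omega)$. **Proposition 7.1.** Let $f\in\mathrm{C}^\infty_D(\Omega)\cap\mathrm{W}^{k,p}(\Omega)$, $\kappa:=\operatorname{dist}(\operatorname{supp} f,D)\in(0,\infty]$ and $\eta>0$.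 Then there is a function $g\in \mathrm{W}^{k,p}(\Omega)$ which is smooth on $\mathbb{R}^d$ and satisfies $\operatorname{dist}(\operatorname{supp} g,D)>\kappa/2$ (to be read as $\operatorname{dist}(\operatorname{supp} g,D)=\infty$ if $\kappa=\infty$) and $\|f-g\|_{\mathrm{W}^{k,p}(\Omega)}\le\eta$. In particular, the compactly supported functions in $\mathrm{C}^\infty_D(\mathbb{R}^d)$ are dense in $\mathrm{C}^\infty_D(\Omega)\cap\mathrm{W}^{k,p}(\Omega)$ with respect to the norm of $\mathrm{W}^{k,p}(\Omega)$. Consequently, these functions (restricted to $\Omega$) belong to $\mathrm{W}^{k,p}_D(\Omega)$ and are dense in it. -/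

import Mathlib

open MeasureTheory Set
open scoped ContDiff

noncomputable section

/-- The distance `inf {|a - b| : a ∈ A, b ∈ B}` of two sets, equal to `∞` if one of them is
empty. -/
def setEDist {X : Type*} [PseudoEMetricSpace X] (A B : Set X) : ENNReal :=
  ⨅ a ∈ A, Metric.infEDist a B

/-! ### Geometry -/

section Geometry

variable {d : ℕ}

/-- `γ`, restricted to `[0, 1]`, is a rectifiable curve in `Ξ` that joins `x` and `y`. -/
structure IsRectifiableCurve (Ξ : Set (EuclideanSpace ℝ (Fin d))) (x y : EuclideanSpace ℝ (Fin d))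
    (γ : ℝ → EuclideanSpace ℝ (Fin d)) : Prop where
  continuousOn : ContinuousOn γ (Icc 0 1)
  rectifiable : BoundedVariationOn γ (Icc 0 1)
  source : γ 0 = x
  target : γ 1 = y
  mapsTo : MapsTo γ (Icc 0 1) Ξ

/-- The length of the curve `γ : [0, 1] → ℝᵈ`. -/
def curveLength (γ : ℝ → EuclideanSpace ℝ (Fin d)) : ENNReal :=
  eVariationOn γ (Icc 0 1)

/-- The arc length integral `∫_γ ρ(z) |dz|` of a nonnegative function `ρ` along a rectifiable
curve `γ : [0, 1] → ℝᵈ`, computed in the parametrization of `γ` by arc length. -/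
def arcLengthIntegral (ρ : EuclideanSpace ℝ (Fin d) → ENNReal)
    (γ : ℝ → EuclideanSpace ℝ (Fin d)) : ENNReal :=
  ∫⁻ s in Icc 0 (curveLength γ).toReal, ρ (naturalParameterization γ (Icc 0 1) 0 s)

/-- The quasihyperbolic distance of `x` and `y` in `Ξ`. If `Ξ` has empty boundary, then the
distance to the boundary is `∞` and its inverse is `0`. -/
def qhDist (Ξ : Set (EuclideanSpace ℝ (Fin d))) (x y : EuclideanSpace ℝ (Fin d)) : ENNReal :=
  ⨅ (γ : ℝ → EuclideanSpace ℝ (Fin d)) (_ : IsRectifiableCurve Ξ x y γ),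
    arcLengthIntegral (fun z => (Metric.infEDist z (frontier Ξ))⁻¹) γ

/-- The quasihyperbolic distance of a point `x` to a set `S` in `Ξ`. -/
def qhDistSet (Ξ : Set (EuclideanSpace ℝ (Fin d))) (x : EuclideanSpace ℝ (Fin d))
    (S : Set (EuclideanSpace ℝ (Fin d))) : ENNReal :=
  ⨅ y ∈ S, qhDist Ξ x y

/-- The part `Γ = ∂Ω \ D` of the boundary of `Ω`. -/
def neumannPart (Ω D : Set (EuclideanSpace ℝ (Fin d))) : Set (EuclideanSpace ℝ (Fin d)) :=
  frontier Ω \ D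

/-- The `(ε, δ)`-condition on `Ω` adapted to `D`: with `Γ = ∂Ω \ D` and `Ξ = ℝᵈ \ closure Γ`, any
`x, y ∈ Ω` with `|x - y| < δ` are joined by a rectifiable curve in `Ξ` that satisfies the length
condition, the carrot condition and the quasihyperbolic distance condition, and the connected
components of `Ω` whose boundary meets `Γ` have diameter at least `lam * δ`. -/
def AdaptedEpsDelta (Ω D : Set (EuclideanSpace ℝ (Fin d))) : Prop :=
  ∃ (ε : ℝ) (δ : ENNReal) (K : ℝ), 0 < ε ∧ ε ≤ 1 ∧ 0 < δ ∧ 0 < K ∧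
    (∀ x ∈ Ω, ∀ y ∈ Ω, edist x y < δ →
      ∃ γ : ℝ → EuclideanSpace ℝ (Fin d),
        IsRectifiableCurve (closure (neumannPart Ω D))ᶜ x y γ ∧
        curveLength γ ≤ ENNReal.ofReal (ε⁻¹ * dist x y) ∧
        (∀ z ∈ γ '' Icc 0 1,
          ENNReal.ofReal (ε * (dist x z * dist y z / dist x y)) ≤
            Metric.infEDist z (neumannPart Ω D)) ∧
        (∀ z ∈ γ '' Icc 0 1,
          qhDistSet (closure (neumannPart Ω D))ᶜ z Ω ≤ ENNReal.ofReal K)) ∧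
    ∃ lam : ℝ, 0 < lam ∧ ∀ x ∈ Ω,
      (frontier (connectedComponentIn Ω x) ∩ neumannPart Ω D).Nonempty →
        ENNReal.ofReal lam * δ ≤ Metric.ediam (connectedComponentIn Ω x)

end Geometry

/-! ### Sobolev spaces

A function on `Ω` is represented by a function on `ℝᵈ` whose values off `Ω` play no role. -/

section Sobolev

variable {d : ℕ} {𝕜 : Type*} [RCLike 𝕜]

/-- The classical partial derivative `∂ᵢ φ`. -/
def partialDeriv (i : Fin d) (φ : EuclideanSpace ℝ (Fin d) → ℝ) : EuclideanSpace ℝ (Fin d) → ℝ :=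
  fun x => fderiv ℝ φ x (EuclideanSpace.single i 1)

/-- The classical derivative `∂^α φ = ∂₁^{α₁} ⋯ ∂_d^{α_d} φ`. -/
def multiDeriv (α : Fin d → ℕ) (φ : EuclideanSpace ℝ (Fin d) → ℝ) :
    EuclideanSpace ℝ (Fin d) → ℝ :=
  (List.finRange d).foldr (fun i ψ => (partialDeriv i)^[α i] ψ) φ

/-- `g` is the weak derivative `∂^α f` on `Ω`. -/
structure HasWeakDeriv (Ω : Set (EuclideanSpace ℝ (Fin d))) (α : Fin d → ℕ)
    (f g : EuclideanSpace ℝ (Fin d) → 𝕜) : Prop where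
  locallyIntegrableOn : LocallyIntegrableOn f Ω
  locallyIntegrableOn_deriv : LocallyIntegrableOn g Ω
  integral_eq : ∀ φ : EuclideanSpace ℝ (Fin d) → ℝ,
    ContDiff ℝ ∞ φ → HasCompactSupport φ → tsupport φ ⊆ Ω →
      ∫ x in Ω, multiDeriv α φ x • f x = (-1 : ℝ) ^ (∑ i, α i) • ∫ x in Ω, φ x • g x

/-- The space `W^{k,p}(Ω)`. -/
def sobolevSpace (𝕜 : Type*) [RCLike 𝕜] (k : ℕ) (p : ENNReal)
    (Ω : Set (EuclideanSpace ℝ (Fin d))) : Set (EuclideanSpace ℝ (Fin d) → 𝕜) :=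
  {f | MemLp f p (volume.restrict Ω) ∧ ∀ α : Fin d → ℕ, ∑ i, α i ≤ k →
    ∃ g, HasWeakDeriv Ω α f g ∧ MemLp g p (volume.restrict Ω)}

/-- The multi-indices of order at most `k`. -/
def multiIndices (d k : ℕ) : Finset (Fin d → ℕ) :=
  (Fintype.piFinset fun _ => Finset.range (k + 1)).filter fun α => ∑ i, α i ≤ k

/-- The norm `∑_{|α| ≤ k} ‖∂^α f‖_{L^p(Ω)}` of `W^{k,p}(Ω)`. The infimum runs over the
representatives of the weak derivative `∂^α f`, which agree almost everywhere in `Ω`, and is `∞` if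
there is none. -/
def sobolevNorm (k : ℕ) (p : ENNReal) (Ω : Set (EuclideanSpace ℝ (Fin d)))
    (f : EuclideanSpace ℝ (Fin d) → 𝕜) : ENNReal :=
  ∑ α ∈ multiIndices d k,
    ⨅ (g : EuclideanSpace ℝ (Fin d) → 𝕜) (_ : HasWeakDeriv Ω α f g),
      eLpNorm g p (volume.restrict Ω)

/-- The support of `f : Ω → 𝕜`, that is, the closure of `{x ∈ Ω | f x ≠ 0}` in `Ω`. -/
def supportIn (Ω : Set (EuclideanSpace ℝ (Fin d))) (f : EuclideanSpace ℝ (Fin d) → 𝕜) :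
    Set (EuclideanSpace ℝ (Fin d)) :=
  Ω ∩ closure {x ∈ Ω | f x ≠ 0}

/-- The space `C^∞_D(Ω)` of smooth functions on `Ω` whose support has positive distance
to `D`. -/
def smoothVanishing (𝕜 : Type*) [RCLike 𝕜] (Ω D : Set (EuclideanSpace ℝ (Fin d))) :
    Set (EuclideanSpace ℝ (Fin d) → 𝕜) :=
  {f | ContDiffOn ℝ ∞ f Ω ∧ 0 < setEDist (supportIn Ω f) D}

/-- The closure in `W^{k,p}(Ω)` of a set `S` of functions of `W^{k,p}(Ω)`. -/
def sobolevClosure (k : ℕ) (p : ENNReal) (Ω : Set (EuclideanSpace ℝ (Fin d)))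
    (S : Set (EuclideanSpace ℝ (Fin d) → 𝕜)) : Set (EuclideanSpace ℝ (Fin d) → 𝕜) :=
  {u | u ∈ sobolevSpace 𝕜 k p Ω ∧
    ∀ η : ℝ, 0 < η → ∃ g ∈ S, sobolevNorm k p Ω (u - g) ≤ ENNReal.ofReal η}

/-- The space `W^{k,p}_D(Ω)`, the closure of `C^∞_D(Ω) ∩ W^{k,p}(Ω)` in `W^{k,p}(Ω)`. -/
def sobolevSpaceVanishing (𝕜 : Type*) [RCLike 𝕜] (k : ℕ) (p : ENNReal)
    (Ω D : Set (EuclideanSpace ℝ (Fin d))) : Set (EuclideanSpace ℝ (Fin d) → 𝕜) :=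
  sobolevClosure k p Ω (smoothVanishing 𝕜 Ω D ∩ sobolevSpace 𝕜 k p Ω)

end Sobolev

end

noncomputable section

/-! ### Iterated directional derivatives -/

section DirDeriv

variable {V W : Type*} [NormedAddCommGroup V] [NormedSpace ℝ V]
  [NormedAddCommGroup W] [NormedSpace ℝ W]

/-! Extend `f` by zero to `F`. Since `f` vanishes near `D`, `F` is smooth on `Ξ`, the complement of
the closure of `Γ` (`contDiffOn_zeroExtension`), so only a neighbourhood of `Γ` needs repair. No
pointwise smallness is needed there: it is enough to bound the error in `L^p` by a constant,
independent of the scale `ρ`, times the energy of the derivatives of `F` up to order `k` in a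
neighbourhood of `Γ` of width comparable to `ρ`. This neighbourhood shrinks to the closure of `Γ`,
which misses `Ω`, so its energy tends to zero (`tendsto_lintegral_thickening`).

At scale `ρ`, take a partition of unity over the lattice `ρ ℤᵈ`. On patches near `Γ` and away from
`D`, `F` is replaced by its Taylor polynomial of degree less than `k` at a base point; on all other
patches `F` is kept (`glued`). The carrot condition and the lower bound on the diameters of the
components provide base points in `Ω` whose distance to `Γ` is at least a multiple of `ρ`
(`exists_interior_point`). The carrot condition also joins the base points of adjacent patches by
polygons of length `O(ρ)` that stay at such a distance from `Γ` (`exists_polygon`). These may leave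
`Ω`, but only into the part of `Ξ` where `F` vanishes.

Each derivative that falls on the partition costs a factor `ρ⁻¹`. This is compensated because moving
the base point changes the Taylor polynomial only through the derivative of order `k`
(`hasDerivAt_taylorPoly_line`): the `l`-th derivative of a difference of two Taylor polynomials is
at most a constant times `ρ^(k-l)` times `ρ⁻¹` times a line integral along the polygon
(`enorm_taylorPoly_transport_le`).

Line integrals are not controlled by `L^p` norms over open sets. Therefore all base points and
polygons are translated by one common small vector `u`. Averaging over `u` turns the line integrals
into volume integrals (`lintegral_rpow_lintegral_translate_le`). As the patches overlap boundedly,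
the sum over all patches is controlled on average, hence for some `u`
(`exists_lintegral_sub_glued_le`).

The rest is a passage between weak derivatives and iterated Fréchet derivatives, a cutoff at
infinity (`exists_cutoff_approx`), and the triangle inequality. -/

/-- The iterated directional derivative along the vectors of a list. -/
def dirDeriv (l : List V) (f : V → W) : V → W :=
  l.foldr (fun v g x => fderiv ℝ g x v) f

@[simp]
lemma dirDeriv_nil (f : V → W) : dirDeriv [] f = f := rfl

@[simp]
lemma dirDeriv_cons (v : V) (l : List V) (f : V → W) :
    dirDeriv (v :: l) f = fun x => fderiv ℝ (dirDeriv l f) x v := rfl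

lemma dirDeriv_append (l l' : List V) (f : V → W) :
    dirDeriv (l ++ l') f = dirDeriv l (dirDeriv l' f) := by
  simp [dirDeriv]

lemma ContDiffOn.fderiv_apply_of_isOpen {U : Set V} (hU : IsOpen U) {f : V → W}
    (hf : ContDiffOn ℝ ∞ f U) (v : V) : ContDiffOn ℝ ∞ (fun x => fderiv ℝ f x v) U :=
  (hf.fderiv_of_isOpen hU (m := ∞) (by simp)).clm_apply contDiffOn_const

lemma ContDiffOn.dirDeriv {U : Set V} (hU : IsOpen U) {f : V → W}
    (hf : ContDiffOn ℝ ∞ f U) (l : List V) : ContDiffOn ℝ ∞ (dirDeriv l f) U := by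
  induction l with
  | nil => exact hf
  | cons v l ih => exact ih.fderiv_apply_of_isOpen hU v

lemma fderiv_eqOn_of_eqOn {U : Set V} (hU : IsOpen U) {f g : V → W} (h : EqOn f g U) :
    EqOn (fderiv ℝ f) (fderiv ℝ g) U := fun _ hx =>
  (h.eventuallyEq_of_mem (hU.mem_nhds hx)).fderiv_eq

lemma fderiv_fderiv_apply_comm {U : Set V} (hU : IsOpen U) {f : V → W}
    (hf : ContDiffOn ℝ ∞ f U) (v w : V) {x : V} (hx : x ∈ U) :
    fderiv ℝ (fun y => fderiv ℝ f y v) x w = fderiv ℝ (fun y => fderiv ℝ f y w) x v := by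
  have hat : ContDiffAt ℝ ∞ f x := hf.contDiffAt (hU.mem_nhds hx)
  have hd : DifferentiableAt ℝ (fderiv ℝ f) x :=
    ((hf.fderiv_of_isOpen hU (m := ∞) (by simp)).contDiffAt (hU.mem_nhds hx)).differentiableAt
      (by simp)
  have key : ∀ u : V, fderiv ℝ (fun y => fderiv ℝ f y u) x
      = (fderiv ℝ (fderiv ℝ f) x).flip u := by
    intro u
    rw [fderiv_clm_apply hd (differentiableAt_const u)]
    ext z
    simp
  rw [key, key]
  have hs : IsSymmSndFDerivAt ℝ f x := hat.isSymmSndFDerivAt (by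
    simp only [minSmoothness_of_isRCLikeNormedField]
    exact WithTop.coe_le_coe.2 le_top)
  exact hs.eq w v

/-- Adjacent transpositions generate all permutations, and each of them is the symmetry of a second
derivative. -/
lemma dirDeriv_perm {U : Set V} (hU : IsOpen U) {f : V → W} (hf : ContDiffOn ℝ ∞ f U)
    {l l' : List V} (h : l.Perm l') : EqOn (dirDeriv l f) (dirDeriv l' f) U := by
  induction h with
  | nil => exact fun _ _ => rfl
  | cons v _ ih => intro x hx; simp [fderiv_eqOn_of_eqOn hU ih hx]
  | swap v w l =>
    intro x hx
    exact fderiv_fderiv_apply_comm hU (hf.dirDeriv hU l) _ _ hx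
  | trans _ _ ih₁ ih₂ => exact fun x hx => (ih₁ hx).trans (ih₂ hx)

lemma iteratedFDeriv_eq_dirDeriv {U : Set V} (hU : IsOpen U) {f : V → W}
    (hf : ContDiffOn ℝ ∞ f U) {n : ℕ} (v : Fin n → V) {x : V} (hx : x ∈ U) :
    iteratedFDeriv ℝ n f x v = dirDeriv (List.ofFn v) f x := by
  induction n generalizing x with
  | zero => simp
  | succ n ih =>
    have hd : DifferentiableAt ℝ (iteratedFDeriv ℝ n f) x :=
      (hf.contDiffAt (hU.mem_nhds hx)).differentiableAt_iteratedFDeriv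
        (by exact_mod_cast WithTop.coe_lt_coe.2 (ENat.natCast_lt_top n))
    rw [hd.iteratedFDeriv_succ_apply_left', List.ofFn_succ, dirDeriv_cons]
    have : EqOn (fun y => iteratedFDeriv ℝ n f y (Fin.tail v))
        (dirDeriv (List.ofFn fun i : Fin n => v i.succ) f) U := fun y hy => ih (Fin.tail v) hy
    simp [fderiv_eqOn_of_eqOn hU this hx]

lemma iteratedFDeriv_perm {U : Set V} (hU : IsOpen U) {f : V → W}
    (hf : ContDiffOn ℝ ∞ f U) {n : ℕ} (v : Fin n → V) (σ : Equiv.Perm (Fin n)) {x : V}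
    (hx : x ∈ U) : iteratedFDeriv ℝ n f x (v ∘ σ) = iteratedFDeriv ℝ n f x v := by
  rw [iteratedFDeriv_eq_dirDeriv hU hf _ hx, iteratedFDeriv_eq_dirDeriv hU hf _ hx]
  exact dirDeriv_perm hU hf (Equiv.Perm.ofFn_comp_perm σ v) hx

/-- A single deviating argument of the iterated derivative may be moved to the front. -/
lemma iteratedFDeriv_update_eq_cons {U : Set V} (hU : IsOpen U) {f : V → W}
    (hf : ContDiffOn ℝ ∞ f U) {n : ℕ} (i : Fin (n + 1)) (v w : V) {x : V} (hx : x ∈ U) :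
    iteratedFDeriv ℝ (n + 1) f x (Function.update (fun _ => v) i w) =
      iteratedFDeriv ℝ (n + 1) f x (Fin.cons w fun _ => v) := by
  rw [← iteratedFDeriv_perm hU hf (Fin.cons w fun _ => v) (Equiv.swap 0 i) hx]
  congr 1
  ext j
  by_cases hj : j = i
  · subst hj; simp
  · by_cases hj0 : j = 0
    · subst hj0
      rw [Function.update_of_ne hj]
      obtain ⟨m, hm⟩ := Fin.exists_succ_eq.2 (Ne.symm hj)
      simp [← hm]
    · rw [Function.update_of_ne hj, Function.comp_apply]
      obtain ⟨m, hm⟩ := Fin.exists_succ_eq.2 hj0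
      rw [Equiv.swap_apply_of_ne_of_ne hj0 hj, ← hm, Fin.cons_succ]

end DirDeriv

/-! ### Taylor polynomials -/

section Taylor

variable {V W : Type*} [NormedAddCommGroup V] [NormedSpace ℝ V]
  [NormedAddCommGroup W] [NormedSpace ℝ W]

open scoped Nat in
/-- The Taylor polynomial of `f` of degree less than `n` at `y`, evaluated at `x`. -/
def taylorPoly (n : ℕ) (f : V → W) (y x : V) : W :=
  ∑ j ∈ Finset.range n, (j ! : ℝ)⁻¹ • iteratedFDeriv ℝ j f y fun _ => x - y

@[simp]
lemma taylorPoly_zero (f : V → W) (y : V) : taylorPoly 0 f y = 0 := by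
  ext; simp [taylorPoly]

lemma taylorPoly_self (n : ℕ) (f : V → W) (x : V) : taylorPoly (n + 1) f x x = f x := by
  rw [taylorPoly, Finset.sum_range_succ', Finset.sum_eq_zero]
  · simp
  · intro j _
    rw [(iteratedFDeriv ℝ (j + 1) f x).map_coord_zero 0 (by simp), smul_zero]

lemma contDiff_taylorPoly (n : ℕ) (f : V → W) (y : V) : ContDiff ℝ ∞ (taylorPoly n f y) := by
  unfold taylorPoly
  refine ContDiff.sum fun j _ => ContDiff.const_smul _ ?_
  exact (iteratedFDeriv ℝ j f y).contDiff.comp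
    (contDiff_pi.2 fun _ => contDiff_id.sub contDiff_const)

open scoped Nat in
-- Each of the `n + 1` slots contributes the same term by symmetry. The deviating argument is moved
-- to the last slot, where `iteratedFDeriv_succ_apply_right` reads it as the argument of `fderiv ℝ
-- f`.
lemma hasFDerivAt_iteratedFDeriv_diag {U : Set V} (hU : IsOpen U) {f : V → W}
    (hf : ContDiffOn ℝ ∞ f U) (n : ℕ) {y : V} (hy : y ∈ U) (x : V) :
    HasFDerivAt (fun x => iteratedFDeriv ℝ (n + 1) f y fun _ => x - y)
      ((n + 1 : ℝ) • iteratedFDeriv ℝ n (fderiv ℝ f) y fun _ => x - y) x := by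
  have h1 := (iteratedFDeriv ℝ (n + 1) f y).hasFDerivAt (fun _ => x - y)
  have h2 : HasFDerivAt (fun x : V => fun _ : Fin (n + 1) => x - y)
      (ContinuousLinearMap.pi fun _ => ContinuousLinearMap.id ℝ V) x :=
    hasFDerivAt_pi.2 fun _ => (hasFDerivAt_id x).sub_const y
  refine (h1.comp x h2).congr_fderiv ?_
  ext w
  simp only [ContinuousLinearMap.comp_apply, ContinuousMultilinearMap.linearDeriv_apply]
  have : ∀ i : Fin (n + 1), iteratedFDeriv ℝ (n + 1) f y
      (Function.update (fun _ => x - y) i w) =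
      iteratedFDeriv ℝ n (fderiv ℝ f) y (fun _ => x - y) w := by
    intro i
    rw [iteratedFDeriv_update_eq_cons hU hf i _ _ hy,
      ← iteratedFDeriv_update_eq_cons hU hf (Fin.last n) _ _ hy, iteratedFDeriv_succ_apply_right]
    congr 2
    · ext j
      simp [Fin.init]
    · simp
  simp [this, add_smul, Nat.cast_smul_eq_nsmul]

open scoped Nat in
-- Differentiation in the evaluation point lowers the degree and replaces `f` by `fderiv ℝ f`; this
-- drives all inductions on the order of differentiation below.
lemma hasFDerivAt_taylorPoly {U : Set V} (hU : IsOpen U) {f : V → W}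
    (hf : ContDiffOn ℝ ∞ f U) (n : ℕ) {y : V} (hy : y ∈ U) (x : V) :
    HasFDerivAt (taylorPoly (n + 1) f y) (taylorPoly n (fderiv ℝ f) y x) x := by
  have h1 : taylorPoly (n + 1) f y = fun x => (∑ j ∈ Finset.range n, ((j + 1) ! : ℝ)⁻¹ •
      iteratedFDeriv ℝ (j + 1) f y fun _ => x - y) + f y := by
    ext x
    simp [taylorPoly, Finset.sum_range_succ']
  rw [h1]
  refine HasFDerivAt.add_const _ (HasFDerivAt.fun_sum fun j _ => ?_)
  refine ((hasFDerivAt_iteratedFDeriv_diag hU hf j hy x).const_smul _).congr_fderiv ?_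
  rw [smul_smul, Nat.factorial_succ]
  congr 1
  push_cast
  field_simp

lemma fderiv_taylorPoly {U : Set V} (hU : IsOpen U) {f : V → W}
    (hf : ContDiffOn ℝ ∞ f U) (n : ℕ) {y : V} (hy : y ∈ U) :
    fderiv ℝ (taylorPoly (n + 1) f y) = taylorPoly n (fderiv ℝ f) y :=
  funext fun x => (hasFDerivAt_taylorPoly hU hf n hy x).fderiv

lemma hasDerivAt_iteratedFDeriv_line {U : Set V} (hU : IsOpen U) {f : V → W}
    (hf : ContDiffOn ℝ ∞ f U) (n : ℕ) (y v x : V) {t : ℝ} (ht : y + t • v ∈ U) :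
    HasDerivAt (fun t : ℝ => iteratedFDeriv ℝ n f (y + t • v) fun _ => x - (y + t • v))
      (iteratedFDeriv ℝ (n + 1) f (y + t • v) (Fin.cons v fun _ => x - (y + t • v))
        - ∑ i : Fin n, iteratedFDeriv ℝ n f (y + t • v)
            (Function.update (fun _ => x - (y + t • v)) i v)) t := by
  have hd : DifferentiableAt ℝ (iteratedFDeriv ℝ n f) (y + t • v) :=
    (hf.contDiffAt (hU.mem_nhds ht)).differentiableAt_iteratedFDeriv
      (by exact_mod_cast WithTop.coe_lt_coe.2 (ENat.natCast_lt_top n))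
  have hl : HasDerivAt (fun t : ℝ => y + t • v) v t := by
    simpa using ((hasDerivAt_id t).smul_const v).const_add y
  have h1 := hd.hasFDerivAt.comp_hasDerivAt t hl
  have h3 := (h1.hasFDerivAt.continuousMultilinearMap_apply (x := t)
    (fun _ => (hl.const_sub x).hasFDerivAt)).hasDerivAt
  refine h3.congr_deriv ?_
  have hneg : ∀ i : Fin n, iteratedFDeriv ℝ n f (y + t • v)
      (Function.update (fun _ => x - (y + t • v)) i (-v)) =
      - iteratedFDeriv ℝ n f (y + t • v) (Function.update (fun _ => x - (y + t • v)) i v) := by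
    intro i
    simpa using (iteratedFDeriv ℝ n f (y + t • v)).map_update_smul
      (fun _ => x - (y + t • v)) i (-1 : ℝ) v
  rw [iteratedFDeriv_succ_apply_left]
  simp only [Function.comp_apply, add_apply, ContinuousLinearMap.comp_apply,
    ContinuousLinearMap.toSpanSingleton_apply, one_smul, sum_apply,
    ContinuousMultilinearMap.toContinuousLinearMap_apply, ContinuousMultilinearMap.apply_apply,
    hneg, Finset.sum_neg_distrib, Fin.cons_zero]
  rw [← sub_eq_add_neg]
  rfl

open scoped Nat in
-- The derivatives of consecutive terms telescope: differentiating the coefficient of one term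
-- cancels against differentiating the argument of the next, and only the top-order term survives.
lemma hasDerivAt_taylorPoly_line {U : Set V} (hU : IsOpen U) {f : V → W}
    (hf : ContDiffOn ℝ ∞ f U) (n : ℕ) (y v x : V) {t : ℝ} (ht : y + t • v ∈ U) :
    HasDerivAt (fun t : ℝ => taylorPoly (n + 1) f (y + t • v) x)
      ((n ! : ℝ)⁻¹ • iteratedFDeriv ℝ (n + 1) f (y + t • v)
        (Fin.cons v fun _ => x - (y + t • v))) t := by
  induction n with
  | zero =>
    have := hasDerivAt_iteratedFDeriv_line hU hf 0 y v x ht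
    simpa [taylorPoly] using this
  | succ n ih =>
    have h1 := hasDerivAt_iteratedFDeriv_line hU hf (n + 1) y v x ht
    have h2 := ih.add (h1.const_smul ((n + 1)! : ℝ)⁻¹)
    have h3 : (fun t : ℝ => taylorPoly (n + 1 + 1) f (y + t • v) x) =
        (fun t : ℝ => taylorPoly (n + 1) f (y + t • v) x) +
        (((n + 1)! : ℝ)⁻¹ • fun t : ℝ => iteratedFDeriv ℝ (n + 1) f (y + t • v)
          fun _ => x - (y + t • v)) := by
      ext t
      simp [taylorPoly, Finset.sum_range_succ]
    rw [h3]
    refine h2.congr_deriv ?_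
    simp only [iteratedFDeriv_update_eq_cons hU hf _ _ _ ht, Finset.sum_const, Finset.card_univ,
      Fintype.card_fin, smul_sub, Nat.factorial_succ, ← Nat.cast_smul_eq_nsmul ℝ, smul_smul]
    have : (((n + 1) * n ! : ℕ) : ℝ)⁻¹ * ((n + 1 : ℕ) : ℝ) = (n ! : ℝ)⁻¹ := by
      push_cast
      field_simp
    rw [this]
    abel

/-- The fundamental theorem of calculus applied to `hasDerivAt_taylorPoly_line`. Only the segment of
base points has to lie in `U`; the evaluation point `x` may be anywhere. -/
lemma enorm_taylorPoly_sub_le [CompleteSpace W] {U : Set V} (hU : IsOpen U) {f : V → W}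
    (hf : ContDiffOn ℝ ∞ f U) (n : ℕ) (y v x : V) {R : ℝ}
    (hseg : ∀ t ∈ Icc (0 : ℝ) 1, y + t • v ∈ U)
    (hR : ∀ t ∈ Icc (0 : ℝ) 1, ‖x - (y + t • v)‖ ≤ R) :
    ‖taylorPoly (n + 1) f (y + v) x - taylorPoly (n + 1) f y x‖ₑ ≤
      ‖v‖ₑ * ENNReal.ofReal R ^ n *
        ∫⁻ t in Icc (0 : ℝ) 1, ‖iteratedFDeriv ℝ (n + 1) f (y + t • v)‖ₑ := by
  have hD : ∀ t ∈ uIcc (0 : ℝ) 1, HasDerivAt (fun t : ℝ => taylorPoly (n + 1) f (y + t • v) x)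
      (((n.factorial : ℝ))⁻¹ • iteratedFDeriv ℝ (n + 1) f (y + t • v)
        (Fin.cons v fun _ => x - (y + t • v))) t := fun t ht =>
    hasDerivAt_taylorPoly_line hU hf n y v x (hseg t (by rwa [uIcc_of_le zero_le_one] at ht))
  have hline : Continuous fun t : ℝ => y + t • v := by fun_prop
  have hcD : ContinuousOn (iteratedFDeriv ℝ (n + 1) f) U := by
    have := hf.continuousOn_iteratedFDerivWithin (m := n + 1)
      (by exact_mod_cast WithTop.coe_le_coe.2 le_top) hU.uniqueDiffOn
    exact this.congr fun z hz => (iteratedFDerivWithin_of_isOpen (n + 1) hU hz).symm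
  have hcont : ContinuousOn (fun t : ℝ => ((n.factorial : ℝ))⁻¹ •
      iteratedFDeriv ℝ (n + 1) f (y + t • v) (Fin.cons v fun _ => x - (y + t • v)))
      (uIcc (0 : ℝ) 1) := by
    rw [uIcc_of_le zero_le_one]
    refine ContinuousOn.const_smul ?_ _
    have h1 : ContinuousOn (fun t : ℝ => iteratedFDeriv ℝ (n + 1) f (y + t • v)) (Icc 0 1) :=
      hcD.comp hline.continuousOn hseg
    have h2 : Continuous (fun t : ℝ => (Fin.cons v fun _ => x - (y + t • v) : Fin (n + 1) → V)) := by
      refine continuous_pi fun i => ?_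
      refine Fin.cases ?_ (fun j => ?_) i
      · simpa using continuous_const
      · simp only [Fin.cons_succ]
        fun_prop
    exact continuous_eval.comp_continuousOn (h1.prodMk h2.continuousOn)
  have hFTC := intervalIntegral.integral_eq_sub_of_hasDerivAt hD hcont.intervalIntegrable
  simp only [one_smul, zero_smul, add_zero] at hFTC
  rw [← hFTC, intervalIntegral.integral_of_le zero_le_one]
  refine (enorm_integral_le_lintegral_enorm _).trans ?_
  refine (lintegral_mono_set Ioc_subset_Icc_self).trans ?_
  rw [← lintegral_const_mul' _ _ (by finiteness)]
  refine setLIntegral_mono' measurableSet_Icc fun t ht => ?_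
  have hR0 : 0 ≤ R := (norm_nonneg _).trans (hR t ht)
  rw [← ofReal_norm, ← ofReal_norm, ← ofReal_norm, ← ENNReal.ofReal_pow hR0,
    ← ENNReal.ofReal_mul (norm_nonneg _), ← ENNReal.ofReal_mul (by positivity)]
  refine ENNReal.ofReal_le_ofReal ?_
  have h1 : ‖iteratedFDeriv ℝ (n + 1) f (y + t • v) (Fin.cons v fun _ => x - (y + t • v))‖ ≤
      ‖iteratedFDeriv ℝ (n + 1) f (y + t • v)‖ * (‖v‖ * R ^ n) := by
    refine (ContinuousMultilinearMap.le_opNorm _ _).trans ?_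
    gcongr
    rw [Fin.prod_univ_succ]
    simp only [Fin.cons_zero, Fin.cons_succ, Finset.prod_const, Finset.card_univ, Fintype.card_fin]
    gcongr
    exact hR t ht
  have h2 : ‖((n.factorial : ℝ))⁻¹‖ ≤ 1 := by
    rw [norm_inv, Real.norm_natCast]
    exact inv_le_one_of_one_le₀ (by exact_mod_cast n.factorial_pos)
  calc _ ≤ 1 * (‖iteratedFDeriv ℝ (n + 1) f (y + t • v)‖ * (‖v‖ * R ^ n)) := by
        rw [norm_smul]
        gcongr
    _ = _ := by ring

lemma enorm_taylorPoly_le (n : ℕ) (f : V → W) {y x : V} {R : ℝ} (hR : ‖x - y‖ ≤ R) (hR1 : 1 ≤ R) :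
    ‖taylorPoly n f y x‖ₑ ≤
      ENNReal.ofReal R ^ n * ∑ j ∈ Finset.range n, ‖iteratedFDeriv ℝ j f y‖ₑ := by
  rw [taylorPoly, Finset.mul_sum]
  refine (enorm_sum_le _ _).trans (Finset.sum_le_sum fun j hj => ?_)
  have hR0 : 0 ≤ R := zero_le_one.trans hR1
  rw [← ofReal_norm, ← ofReal_norm, ← ENNReal.ofReal_pow hR0,
    ← ENNReal.ofReal_mul (by positivity)]
  refine ENNReal.ofReal_le_ofReal ?_
  have h2 : ‖((j.factorial : ℝ))⁻¹‖ ≤ 1 := by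
    rw [norm_inv, Real.norm_natCast]
    exact inv_le_one_of_one_le₀ (by exact_mod_cast j.factorial_pos)
  have h1 : ‖iteratedFDeriv ℝ j f y fun _ => x - y‖ ≤ ‖iteratedFDeriv ℝ j f y‖ * R ^ j := by
    refine (ContinuousMultilinearMap.le_opNorm _ _).trans ?_
    simp only [Finset.prod_const, Finset.card_univ, Fintype.card_fin]
    gcongr
  have h3 : R ^ j ≤ R ^ n := pow_le_pow_right₀ hR1 (Finset.mem_range.1 hj).le
  calc _ ≤ 1 * (‖iteratedFDeriv ℝ j f y‖ * R ^ n) := by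
        rw [norm_smul]
        gcongr
        exact h1.trans (by gcongr)
    _ = _ := by ring

end Taylor

/-! ### Derivatives of Taylor polynomials in the evaluation point. -/

section TaylorDerivatives

variable {V : Type} {W : Type*} [NormedAddCommGroup V] [NormedSpace ℝ V]
  [NormedAddCommGroup W] [NormedSpace ℝ W]

lemma enorm_iteratedFDeriv_fderiv (n : ℕ) (f : V → W) (x : V) :
    ‖iteratedFDeriv ℝ n (fderiv ℝ f) x‖ₑ = ‖iteratedFDeriv ℝ (n + 1) f x‖ₑ := by
  rw [← ofReal_norm, ← ofReal_norm, norm_iteratedFDeriv_fderiv]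

lemma enorm_iteratedFDeriv_zero (f : V → W) (x : V) :
    ‖iteratedFDeriv ℝ 0 f x‖ₑ = ‖f x‖ₑ := by
  rw [← ofReal_norm, ← ofReal_norm, norm_iteratedFDeriv_zero]

/-- Each derivative in `x` passes to the Taylor polynomials of `fderiv ℝ f`, so the case `m = 0`
suffices. `V` lives in `Type` so that replacing `W` by `V →L[ℝ] W` in the induction stays in the
same universe. -/
lemma enorm_iteratedFDeriv_taylorPoly_sub_le [CompleteSpace W] {U : Set V} (hU : IsOpen U)
    {f : V → W} (hf : ContDiffOn ℝ ∞ f U) (m q : ℕ) (y v x : V) {R : ℝ}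
    (hseg : ∀ t ∈ Icc (0 : ℝ) 1, y + t • v ∈ U)
    (hR : ∀ t ∈ Icc (0 : ℝ) 1, ‖x - (y + t • v)‖ ≤ R) :
    ‖iteratedFDeriv ℝ m (fun x => taylorPoly (q + m + 1) f (y + v) x -
        taylorPoly (q + m + 1) f y x) x‖ₑ ≤
      ‖v‖ₑ * ENNReal.ofReal R ^ q *
        ∫⁻ t in Icc (0 : ℝ) 1, ‖iteratedFDeriv ℝ (q + m + 1) f (y + t • v)‖ₑ := by
  have hy : y ∈ U := by simpa using hseg 0 (by simp)
  have hyv : y + v ∈ U := by simpa using hseg 1 (by simp)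
  induction m generalizing W with
  | zero =>
    rw [enorm_iteratedFDeriv_zero]
    exact enorm_taylorPoly_sub_le hU hf q y v x hseg hR
  | succ m ih =>
    rw [← enorm_iteratedFDeriv_fderiv]
    have h1 : fderiv ℝ (fun x => taylorPoly (q + (m + 1) + 1) f (y + v) x -
        taylorPoly (q + (m + 1) + 1) f y x) = fun x => taylorPoly (q + m + 1) (fderiv ℝ f) (y + v) x
        - taylorPoly (q + m + 1) (fderiv ℝ f) y x :=
      funext fun x => ((hasFDerivAt_taylorPoly hU hf _ hyv x).sub
        (hasFDerivAt_taylorPoly hU hf _ hy x)).fderiv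
    rw [h1]
    refine (ih (hf.fderiv_of_isOpen hU (m := ∞) (by simp))).trans ?_
    simp_rw [enorm_iteratedFDeriv_fderiv]
    exact le_rfl

lemma iteratedFDeriv_taylorPoly_eq_zero {U : Set V} (hU : IsOpen U)
    {f : V → W} (hf : ContDiffOn ℝ ∞ f U) {m n : ℕ} (hmn : n ≤ m) {y : V} (hy : y ∈ U) :
    iteratedFDeriv ℝ m (taylorPoly n f y) = 0 := by
  induction m generalizing W n with
  | zero =>
    obtain rfl : n = 0 := by omega
    ext; simp
  | succ m ih =>
    ext1 x
    rw [Pi.zero_apply, ← norm_eq_zero, ← norm_iteratedFDeriv_fderiv, norm_eq_zero]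
    rcases n with _ | n
    · have : fderiv ℝ (taylorPoly 0 f y) = taylorPoly 0 (fderiv ℝ f) y := by
        ext; simp [taylorPoly_zero]
      rw [this, ih (hf.fderiv_of_isOpen hU (m := ∞) (by simp)) (by omega)]
      rfl
    · rw [fderiv_taylorPoly hU hf n hy, ih (hf.fderiv_of_isOpen hU (m := ∞) (by simp)) (by omega)]
      rfl

lemma enorm_iteratedFDeriv_taylorPoly_le {U : Set V} (hU : IsOpen U)
    {f : V → W} (hf : ContDiffOn ℝ ∞ f U) (m n : ℕ) {y x : V} (hy : y ∈ U) {R : ℝ}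
    (hR : ‖x - y‖ ≤ R) (hR1 : 1 ≤ R) :
    ‖iteratedFDeriv ℝ m (taylorPoly n f y) x‖ₑ ≤
      ENNReal.ofReal R ^ n * ∑ j ∈ Finset.range n, ‖iteratedFDeriv ℝ j f y‖ₑ := by
  induction m generalizing W n with
  | zero =>
    rw [enorm_iteratedFDeriv_zero]
    exact enorm_taylorPoly_le n f hR hR1
  | succ m ih =>
    rcases n with _ | n
    · rw [iteratedFDeriv_taylorPoly_eq_zero hU hf (by omega) hy, Pi.zero_apply,
        ← ofReal_norm, norm_zero, ENNReal.ofReal_zero]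
      exact zero_le
    · rw [← enorm_iteratedFDeriv_fderiv, fderiv_taylorPoly hU hf n hy]
      refine (ih (hf.fderiv_of_isOpen hU (m := ∞) (by simp)) n).trans ?_
      gcongr ?_ * ?_
      · exact pow_le_pow_right₀ (by simpa using hR1) n.le_succ
      · rw [Finset.sum_range_succ']
        simp_rw [enorm_iteratedFDeriv_fderiv]
        exact le_self_add

lemma iteratedFDeriv_sub_taylorPoly_self {U : Set V} (hU : IsOpen U)
    {f : V → W} (hf : ContDiffOn ℝ ∞ f U) (m q : ℕ) {x : V} (hx : x ∈ U) :
    iteratedFDeriv ℝ m (fun z => f z - taylorPoly (q + m + 1) f x z) x = 0 := by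
  induction m generalizing W with
  | zero =>
    rw [← norm_eq_zero, norm_iteratedFDeriv_zero, taylorPoly_self, sub_self, norm_zero]
  | succ m ih =>
    rw [← norm_eq_zero, ← norm_iteratedFDeriv_fderiv, norm_eq_zero,
      ← ih (hf.fderiv_of_isOpen hU (m := ∞) (by simp))]
    refine (Filter.EventuallyEq.iteratedFDeriv ℝ ?_ m).eq_of_nhds
    filter_upwards [hU.mem_nhds hx] with z hz
    exact (((hf.contDiffAt (hU.mem_nhds hz)).differentiableAt (by simp)).hasFDerivAt.sub
      (hasFDerivAt_taylorPoly hU hf _ hx z)).fderiv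

end TaylorDerivatives

/-! ### Averaging along paths -/

section Averaging

/-- Hölder's inequality against the constant `1`; the case `p = 1` is separate because its conjugate
exponent is infinite. -/
lemma rpow_lintegral_le {α : Type*} [MeasurableSpace α] (μ : Measure α) {G : α → ENNReal}
    (hG : Measurable G) {p : ℝ} (hp : 1 ≤ p) :
    (∫⁻ a, G a ∂μ) ^ p ≤ μ univ ^ (p - 1) * ∫⁻ a, G a ^ p ∂μ := by
  rcases hp.eq_or_lt with rfl | hp
  · simp
  have hpq := Real.HolderConjugate.conjExponent hp
  have h := ENNReal.lintegral_mul_le_Lp_mul_Lq μ hpq hG.aemeasurable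
    (aemeasurable_const (b := (1 : ENNReal)))
  have hp0 : 0 < p := zero_lt_one.trans hp
  calc (∫⁻ a, G a ∂μ) ^ p
      ≤ ((∫⁻ a, G a ^ p ∂μ) ^ (1 / p) *
          (∫⁻ _, (1 : ENNReal) ^ p.conjExponent ∂μ) ^ (1 / p.conjExponent)) ^ p := by
        gcongr
        simpa using h
    _ = μ univ ^ (p - 1) * ∫⁻ a, G a ^ p ∂μ := by
        rw [ENNReal.mul_rpow_of_nonneg _ _ hp0.le, ← ENNReal.rpow_mul, ← ENNReal.rpow_mul,
          one_div_mul_cancel hp0.ne', mul_comm]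
        have : 1 / p.conjExponent * p = p - 1 := by
          rw [Real.conjExponent]
          field_simp
        rw [this]
        simp

/-- Hölder, Tonelli, then translation invariance of `ν` for each fixed `q`. The measure `μ` may be
singular, such as arc length on a polygon; the integration over the translations `u` is what
produces a volume integral. -/
lemma lintegral_rpow_lintegral_translate_le {V : Type*} [NormedAddCommGroup V]
    [MeasurableSpace V] [BorelSpace V] [SecondCountableTopology V] (ν : Measure V) [SFinite ν]
    [ν.IsAddLeftInvariant] (μ : Measure V) [IsFiniteMeasure μ] {G : V → ENNReal} (hG : Measurable G)
    {p : ℝ} (hp : 1 ≤ p) {B S : Set V} (hB : MeasurableSet B)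
    (h : ∀ᵐ q ∂μ, ∀ u ∈ B, q + u ∈ S) :
    ∫⁻ u in B, (∫⁻ q, G (q + u) ∂μ) ^ p ∂ν ≤ μ univ ^ p * ∫⁻ y in S, G y ^ p ∂ν := by
  have hGp : Measurable fun y => G y ^ p := hG.pow_const p
  calc ∫⁻ u in B, (∫⁻ q, G (q + u) ∂μ) ^ p ∂ν
      ≤ ∫⁻ u in B, μ univ ^ (p - 1) * ∫⁻ q, G (q + u) ^ p ∂μ ∂ν :=
        lintegral_mono fun u => rpow_lintegral_le μ (hG.comp (by fun_prop)) hp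
    _ = μ univ ^ (p - 1) * ∫⁻ q, ∫⁻ u in B, G (q + u) ^ p ∂ν ∂μ := by
        rw [lintegral_const_mul' _ _ (ENNReal.rpow_ne_top_of_nonneg (by linarith)
          (measure_ne_top _ _)), lintegral_lintegral_swap]
        exact (hGp.comp (by fun_prop : Measurable fun z : V × V => z.2 + z.1)).aemeasurable
    _ ≤ μ univ ^ (p - 1) * ∫⁻ _, ∫⁻ y in S, G y ^ p ∂ν ∂μ := by
        refine mul_le_mul_right (lintegral_mono_ae ?_) _
        filter_upwards [h] with q hq
        rw [← lintegral_indicator hB]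
        calc ∫⁻ u, B.indicator (fun u => G (q + u) ^ p) u ∂ν
            ≤ ∫⁻ u, S.indicator (fun y => G y ^ p) (q + u) ∂ν := by
              refine lintegral_mono fun u => ?_
              by_cases hu : u ∈ B
              · simp [hu, hq u hu]
              · simp [hu]
          _ = ∫⁻ y, S.indicator (fun y => G y ^ p) y ∂ν :=
              lintegral_add_left_eq_self _ q
          _ ≤ ∫⁻ y in S, G y ^ p ∂ν := lintegral_indicator_le _ _
    _ = μ univ ^ p * ∫⁻ y in S, G y ^ p ∂ν := by
        rw [lintegral_const, mul_comm (lintegral _ _), ← mul_assoc]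
        congr 1
        rcases eq_or_ne (μ univ) 0 with h0 | h0
        · rw [h0, mul_zero, ENNReal.zero_rpow_of_pos (by linarith)]
        · nth_rw 2 [← ENNReal.rpow_one (μ univ)]
          rw [← ENNReal.rpow_add _ _ h0 (measure_ne_top _ _)]
          simp

variable {V : Type*} [NormedAddCommGroup V] [NormedSpace ℝ V] [MeasurableSpace V] [BorelSpace V]

/-- Arc length measure of the segment from `a` to `b`. -/
def segMeasure (a b : V) : Measure V :=
  ‖b - a‖ₑ • (volume.restrict (Icc (0 : ℝ) 1)).map fun t => a + t • (b - a)

/-- Arc length measure of the polygon with vertices `P 0, …, P N`. -/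
def polyMeasure (P : ℕ → V) (N : ℕ) : Measure V :=
  ∑ s ∈ Finset.range N, segMeasure (P s) (P (s + 1))

lemma lintegral_segMeasure (a b : V) {G : V → ENNReal} (hG : Measurable G) :
    ∫⁻ y, G y ∂segMeasure a b = ‖b - a‖ₑ * ∫⁻ t in Icc (0 : ℝ) 1, G (a + t • (b - a)) := by
  have : Measurable fun t : ℝ => a + t • (b - a) := by
    have : Continuous fun t : ℝ => a + t • (b - a) := by fun_prop
    exact this.measurable
  rw [segMeasure, lintegral_smul_measure, lintegral_map hG this, smul_eq_mul]

lemma segMeasure_univ (a b : V) : segMeasure a b univ = ‖b - a‖ₑ := by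
  have := lintegral_segMeasure a b (measurable_const (a := (1 : ENNReal)))
  simpa using this

lemma segMeasure_compl_eq_zero {a b : V} {K : Set V} (hK : MeasurableSet K)
    (h : ∀ t ∈ Icc (0 : ℝ) 1, a + t • (b - a) ∈ K) : segMeasure a b Kᶜ = 0 := by
  rw [← lintegral_indicator_one hK.compl,
    lintegral_segMeasure a b ((measurable_one (α := ENNReal)).indicator hK.compl)]
  rw [setLIntegral_congr_fun (g := 0) measurableSet_Icc]
  · simp
  · intro t ht
    simp [h t ht]

lemma polyMeasure_univ (P : ℕ → V) (N : ℕ) :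
    polyMeasure P N univ = ∑ s ∈ Finset.range N, ‖P (s + 1) - P s‖ₑ := by
  simp [polyMeasure, segMeasure_univ]

lemma polyMeasure_compl_eq_zero {P : ℕ → V} {N : ℕ} {K : Set V} (hK : MeasurableSet K)
    (h : ∀ s < N, ∀ t ∈ Icc (0 : ℝ) 1, P s + t • (P (s + 1) - P s) ∈ K) :
    polyMeasure P N Kᶜ = 0 := by
  simp only [polyMeasure, Measure.coe_finsetSum, Finset.sum_apply, Finset.sum_eq_zero_iff,
    Finset.mem_range]
  exact fun s hs => segMeasure_compl_eq_zero hK (h s hs)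

end Averaging

/-! ### Transport of Taylor polynomials along translated polygons. -/

section Transport

variable {V : Type} {W : Type*} [NormedAddCommGroup V] [NormedSpace ℝ V]
  [NormedAddCommGroup W] [NormedSpace ℝ W]

lemma enorm_add_multilinear_le {m : ℕ} (a b : V [×m]→L[ℝ] W) : ‖a + b‖ₑ ≤ ‖a‖ₑ + ‖b‖ₑ := by
  rw [← ofReal_norm, ← ofReal_norm, ← ofReal_norm,
    ← ENNReal.ofReal_add (norm_nonneg _) (norm_nonneg _)]
  exact ENNReal.ofReal_le_ofReal (norm_add_le a b)

variable [MeasurableSpace V] [BorelSpace V] [CompleteSpace W]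

/-- Comparison of the Taylor polynomials at the ends of a translated polygon. -/
lemma enorm_iteratedFDeriv_taylorPoly_sub_le_lintegral {U : Set V} (hU : IsOpen U)
    {f : V → W} (hf : ContDiffOn ℝ ∞ f U) (m q : ℕ) {G : V → ENNReal} (hG : Measurable G)
    (hfG : ∀ y ∈ U, ‖iteratedFDeriv ℝ (q + m + 1) f y‖ₑ ≤ G y) (P : ℕ → V) (N : ℕ) (u x : V) {R : ℝ}
    (hseg : ∀ s < N, ∀ t ∈ Icc (0 : ℝ) 1, P s + t • (P (s + 1) - P s) + u ∈ U)
    (hR : ∀ s < N, ∀ t ∈ Icc (0 : ℝ) 1, ‖x - (P s + t • (P (s + 1) - P s) + u)‖ ≤ R) :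
    ‖iteratedFDeriv ℝ m (fun x => taylorPoly (q + m + 1) f (P N + u) x -
        taylorPoly (q + m + 1) f (P 0 + u) x) x‖ₑ ≤
      ENNReal.ofReal R ^ q * ∫⁻ y, G (y + u) ∂polyMeasure P N := by
  have hGu : Measurable fun y => G (y + u) := hG.comp (measurable_add_const u)
  induction N with
  | zero =>
    simp only [sub_self]
    rw [← ofReal_norm, iteratedFDeriv_fun_zero, Pi.zero_apply, norm_zero, ENNReal.ofReal_zero]
    exact zero_le
  | succ N ih =>
    specialize ih (fun s hs => hseg s (by omega)) (fun s hs => hR s (by omega))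
    have hpt : ∀ t : ℝ, P N + t • (P (N + 1) - P N) + u = P N + u + t • (P (N + 1) - P N) := by
      intro t; abel
    have h1 := enorm_iteratedFDeriv_taylorPoly_sub_le hU hf m q (P N + u) (P (N + 1) - P N) x
      (fun t ht => hpt t ▸ hseg N (by omega) t ht) (fun t ht => hpt t ▸ hR N (by omega) t ht)
    have hend : P N + u + (P (N + 1) - P N) = P (N + 1) + u := by abel
    rw [hend] at h1
    have h2 : ‖P (N + 1) - P N‖ₑ * ENNReal.ofReal R ^ q * ∫⁻ t in Icc (0 : ℝ) 1,
        ‖iteratedFDeriv ℝ (q + m + 1) f (P N + u + t • (P (N + 1) - P N))‖ₑ ≤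
        ENNReal.ofReal R ^ q * ∫⁻ y, G (y + u) ∂segMeasure (P N) (P (N + 1)) := by
      rw [lintegral_segMeasure _ _ hGu, mul_comm ‖_‖ₑ, mul_assoc]
      refine mul_le_mul_right (mul_le_mul_right ?_ _) _
      refine setLIntegral_mono' measurableSet_Icc fun t ht => ?_
      rw [hpt]
      exact hfG _ (hpt t ▸ hseg N (by omega) t ht)
    have hsum : (fun x => taylorPoly (q + m + 1) f (P (N + 1) + u) x -
        taylorPoly (q + m + 1) f (P 0 + u) x) =
        (fun x => taylorPoly (q + m + 1) f (P (N + 1) + u) x -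
          taylorPoly (q + m + 1) f (P N + u) x) +
        fun x => taylorPoly (q + m + 1) f (P N + u) x - taylorPoly (q + m + 1) f (P 0 + u) x := by
      ext; simp
    have hc : ∀ y y' : V, ContDiff ℝ m fun x => taylorPoly (q + m + 1) f y x -
        taylorPoly (q + m + 1) f y' x := fun y y' =>
      ((contDiff_taylorPoly _ f y).sub (contDiff_taylorPoly _ f y')).of_le
        (by exact_mod_cast WithTop.coe_le_coe.2 le_top)
    rw [hsum, iteratedFDeriv_add_apply (hc _ _).contDiffAt (hc _ _).contDiffAt, polyMeasure,
      Finset.sum_range_succ, lintegral_add_measure, mul_add, add_comm]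
    exact (enorm_add_multilinear_le _ _).trans (add_le_add ih (h1.trans h2))

end Transport

/-! ### A partition of unity adapted to a lattice -/

section Lattice

variable {d : ℕ}

/-- The point of the lattice `ρ ℤᵈ` with index `i`. -/
def latticePoint (ρ : ℝ) (i : Fin d → ℤ) : EuclideanSpace ℝ (Fin d) :=
  ρ • WithLp.toLp 2 fun l => (i l : ℝ)

lemma latticePoint_eq_smul (ρ : ℝ) (i : Fin d → ℤ) : latticePoint ρ i = ρ • latticePoint 1 i := by
  simp [latticePoint]

lemma latticePoint_add (ρ : ℝ) (i j : Fin d → ℤ) :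
    latticePoint ρ (i + j) = latticePoint ρ i + latticePoint ρ j := by
  ext l
  simp [latticePoint, mul_add]

/-- Each coordinate `i l` is confined to an interval of `2 * ⌈s⌉₊ + 1` integers around `⌊x l / ρ⌋`,
so the count is free of `ρ` and `x`. -/
lemma exists_lattice_card_le (d : ℕ) (s : ℝ) : ∃ N : ℕ, ∀ ρ : ℝ, 0 < ρ →
    ∀ x : EuclideanSpace ℝ (Fin d), ∃ J : Finset (Fin d → ℤ), J.card ≤ N ∧
      ∀ i, i ∈ J ↔ dist x (latticePoint ρ i) < s * ρ := by
  classical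
  refine ⟨(2 * ⌈s⌉₊ + 1) ^ d, fun ρ hρ x => ?_⟩
  let J₀ : Finset (Fin d → ℤ) :=
    Fintype.piFinset fun l => Finset.Icc (⌊x l / ρ⌋ - ⌈s⌉₊) (⌊x l / ρ⌋ + ⌈s⌉₊)
  refine ⟨J₀.filter fun i => dist x (latticePoint ρ i) < s * ρ, ?_, fun i => ?_⟩
  · refine (Finset.card_filter_le _ _).trans ?_
    rw [Fintype.card_piFinset]
    refine (Finset.prod_le_pow_card _ _ (2 * ⌈s⌉₊ + 1) fun l _ => ?_).trans (by simp)
    rw [Int.card_Icc]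
    omega
  · simp only [Finset.mem_filter, and_iff_right_iff_imp]
    intro hi
    rw [Fintype.mem_piFinset]
    intro l
    have h1 : |x l - ρ * i l| < s * ρ := by
      refine lt_of_le_of_lt ?_ hi
      have := PiLp.norm_apply_le (x - latticePoint ρ i) l
      rw [dist_eq_norm]
      simpa [latticePoint] using this
    have h2 : |x l / ρ - i l| < s := by
      rw [← mul_lt_mul_iff_left₀ hρ]
      calc |x l / ρ - i l| * ρ = |(x l / ρ - i l) * ρ| := by rw [abs_mul, abs_of_pos hρ]
        _ = |x l - ρ * i l| := by congr 1; field_simp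
        _ < _ := h1
    have hs : s ≤ ⌈s⌉₊ := Nat.le_ceil s
    obtain ⟨h3, h4⟩ := abs_lt.1 h2
    have h5 := Int.floor_le (x l / ρ)
    have h6 := Int.lt_floor_add_one (x l / ρ)
    rw [Finset.mem_Icc]
    constructor
    · rw [← Int.sub_one_lt_iff]
      have : ((⌊x l / ρ⌋ - ⌈s⌉₊ - 1 : ℤ) : ℝ) < (i l : ℝ) := by
        push_cast; linarith
      exact_mod_cast this
    · rw [← Int.lt_add_one_iff]
      have : (i l : ℝ) < ((⌊x l / ρ⌋ + ⌈s⌉₊ + 1 : ℤ) : ℝ) := by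
        push_cast; linarith
      exact_mod_cast this

lemma exists_dist_latticePoint_le (y : EuclideanSpace ℝ (Fin d)) :
    ∃ i : Fin d → ℤ, dist y (latticePoint 1 i) ≤ d := by
  refine ⟨fun l => ⌊y l⌋, ?_⟩
  rw [EuclideanSpace.dist_eq, Real.sqrt_le_left (by positivity)]
  have : ∀ l ∈ Finset.univ, dist (y l) (latticePoint (d := d) 1 (fun l => ⌊y l⌋) l) ^ 2 ≤ 1 := by
    intro l _
    have h1 : dist (y l) (latticePoint (d := d) 1 (fun l => ⌊y l⌋) l) ≤ 1 := by
      simp only [latticePoint, one_smul, Real.dist_eq]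
      refine (abs_of_nonneg (Int.fract_nonneg (y l))).le.trans ?_
      exact (Int.fract_lt_one _).le
    exact pow_le_one₀ dist_nonneg h1
  refine (Finset.sum_le_sum this).trans ?_
  simp only [Finset.sum_const, Finset.card_univ, Fintype.card_fin, nsmul_eq_mul, mul_one]
  exact_mod_cast Nat.le_self_pow two_ne_zero d

/-- A locally finite sum over the lattice is locally a sum over a fixed finite set. -/
lemma finsum_eq_sum_of_lattice {W : Type*} [AddCommMonoid W] {ρ R : ℝ}
    {F : (Fin d → ℤ) → EuclideanSpace ℝ (Fin d) → W}
    (hF : ∀ i x, F i x ≠ 0 → dist x (latticePoint ρ i) < R * ρ) {x y : EuclideanSpace ℝ (Fin d)}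
    (hy : dist y x < ρ) {J : Finset (Fin d → ℤ)}
    (hJ : ∀ i, dist x (latticePoint ρ i) < (R + 1) * ρ → i ∈ J) :
    ∑ᶠ i, F i y = ∑ i ∈ J, F i y := by
  refine finsum_eq_sum_of_support_subset _ fun i hi => ?_
  refine hJ i ?_
  have h1 := hF i y hi
  have h2 := dist_triangle x y (latticePoint ρ i)
  rw [dist_comm x y] at h2
  linarith

lemma contDiff_finsum_of_lattice {W : Type*} [NormedAddCommGroup W] [NormedSpace ℝ W] {ρ R : ℝ}
    (hρ : 0 < ρ) {F : (Fin d → ℤ) → EuclideanSpace ℝ (Fin d) → W}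
    (hF : ∀ i x, F i x ≠ 0 → dist x (latticePoint ρ i) < R * ρ) (hs : ∀ i, ContDiff ℝ ∞ (F i)) :
    ContDiff ℝ ∞ fun x => ∑ᶠ i, F i x := by
  rw [contDiff_iff_contDiffAt]
  intro x
  obtain ⟨N, hN⟩ := exists_lattice_card_le d (R + 1)
  obtain ⟨J, -, hJ⟩ := hN ρ hρ x
  have h1 : ContDiffAt ℝ ∞ (fun y => ∑ i ∈ J, F i y) x :=
    (ContDiff.sum fun i _ => hs i).contDiffAt
  refine h1.congr_of_eventuallyEq ?_
  filter_upwards [Metric.ball_mem_nhds x hρ] with y hy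
  exact finsum_eq_sum_of_lattice hF hy fun i hi => (hJ i).2 hi

/-- Partitions of unity at all scales, with derivative bounds that are uniform in the scale. -/
lemma exists_lattice_partition (d : ℕ) : ∃ (R : ℝ) (C : ℕ → ℝ), 1 ≤ R ∧ ∀ ρ : ℝ, 0 < ρ →
    ∃ φ : (Fin d → ℤ) → EuclideanSpace ℝ (Fin d) → ℝ,
      (∀ i, ContDiff ℝ ∞ (φ i)) ∧
      (∀ i x, φ i x ≠ 0 → dist x (latticePoint ρ i) < R * ρ) ∧
      (∀ x, ∑ᶠ i, φ i x = 1) ∧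
      ∀ m i x, ‖iteratedFDeriv ℝ m (φ i) x‖ ≤ C m * (ρ⁻¹) ^ m := by
  -- The outer radius exceeds `d`, the covering radius from `exists_dist_latticePoint_le`, so the
  -- sum `S` of the translates is positive everywhere.
  let ψ : ContDiffBump (0 : EuclideanSpace ℝ (Fin d)) :=
    ⟨d + 1, d + 2, by positivity, by linarith⟩
  let S : EuclideanSpace ℝ (Fin d) → ℝ := fun y => ∑ᶠ i : Fin d → ℤ, ψ (y - latticePoint 1 i)
  have hψ : ∀ (i : Fin d → ℤ) x, ψ (x - latticePoint 1 i) ≠ 0 →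
      dist x (latticePoint 1 i) < (d + 2 : ℝ) * 1 := by
    intro i x hx
    have : x - latticePoint 1 i ∈ Function.support ψ := hx
    rw [ψ.support_eq] at this
    simpa [dist_eq_norm, ψ] using this
  have hS : ContDiff ℝ ∞ S := contDiff_finsum_of_lattice one_pos hψ fun i =>
    ψ.contDiff.comp (contDiff_id.sub contDiff_const)
  have hfin : ∀ x, (Function.support fun i : Fin d → ℤ => ψ (x - latticePoint 1 i)).Finite := by
    intro x
    obtain ⟨N, hN⟩ := exists_lattice_card_le d (d + 2)
    obtain ⟨J, -, hJ⟩ := hN 1 one_pos x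
    exact J.finite_toSet.subset fun i hi => (hJ i).2 (hψ i x hi)
  have hSpos : ∀ x, 0 < S x := by
    intro x
    obtain ⟨i, hi⟩ := exists_dist_latticePoint_le x
    refine finsum_pos (fun i => ψ.nonneg) ⟨i, ?_⟩ (hfin x)
    refine ψ.pos_of_mem_ball ?_
    simp only [Metric.mem_ball, dist_zero_right, ψ, ← dist_eq_norm]
    linarith
  -- By periodicity of `S`, every member of the partition is a translate and dilate of the single
  -- function `θ = ψ / S`, so one derivative bound for `θ` serves all indices and scales.
  have hSper : ∀ x (i : Fin d → ℤ), S (x - latticePoint 1 i) = S x := by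
    intro x i
    refine finsum_eq_of_bijective (fun j => i + j) (AddGroup.addLeft_bijective i) fun j => ?_
    rw [latticePoint_add, sub_sub]
  let θ : EuclideanSpace ℝ (Fin d) → ℝ := fun x => ψ x / S x
  have hθ : ContDiff ℝ ∞ θ := ψ.contDiff.div hS fun x => (hSpos x).ne'
  have hθc : HasCompactSupport θ := by
    refine ψ.hasCompactSupport.mono fun x hx hψx => hx ?_
    simp [θ, hψx]
  have hb : ∀ m, ∃ C : ℝ, ∀ x, ‖iteratedFDeriv ℝ m θ x‖ ≤ C := fun m =>
    (hθc.iteratedFDeriv m).exists_bound_of_continuous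
      (hθ.continuous_iteratedFDeriv (by exact_mod_cast WithTop.coe_le_coe.2 le_top))
  choose C hC using hb
  refine ⟨d + 2, C, by linarith [(Nat.cast_nonneg d : (0 : ℝ) ≤ d)], fun ρ hρ => ?_⟩
  refine ⟨fun i x => θ (ρ⁻¹ • x - latticePoint 1 i), fun i => ?_, fun i x hx => ?_, fun x => ?_,
    fun m i x => ?_⟩
  · exact hθ.comp ((contDiff_const_smul _).sub contDiff_const)
  · have h1 : ψ (ρ⁻¹ • x - latticePoint 1 i) ≠ 0 := fun h => hx (by simp [θ, h])
    have h2 := hψ i _ h1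
    rw [latticePoint_eq_smul, show x = ρ • ρ⁻¹ • x by rw [smul_inv_smul₀ hρ.ne'], dist_smul₀,
      Real.norm_of_nonneg hρ.le]
    nlinarith
  · simp only [θ, hSper, div_eq_mul_inv]
    rw [← finsum_mul' _ _ (hfin _)]
    exact mul_inv_cancel₀ (hSpos _).ne'
  · have h1 : iteratedFDeriv ℝ m (fun x => θ (ρ⁻¹ • x - latticePoint 1 i)) x =
        (ρ⁻¹) ^ m • iteratedFDeriv ℝ m θ (ρ⁻¹ • x - latticePoint 1 i) := by
      have h2 := iteratedFDeriv_comp_const_smul (𝕜 := ℝ) (i := m)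
        (f := fun x => θ (x - latticePoint 1 i)) (ρ⁻¹)
        ((hθ.comp (contDiff_id.sub contDiff_const)).of_le
          (by exact_mod_cast WithTop.coe_le_coe.2 le_top))
      rw [h2]
      simp only [iteratedFDeriv_comp_sub]
    rw [h1, norm_smul, norm_pow, Real.norm_of_nonneg (by positivity), mul_comm]
    gcongr
    exact hC m _

end Lattice

/-! ### Geometry of the domain -/

section DomainGeometry

lemma ofReal_le_infEDist_iff {X : Type*} [PseudoMetricSpace X] {c : ℝ} {x : X} {S : Set X} :
    ENNReal.ofReal c ≤ Metric.infEDist x S ↔ ∀ w ∈ S, c ≤ dist x w := by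
  rw [Metric.le_infEDist]
  refine forall₂_congr fun w _ => ?_
  rw [edist_dist, ENNReal.ofReal_le_ofReal_iff dist_nonneg]

lemma frontier_connectedComponentIn_subset {X : Type*} [TopologicalSpace X]
    [LocallyConnectedSpace X] {Ω : Set X} (hΩ : IsOpen Ω) (x : X) :
    frontier (connectedComponentIn Ω x) ⊆ frontier Ω := by
  intro w hw
  have hopen := hΩ.connectedComponentIn (x := x)
  refine ⟨closure_mono (connectedComponentIn_subset Ω x) hw.1, fun hwi => ?_⟩
  rw [hΩ.interior_eq] at hwi
  obtain ⟨v, hv, hv'⟩ := mem_closure_iff.1 hw.1 _ (hΩ.connectedComponentIn (x := w))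
    (mem_connectedComponentIn hwi)
  have h1 : connectedComponentIn Ω w = connectedComponentIn Ω x :=
    (connectedComponentIn_eq hv).trans (connectedComponentIn_eq hv').symm
  refine hw.2 ?_
  rw [hopen.interior_eq, ← h1]
  exact mem_connectedComponentIn hwi

/-- Otherwise the interior of `C` and the complement of its closure would separate `S`. -/
lemma IsPreconnected.inter_frontier_nonempty {X : Type*} [TopologicalSpace X] {S C : Set X}
    (hS : IsPreconnected S) (h1 : (S ∩ C).Nonempty) (h2 : (S ∩ Cᶜ).Nonempty) :
    (S ∩ frontier C).Nonempty := by
  by_contra hcon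
  rw [not_nonempty_iff_eq_empty] at hcon
  have hsub : S ⊆ interior C ∪ (closure C)ᶜ := by
    intro x hx
    by_contra hx'
    rw [mem_union, not_or, mem_compl_iff, not_not] at hx'
    exact (hcon ▸ ⟨hx, hx'.2, hx'.1⟩ : x ∈ (∅ : Set X))
  obtain ⟨a, haS, haC⟩ := h1
  obtain ⟨b, hbS, hbC⟩ := h2
  obtain ⟨c, -, hc1, hc2⟩ := hS _ _ isOpen_interior isClosed_closure.isOpen_compl hsub
    ⟨a, haS, (hsub haS).resolve_right fun h => h (subset_closure haC)⟩
    ⟨b, hbS, (hsub hbS).resolve_left fun h => hbC (interior_subset h)⟩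
  exact hc2 (subset_closure (interior_subset hc1))

variable {d : ℕ} {Ω D : Set (EuclideanSpace ℝ (Fin d))}

/-- The part of the `(ε, δ)`-condition on curves that is used below. -/
def CarrotCondition (Ω D : Set (EuclideanSpace ℝ (Fin d))) (ε : ℝ) (δ : ENNReal) : Prop :=
  ∀ x ∈ Ω, ∀ y ∈ Ω, edist x y < δ → ∃ γ : ℝ → EuclideanSpace ℝ (Fin d),
    IsRectifiableCurve (closure (neumannPart Ω D))ᶜ x y γ ∧
    curveLength γ ≤ ENNReal.ofReal (ε⁻¹ * dist x y) ∧
    ∀ z ∈ γ '' Icc 0 1, ENNReal.ofReal (ε * (dist x z * dist y z / dist x y)) ≤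
      Metric.infEDist z (neumannPart Ω D)

lemma dist_le_of_mem_curve {Ξ : Set (EuclideanSpace ℝ (Fin d))} {x y : EuclideanSpace ℝ (Fin d)}
    {γ : ℝ → EuclideanSpace ℝ (Fin d)} (hγ : IsRectifiableCurve Ξ x y γ) {L : ℝ} (hL : 0 ≤ L)
    (hlen : curveLength γ ≤ ENNReal.ofReal L) {t : ℝ} (ht : t ∈ Icc (0 : ℝ) 1) :
    dist x (γ t) ≤ L := by
  have h1 := eVariationOn.edist_le γ (s := Icc (0 : ℝ) 1) (left_mem_Icc.2 zero_le_one) ht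
  rw [hγ.source, edist_dist] at h1
  exact (ENNReal.ofReal_le_ofReal_iff hL).1 (h1.trans hlen)

/-- Points of `Ω` away from `D` have points of `Ω` nearby that are far from `Γ`. -/
lemma exists_interior_point (hΩ : IsOpen Ω) {ε : ℝ} {δ : ENNReal} (hε : 0 < ε) (hε1 : ε ≤ 1)
    (hcar : CarrotCondition Ω D ε δ) {lam : ℝ}
    (hcomp : ∀ x ∈ Ω, (frontier (connectedComponentIn Ω x) ∩ neumannPart Ω D).Nonempty →
        ENNReal.ofReal lam * δ ≤ Metric.ediam (connectedComponentIn Ω x))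
    {ρ κ : ℝ} (hρ : 0 < ρ) (hρκ : ε⁻¹ * ρ < κ) (hρδ : ENNReal.ofReal ρ < δ)
    (hρlam : ENNReal.ofReal (2 * ρ) < ENNReal.ofReal lam * δ)
    {x : EuclideanSpace ℝ (Fin d)} (hx : x ∈ Ω) (hxD : ∀ w ∈ D, κ ≤ dist x w) :
    ∃ z ∈ Ω, dist z x ≤ ρ ∧ ∀ w ∈ neumannPart Ω D, ε / 4 * ρ ≤ dist z w := by
  by_cases hfar : ∀ w ∈ neumannPart Ω D, ε / 4 * ρ ≤ dist x w
  · exact ⟨x, hx, by simpa using hρ.le, hfar⟩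
  push Not at hfar
  obtain ⟨q, hq, hxq⟩ := hfar
  have hερ : ρ ≤ ε⁻¹ * ρ := le_mul_of_one_le_left hρ.le ((one_le_inv₀ hε).2 hε1)
  have hxq' : dist x q < ρ := hxq.trans_le (by nlinarith)
  have hqΩ : q ∉ Ω := fun h => hq.1.2 (by rwa [hΩ.interior_eq])
  set C := connectedComponentIn Ω x with hC
  have hxC : x ∈ C := mem_connectedComponentIn hx
  -- The segment from `x` to the nearby point `q` of `Γ` leaves the component of `x`. The exit point
  -- is too close to `x` to lie in `D`, so the boundary of the component meets `Γ` and the diameter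
  -- bound applies.
  obtain ⟨w, hwseg, hwC⟩ := (convex_segment x q).isPreconnected.inter_frontier_nonempty
    (C := C) ⟨x, left_mem_segment ℝ x q, hxC⟩
    ⟨q, right_mem_segment ℝ x q, fun h => hqΩ (connectedComponentIn_subset Ω x h)⟩
  have hwx : dist x w < ρ := by
    have := (convex_closedBall x (dist x q)).segment_subset
      (Metric.mem_closedBall_self dist_nonneg) (Metric.mem_closedBall.2 (dist_comm q x).le) hwseg
    rw [Metric.mem_closedBall, dist_comm] at this
    exact this.trans_lt hxq'
  have hwΓ : w ∈ neumannPart Ω D :=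
    ⟨frontier_connectedComponentIn_subset hΩ x hwC, fun hwD => by
      have := hxD w hwD
      linarith⟩
  have hdiam := hcomp x hx ⟨w, hwC, hwΓ⟩
  -- If the component stayed within distance `ρ` of `x`, its diameter would be at most `2 * ρ`,
  -- contrary to `hρlam`.
  obtain ⟨y₀, hy₀, hy₀x⟩ : ∃ y ∈ C, ρ ≤ dist x y := by
    by_contra! hcon
    have h1 : Metric.ediam C ≤ ENNReal.ofReal (2 * ρ) := by
      refine Metric.ediam_le fun a ha b hb => ?_
      rw [edist_dist]
      refine ENNReal.ofReal_le_ofReal ?_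
      have h2 := dist_triangle_left a b x
      linarith [hcon a ha, hcon b hb]
    exact absurd (hdiam.trans h1) (not_le.2 hρlam)
  obtain ⟨y, hy, hxy⟩ : ∃ y ∈ C, dist x y = ρ := by
    have := isPreconnected_connectedComponentIn.intermediate_value (f := fun y => dist x y)
      hxC hy₀ (by fun_prop)
    exact this ⟨by simpa using hρ.le, hy₀x⟩
  have hyΩ : y ∈ Ω := connectedComponentIn_subset Ω x hy
  obtain ⟨γ, hγ, hlen, hgam⟩ := hcar x hx y hyΩ (by rwa [edist_dist, hxy])
  rw [hxy] at hlen hgam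
  have hconn : IsPreconnected (γ '' Icc 0 1) := isPreconnected_Icc.image γ hγ.continuousOn
  have hx0 : x ∈ γ '' Icc 0 1 := ⟨0, by simp, hγ.source⟩
  have hy1 : y ∈ γ '' Icc 0 1 := ⟨1, by simp, hγ.target⟩
  -- At distance `ρ / 2` from `x`, the point is also at distance at least `ρ / 2` from `y`, and the
  -- carrot condition gives `ε * (ρ / 2) * (ρ / 2) / ρ = ε / 4 * ρ`.
  obtain ⟨z, hz, hxz⟩ : ∃ z ∈ γ '' Icc 0 1, dist x z = ρ / 2 := by
    have := hconn.intermediate_value (f := fun y => dist x y) hx0 hy1 (by fun_prop)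
    exact this ⟨by rw [dist_self]; positivity, by rw [hxy]; linarith⟩
  refine ⟨z, ?_, by rw [dist_comm]; linarith, ?_⟩
  · by_contra hzΩ
    -- A curve that avoids the closure of `Γ` can leave `Ω` only through `D`, but its length is less
    -- than `κ`.
    obtain ⟨v, ⟨t, ht, rfl⟩, hvΩ⟩ := hconn.inter_frontier_nonempty ⟨x, hx0, hx⟩ ⟨z, hz, hzΩ⟩
    have hvD : γ t ∈ D := by
      by_contra hvD
      exact hγ.mapsTo ht (subset_closure ⟨hvΩ, hvD⟩)
    have h1 := dist_le_of_mem_curve hγ (by positivity) hlen ht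
    linarith [hxD _ hvD]
  · intro w hw
    have h1 := ofReal_le_infEDist_iff.1 (hgam z hz) w hw
    have h2 : ρ / 2 ≤ dist y z := by
      have := dist_triangle x z y
      rw [dist_comm z y] at this
      linarith
    refine le_trans ?_ h1
    have h3 : ρ / 2 * dist y z / ρ = dist y z / 2 := by field_simp
    rw [hxz, h3]
    nlinarith

/-- Points of `Ω` far from `Γ` are joined by polygons far from `Γ`. -/
lemma exists_polygon {ε : ℝ} {δ : ENNReal} (hε : 0 < ε) (hcar : CarrotCondition Ω D ε δ)
    {ρ a b M : ℝ} (hρ : 0 < ρ) (ha : 0 < a) (hb : 0 < b) (hM : 0 < M) (hba : 3 * b ≤ a / 2)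
    (hbM : 3 * b * M ≤ ε * (a / 2) ^ 2) (hMδ : ENNReal.ofReal (M * ρ) < δ)
    {z z' : EuclideanSpace ℝ (Fin d)} (hz : z ∈ Ω) (hz' : z' ∈ Ω) (hzz' : dist z z' ≤ M * ρ)
    (hzΓ : ∀ w ∈ neumannPart Ω D, a * ρ ≤ dist z w)
    (hzΓ' : ∀ w ∈ neumannPart Ω D, a * ρ ≤ dist z' w) :
    ∃ (P : ℕ → EuclideanSpace ℝ (Fin d)) (N : ℕ), P 0 = z ∧ P N = z' ∧
      ∑ s ∈ Finset.range N, ‖P (s + 1) - P s‖ₑ ≤ ENNReal.ofReal (ε⁻¹ * (M * ρ)) ∧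
      ∀ s < N, ∀ t ∈ Icc (0 : ℝ) 1,
        (∀ w ∈ neumannPart Ω D, 2 * b * ρ ≤ dist (P s + t • (P (s + 1) - P s)) w) ∧
        dist (P s + t • (P (s + 1) - P s)) z ≤ ε⁻¹ * (M * ρ) := by
  obtain ⟨γ, hγ, hlen, hgam⟩ := hcar z hz z' hz' (by
    rw [edist_dist]
    exact (ENNReal.ofReal_le_ofReal hzz').trans_lt hMδ)
  have hlen₀ := hlen
  replace hlen : curveLength γ ≤ ENNReal.ofReal (ε⁻¹ * (M * ρ)) :=
    hlen.trans (ENNReal.ofReal_le_ofReal (by gcongr))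
  have hL : 0 ≤ ε⁻¹ * (M * ρ) := by positivity
  -- Near either endpoint the distance to `Γ` is inherited from the endpoint by `hba`; elsewhere
  -- both factors of the carrot condition are at least `a / 2 * ρ`, and `hbM` absorbs the
  -- denominator.
  have hcurve : ∀ t ∈ Icc (0 : ℝ) 1, ∀ w ∈ neumannPart Ω D, 3 * b * ρ ≤ dist (γ t) w := by
    intro t ht w hw
    have hnear : ∀ v, (∀ w ∈ neumannPart Ω D, a * ρ ≤ dist v w) → dist v (γ t) ≤ a / 2 * ρ →
        3 * b * ρ ≤ dist (γ t) w := by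
      intro v hv hvt
      have h1 := hv w hw
      have h2 := dist_triangle v (γ t) w
      nlinarith
    by_cases h1 : dist z (γ t) ≤ a / 2 * ρ
    · exact hnear z hzΓ h1
    by_cases h2 : dist z' (γ t) ≤ a / 2 * ρ
    · exact hnear z' hzΓ' h2
    push Not at h1 h2
    -- If `z = z'`, the length bound makes the curve constant, so no point of it is far from `z`.
    have hd0 : 0 < dist z z' := by
      rcases eq_or_ne z z' with h | h
      · exfalso
        have h3 := dist_le_of_mem_curve hγ (by positivity) hlen₀ ht
        rw [h, dist_self, mul_zero, ← h] at h3
        have : 0 < a / 2 * ρ := by positivity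
        linarith
      · exact dist_pos.2 h
    refine le_trans ?_ (ofReal_le_infEDist_iff.1 (hgam _ ⟨t, ht, rfl⟩) w hw)
    rw [← mul_div_assoc, le_div_iff₀ hd0]
    have h3 : (a / 2 * ρ) * (a / 2 * ρ) ≤ dist z (γ t) * dist z' (γ t) := by gcongr
    calc 3 * b * ρ * dist z z' ≤ 3 * b * ρ * (M * ρ) := by gcongr
      _ = (3 * b * M) * (ρ * ρ) := by ring
      _ ≤ (ε * (a / 2) ^ 2) * (ρ * ρ) := by gcongr
      _ = ε * ((a / 2 * ρ) * (a / 2 * ρ)) := by ring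
      _ ≤ _ := by gcongr
  -- The mesh is chosen so that consecutive vertices are less than `b * ρ` apart. Passing from the
  -- curve to the chords lowers the clearance from `3 * b * ρ` to `2 * b * ρ`, which leaves room for
  -- a translation by less than `b * ρ`.
  have huc := isCompact_Icc.uniformContinuousOn_of_continuous hγ.continuousOn
  obtain ⟨η, hη, hηc⟩ := Metric.uniformContinuousOn_iff.1 huc (b * ρ) (by positivity)
  obtain ⟨N, hN⟩ := exists_nat_one_div_lt hη
  have hmem : ∀ s ≤ N + 1, (s : ℝ) / (N + 1) ∈ Icc (0 : ℝ) 1 := by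
    intro s hs
    refine ⟨by positivity, ?_⟩
    rw [div_le_one (by positivity)]
    exact_mod_cast hs
  refine ⟨fun s => γ (s / (N + 1)), N + 1, by simpa using hγ.source, ?_, ?_, ?_⟩
  · have : ((N + 1 : ℕ) : ℝ) / (N + 1) = 1 := by
      push_cast
      exact div_self (by positivity)
    dsimp only
    rw [this, hγ.target]
  · refine le_trans ?_ hlen
    have h1 := eVariationOn.sum_le_of_monotoneOn_Iic (f := γ) (s := Icc (0 : ℝ) 1) (n := N + 1)
      (u := fun s : ℕ => (s : ℝ) / (N + 1))
      (fun i _ j _ hij => by dsimp only; gcongr) (fun i hi => hmem i hi)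
    refine le_trans (le_of_eq ?_) h1
    simp [edist_eq_enorm_sub]
  · intro s hs t ht
    have hm1 := hmem s (by omega)
    have hm2 := hmem (s + 1) (by omega)
    have hseg : γ (s / (N + 1)) + t • (γ ((s + 1 : ℕ) / (N + 1)) - γ (s / (N + 1))) ∈
        segment ℝ (γ (s / (N + 1))) (γ ((s + 1 : ℕ) / (N + 1))) := by
      rw [segment_eq_image']
      exact ⟨t, ht, rfl⟩
    have hclose : dist (γ (s / (N + 1))) (γ ((s + 1 : ℕ) / (N + 1))) < b * ρ := by
      refine hηc _ hm1 _ hm2 ?_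
      rw [Real.dist_eq, abs_sub_comm, abs_of_nonneg (by rw [sub_nonneg]; gcongr; simp)]
      refine lt_of_le_of_lt (le_of_eq ?_) hN
      push_cast
      ring
    constructor
    · intro w hw
      have h1 := (convex_closedBall (γ (s / (N + 1))) (b * ρ)).segment_subset
        (Metric.mem_closedBall_self (by positivity))
        (Metric.mem_closedBall.2 (by rw [dist_comm]; exact hclose.le)) hseg
      rw [Metric.mem_closedBall] at h1
      have h2 := hcurve _ hm1 w hw
      have h3 := dist_triangle_left (γ (s / (N + 1))) w
        (γ (s / (N + 1)) + t • (γ ((s + 1 : ℕ) / (N + 1)) - γ (s / (N + 1))))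
      linarith
    · have h1 := dist_le_of_mem_curve hγ hL hlen hm1
      have h2 := dist_le_of_mem_curve hγ hL hlen hm2
      rw [dist_comm] at h1 h2
      exact Metric.mem_closedBall.1 ((convex_closedBall z (ε⁻¹ * (M * ρ))).segment_subset
        (Metric.mem_closedBall.2 h1) (Metric.mem_closedBall.2 h2) hseg)

end DomainGeometry

/-! ### Pointwise estimates for glued functions -/

section Gluing

variable {V : Type} {W : Type*} [NormedAddCommGroup V] [NormedSpace ℝ V]
  [NormedAddCommGroup W] [NormedSpace ℝ W]

lemma natCast_le_infty (m : ℕ) : (m : WithTop ℕ∞) ≤ ∞ := by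
  exact_mod_cast WithTop.coe_le_coe.2 le_top

lemma enorm_neg_multilinear {m : ℕ} (a : V [×m]→L[ℝ] W) : ‖-a‖ₑ = ‖a‖ₑ := by
  rw [← ofReal_norm, ← ofReal_norm, norm_neg]

lemma enorm_zero_multilinear {m : ℕ} : ‖(0 : V [×m]→L[ℝ] W)‖ₑ = 0 := by
  rw [← ofReal_norm, norm_zero, ENNReal.ofReal_zero]

lemma enorm_iteratedFDeriv_add_le {f g : V → W} {x : V} (hf : ContDiffAt ℝ ∞ f x)
    (hg : ContDiffAt ℝ ∞ g x) (m : ℕ) :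
    ‖iteratedFDeriv ℝ m (fun y => f y + g y) x‖ₑ ≤
      ‖iteratedFDeriv ℝ m f x‖ₑ + ‖iteratedFDeriv ℝ m g x‖ₑ := by
  have := iteratedFDeriv_add_apply (hf.of_le (natCast_le_infty m))
    (hg.of_le (natCast_le_infty m))
  rw [show (fun y => f y + g y) = f + g from rfl, this]
  exact enorm_add_multilinear_le _ _

lemma enorm_iteratedFDeriv_sub_le {f g : V → W} {x : V} (hf : ContDiffAt ℝ ∞ f x)
    (hg : ContDiffAt ℝ ∞ g x) (m : ℕ) :
    ‖iteratedFDeriv ℝ m (fun y => f y - g y) x‖ₑ ≤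
      ‖iteratedFDeriv ℝ m f x‖ₑ + ‖iteratedFDeriv ℝ m g x‖ₑ := by
  have h := enorm_iteratedFDeriv_add_le hf hg.neg m
  have h2 : iteratedFDeriv ℝ m (-g) x = -iteratedFDeriv ℝ m g x := by
    rw [iteratedFDeriv_neg_apply]
  simp_rw [sub_eq_add_neg]
  refine h.trans_eq ?_
  rw [show (fun x => -g x) = -g from rfl, h2, enorm_neg_multilinear]

lemma enorm_iteratedFDeriv_sum_le {ι : Type*} (J : Finset ι) {h : ι → V → W} {x : V}
    (hh : ∀ i ∈ J, ContDiffAt ℝ ∞ (h i) x) (m : ℕ) :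
    ‖iteratedFDeriv ℝ m (fun y => ∑ i ∈ J, h i y) x‖ₑ ≤
      ∑ i ∈ J, ‖iteratedFDeriv ℝ m (h i) x‖ₑ := by
  classical
  induction J using Finset.induction_on with
  | empty =>
    simp only [Finset.sum_empty, iteratedFDeriv_fun_zero, Pi.zero_apply]
    exact enorm_zero_multilinear.le
  | insert i J hi ih =>
    simp only [Finset.sum_insert hi]
    refine (enorm_iteratedFDeriv_add_le (hh i (Finset.mem_insert_self _ _))
      (ContDiffAt.sum fun j hj => hh j (Finset.mem_insert_of_mem hj)) m).trans ?_
    gcongr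
    exact ih fun j hj => hh j (Finset.mem_insert_of_mem hj)

lemma enorm_iteratedFDeriv_smul_le {𝕜 : Type*} [NormedField 𝕜] [NormedAlgebra ℝ 𝕜]
    [NormedSpace 𝕜 W] [IsScalarTower ℝ 𝕜 W] {U : Set V} (hU : IsOpen U) {φ : V → 𝕜}
    {h : V → W} (hφ : ContDiffOn ℝ ∞ φ U) (hh : ContDiffOn ℝ ∞ h U) {x : V} (hx : x ∈ U) (m : ℕ) :
    ‖iteratedFDeriv ℝ m (fun y => φ y • h y) x‖ₑ ≤ ∑ i ∈ Finset.range (m + 1),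
      (m.choose i : ENNReal) * ‖iteratedFDeriv ℝ i φ x‖ₑ * ‖iteratedFDeriv ℝ (m - i) h x‖ₑ := by
  have key := norm_iteratedFDerivWithin_smul_le hφ hh hU.uniqueDiffOn hx (natCast_le_infty m)
  simp only [iteratedFDerivWithin_of_isOpen _ hU hx] at key
  rw [← ofReal_norm]
  refine (ENNReal.ofReal_le_ofReal key).trans_eq ?_
  rw [ENNReal.ofReal_sum_of_nonneg fun _ _ => by positivity]
  refine Finset.sum_congr rfl fun i _ => ?_
  rw [ENNReal.ofReal_mul (by positivity), ENNReal.ofReal_mul (by positivity), ofReal_norm,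
    ofReal_norm, ENNReal.ofReal_natCast]

/-- The constant in the Leibniz estimate `enorm_iteratedFDeriv_smul_le_of_scale`. -/
def leibnizConst (C : ℕ → ℝ) (k : ℕ) : ENNReal :=
  ∑ m ∈ Finset.range (k + 1), ∑ i ∈ Finset.range (m + 1),
    (m.choose i : ENNReal) * ENNReal.ofReal (C i)

/-- In the Leibniz formula, `i` derivatives on `φ` cost `ρ⁻¹ ^ i`, while the remaining `m - i` on
`h` gain `ρ ^ (k - (m - i))`. The net power is `ρ ^ (k - m) ≤ 1`. -/
lemma enorm_iteratedFDeriv_smul_le_of_scale {U : Set V} (hU : IsOpen U) {φ : V → ℝ}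
    {h : V → W} (hφ : ContDiffOn ℝ ∞ φ U) (hh : ContDiffOn ℝ ∞ h U) {x : V} (hx : x ∈ U)
    {C : ℕ → ℝ} {ρ : ℝ} (hρ : 0 < ρ) (hρ1 : ρ ≤ 1) {k : ℕ}
    (hC : ∀ i, ‖iteratedFDeriv ℝ i φ x‖ ≤ C i * ρ⁻¹ ^ i) {A : ENNReal}
    (hA : ∀ l ≤ k, ‖iteratedFDeriv ℝ l h x‖ₑ ≤ ENNReal.ofReal ρ ^ (k - l) * A) {m : ℕ}
    (hm : m ≤ k) :
    ‖iteratedFDeriv ℝ m (fun y => φ y • h y) x‖ₑ ≤ leibnizConst C k * A := by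
  refine (enorm_iteratedFDeriv_smul_le hU hφ hh hx m).trans ?_
  have h1 : ∑ i ∈ Finset.range (m + 1), (m.choose i : ENNReal) * ENNReal.ofReal (C i) ≤
      leibnizConst C k :=
    Finset.single_le_sum (f := fun m => ∑ i ∈ Finset.range (m + 1),
      (m.choose i : ENNReal) * ENNReal.ofReal (C i)) (fun _ _ => zero_le)
      (Finset.mem_range.2 (Nat.lt_succ_of_le hm))
  refine le_trans ?_ (mul_le_mul_left h1 A)
  rw [Finset.sum_mul]
  refine Finset.sum_le_sum fun i hi => ?_
  have hi' : i ≤ m := Nat.lt_succ_iff.1 (Finset.mem_range.1 hi)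
  have h2 : ‖iteratedFDeriv ℝ i φ x‖ₑ ≤ ENNReal.ofReal (C i) * ENNReal.ofReal (ρ⁻¹ ^ i) := by
    rw [← ofReal_norm, ← ENNReal.ofReal_mul' (by positivity)]
    exact ENNReal.ofReal_le_ofReal (hC i)
  have h3 : ENNReal.ofReal (ρ⁻¹ ^ i) * ENNReal.ofReal ρ ^ (k - (m - i)) ≤ 1 := by
    rw [← ENNReal.ofReal_pow hρ.le, ← ENNReal.ofReal_mul (by positivity),
      ← ENNReal.ofReal_one]
    refine ENNReal.ofReal_le_ofReal ?_
    have : k - (m - i) = i + (k - m) := by omega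
    rw [this, pow_add, ← mul_assoc, ← mul_pow, inv_mul_cancel₀ hρ.ne', one_pow, one_mul]
    exact pow_le_one₀ hρ.le hρ1
  calc (m.choose i : ENNReal) * ‖iteratedFDeriv ℝ i φ x‖ₑ * ‖iteratedFDeriv ℝ (m - i) h x‖ₑ
      ≤ (m.choose i : ENNReal) * (ENNReal.ofReal (C i) * ENNReal.ofReal (ρ⁻¹ ^ i)) *
        (ENNReal.ofReal ρ ^ (k - (m - i)) * A) := by
        refine mul_le_mul' (mul_le_mul' le_rfl h2) (hA _ (by omega))
    _ = (m.choose i : ENNReal) * ENNReal.ofReal (C i) *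
        (ENNReal.ofReal (ρ⁻¹ ^ i) * ENNReal.ofReal ρ ^ (k - (m - i))) * A := by ring
    _ ≤ (m.choose i : ENNReal) * ENNReal.ofReal (C i) * 1 * A := by
        refine mul_le_mul' (mul_le_mul' le_rfl h3) le_rfl
    _ = _ := by rw [mul_one]

lemma enorm_iteratedFDeriv_sum_smul_le {ι : Type*} (J : Finset ι) {U : Set V} (hU : IsOpen U)
    {φ : ι → V → ℝ} {h : ι → V → W} (hφ : ∀ i, ContDiff ℝ ∞ (φ i))
    (hh : ∀ i ∈ J, ContDiffOn ℝ ∞ (h i) U) {x : V} (hx : x ∈ U)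
    {C : ℕ → ℝ} {ρ : ℝ} (hρ : 0 < ρ) (hρ1 : ρ ≤ 1) {k : ℕ}
    (hC : ∀ m i x, ‖iteratedFDeriv ℝ m (φ i) x‖ ≤ C m * ρ⁻¹ ^ m) {A : ι → ENNReal}
    (hA : ∀ i ∈ J, ∀ l ≤ k, ‖iteratedFDeriv ℝ l (h i) x‖ₑ ≤ ENNReal.ofReal ρ ^ (k - l) * A i)
    {m : ℕ} (hm : m ≤ k) :
    ‖iteratedFDeriv ℝ m (fun y => ∑ i ∈ J, φ i y • h i y) x‖ₑ ≤
      leibnizConst C k * ∑ i ∈ J, A i := by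
  rw [Finset.mul_sum]
  refine (enorm_iteratedFDeriv_sum_le J (fun i hi => ?_) m).trans
    (Finset.sum_le_sum fun i hi => ?_)
  · exact (hφ i).contDiffAt.smul ((hh i hi).contDiffAt (hU.mem_nhds hx))
  · exact enorm_iteratedFDeriv_smul_le_of_scale hU (hφ i).contDiffOn (hh i hi) hx hρ hρ1
      (fun j => hC j i x) (hA i hi) hm

end Gluing

/-! ### Comparison of a function with its glued Taylor polynomials. -/

section GluedTaylor

variable {V : Type} {W : Type*} [NormedAddCommGroup V] [NormedSpace ℝ V]
  [NormedAddCommGroup W] [NormedSpace ℝ W]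

/-- Estimate for a function glued from Taylor polynomials only. -/
lemma enorm_iteratedFDeriv_sub_glued_taylor_le {ι : Type*} (J : Finset ι) {U : Set V}
    (hU : IsOpen U) {f : V → W} (hf : ContDiffOn ℝ ∞ f U) {φ : ι → V → ℝ}
    (hφ : ∀ i, ContDiff ℝ ∞ (φ i)) {x : V} (hx : x ∈ U)
    (hsum : ∀ᶠ y in nhds x, ∑ i ∈ J, φ i y = 1)
    {C : ℕ → ℝ} {ρ : ℝ} (hρ : 0 < ρ) (hρ1 : ρ ≤ 1) {k : ℕ}
    (hC : ∀ m i x, ‖iteratedFDeriv ℝ m (φ i) x‖ ≤ C m * ρ⁻¹ ^ m)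
    {y : ι → V} {i₀ : ι} (hy : y i₀ ∈ U) {R : ℝ} (hR1 : 1 ≤ R) (hR : ‖x - y i₀‖ ≤ R)
    {A : ι → ENNReal}
    (hA : ∀ i ∈ J, ∀ l ≤ k, ‖iteratedFDeriv ℝ l
      (fun z => taylorPoly k f (y i) z - taylorPoly k f (y i₀) z) x‖ₑ ≤
        ENNReal.ofReal ρ ^ (k - l) * A i) {m : ℕ} (hm : m ≤ k) :
    ‖iteratedFDeriv ℝ m (fun z => f z - ∑ i ∈ J, φ i z • taylorPoly k f (y i) z) x‖ₑ ≤
      ‖iteratedFDeriv ℝ m f x‖ₑ +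
      ENNReal.ofReal R ^ k * ∑ j ∈ Finset.range k, ‖iteratedFDeriv ℝ j f (y i₀)‖ₑ +
      leibnizConst C k * ∑ i ∈ J, A i := by
  have hT : ∀ y, ContDiff ℝ ∞ (taylorPoly k f y) := contDiff_taylorPoly k f
  -- Since the `φ i` sum to one, a reference polynomial at `y i₀` can be subtracted under the sum.
  -- Only differences of polynomials then meet derivatives of `φ i`; the term `f - taylorPoly k f (y
  -- i₀)` is bounded crudely.
  have hev : (fun z => f z - ∑ i ∈ J, φ i z • taylorPoly k f (y i) z) =ᶠ[nhds x] fun z =>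
      (f z - taylorPoly k f (y i₀) z) -
        ∑ i ∈ J, φ i z • (taylorPoly k f (y i) z - taylorPoly k f (y i₀) z) := by
    filter_upwards [hsum] with z hz
    simp only [smul_sub, Finset.sum_sub_distrib, ← Finset.sum_smul, hz, one_smul]
    abel
  have hfx := hf.contDiffAt (hU.mem_nhds hx)
  rw [(hev.iteratedFDeriv ℝ m).eq_of_nhds]
  refine (enorm_iteratedFDeriv_sub_le (hfx.sub (hT _).contDiffAt) ?_ m).trans ?_
  · exact ContDiffAt.sum fun i _ =>
      ((hφ i).smul ((hT _).sub (hT _))).contDiffAt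
  gcongr
  · refine (enorm_iteratedFDeriv_sub_le hfx (hT _).contDiffAt m).trans ?_
    gcongr
    exact enorm_iteratedFDeriv_taylorPoly_le hU hf m k hy hR hR1
  · exact enorm_iteratedFDeriv_sum_smul_le J hU hφ
      (fun i _ => ((hT _).sub (hT _)).contDiffOn) hx hρ hρ1 hC hA hm

variable [CompleteSpace W]

/-- Transport along a polygon, in the form needed for `enorm_iteratedFDeriv_sum_smul_le`. -/
lemma enorm_taylorPoly_transport_le [MeasurableSpace V] [BorelSpace V] {U : Set V} (hU : IsOpen U)
    {f : V → W} (hf : ContDiffOn ℝ ∞ f U) {k : ℕ} {G : V → ENNReal} (hG : Measurable G)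
    (hfG : ∀ y ∈ U, ‖iteratedFDeriv ℝ k f y‖ₑ ≤ G y) (P : ℕ → V) (N : ℕ) (u x : V) {ρ c : ℝ}
    (hρ : 0 < ρ) (hc : 1 ≤ c) (hz : P 0 + u ∈ U) (hz' : P N + u ∈ U)
    (hseg : ∀ s < N, ∀ t ∈ Icc (0 : ℝ) 1, P s + t • (P (s + 1) - P s) + u ∈ U)
    (hR : ∀ s < N, ∀ t ∈ Icc (0 : ℝ) 1, ‖x - (P s + t • (P (s + 1) - P s) + u)‖ ≤ c * ρ)
    {l : ℕ} (hl : l ≤ k) :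
    ‖iteratedFDeriv ℝ l (fun x => taylorPoly k f (P N + u) x - taylorPoly k f (P 0 + u) x) x‖ₑ ≤
      ENNReal.ofReal ρ ^ (k - l) * (ENNReal.ofReal c ^ k *
        (ENNReal.ofReal ρ⁻¹ * ∫⁻ y, G (y + u) ∂polyMeasure P N)) := by
  rcases hl.eq_or_lt with rfl | hl
  · refine (enorm_iteratedFDeriv_sub_le (contDiff_taylorPoly _ _ _).contDiffAt
      (contDiff_taylorPoly _ _ _).contDiffAt l).trans ?_
    rw [iteratedFDeriv_taylorPoly_eq_zero hU hf le_rfl hz,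
      iteratedFDeriv_taylorPoly_eq_zero hU hf le_rfl hz', Pi.zero_apply, enorm_zero_multilinear,
      add_zero]
    exact zero_le
  · obtain ⟨q, rfl⟩ : ∃ q, k = q + l + 1 := ⟨k - l - 1, by omega⟩
    refine (enorm_iteratedFDeriv_taylorPoly_sub_le_lintegral hU hf l q hG hfG P N u x
      hseg hR).trans ?_
    have h1 : q + l + 1 - l = q + 1 := by omega
    rw [h1, ← mul_assoc, ← mul_assoc]
    refine mul_le_mul' ?_ le_rfl
    rw [← ENNReal.ofReal_pow (by positivity), ← ENNReal.ofReal_pow (by positivity),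
      ← ENNReal.ofReal_pow (by positivity), ← ENNReal.ofReal_mul (by positivity),
      ← ENNReal.ofReal_mul (by positivity)]
    refine ENNReal.ofReal_le_ofReal ?_
    have h2 : c ^ q ≤ c ^ (q + l + 1) := pow_le_pow_right₀ hc (by omega)
    calc (c * ρ) ^ q = c ^ q * ρ ^ q := mul_pow _ _ _
      _ ≤ c ^ (q + l + 1) * ρ ^ q := by gcongr
      _ = _ := by
        rw [pow_succ ρ q]
        field_simp

/-- Comparison of a function at `x` with its Taylor polynomial at `z + u`, along the path
`z + u → x + u → x`. -/
lemma enorm_sub_taylorPoly_le [MeasurableSpace V] [BorelSpace V] {U : Set V} (hU : IsOpen U)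
    {f : V → W} (hf : ContDiffOn ℝ ∞ f U) {k : ℕ} {G : V → ENNReal} (hG : Measurable G)
    (hfG : ∀ y ∈ U, ‖iteratedFDeriv ℝ k f y‖ₑ ≤ G y) {z u x : V} {ρ c : ℝ}
    (hρ : 0 < ρ) (hc : 1 ≤ c) (hball : Metric.closedBall x (c * ρ) ⊆ U)
    (hu : ‖u‖ ≤ c * ρ / 2) (hz : ‖z - x‖ ≤ c * ρ / 2) {l : ℕ} (hl : l ≤ k) :
    ‖iteratedFDeriv ℝ l (fun y => f y - taylorPoly k f (z + u) y) x‖ₑ ≤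
      ENNReal.ofReal ρ ^ (k - l) * (ENNReal.ofReal c ^ (k + 1) *
        (G x + ((∫⁻ t in Icc (0 : ℝ) 1, G (x + t • u)) +
          ∫⁻ t in Icc (0 : ℝ) 1, G (z + t • (x - z) + u)))) := by
  have hx : x ∈ U := hball (Metric.mem_closedBall_self (by positivity))
  have hc1 : 1 ≤ ENNReal.ofReal c := by simpa using hc
  have hmem : ∀ t ∈ Icc (0 : ℝ) 1, ‖x - (x + t • u)‖ ≤ c * ρ / 2 := by
    intro t ht
    rw [sub_add_cancel_left, norm_neg, norm_smul, Real.norm_of_nonneg ht.1]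
    exact (mul_le_of_le_one_left (norm_nonneg u) ht.2).trans hu
  have hmem' : ∀ t ∈ Icc (0 : ℝ) 1, ‖x - (z + t • (x - z) + u)‖ ≤ c * ρ := by
    intro t ht
    have : x - (z + t • (x - z) + u) = -((1 - t) • (z - x) + u) := by
      module
    rw [this, norm_neg]
    refine (norm_add_le _ _).trans ?_
    rw [norm_smul, Real.norm_of_nonneg (by linarith [ht.2])]
    have := mul_le_of_le_one_left (norm_nonneg (z - x)) (by linarith [ht.1] : 1 - t ≤ 1)
    linarith
  have hcρ : 0 < c * ρ := by positivity
  have hin : ∀ w, ‖x - w‖ ≤ c * ρ → w ∈ U := fun w hw =>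
    hball (by rwa [Metric.mem_closedBall, dist_comm, dist_eq_norm])
  have hzu : z + u ∈ U := hin _ (by simpa using hmem' 0 (by simp))
  have hfx := hf.contDiffAt (hU.mem_nhds hx)
  rcases hl.eq_or_lt with rfl | hl
  · refine (enorm_iteratedFDeriv_sub_le hfx (contDiff_taylorPoly _ _ _).contDiffAt l).trans ?_
    rw [iteratedFDeriv_taylorPoly_eq_zero hU hf le_rfl hzu, Pi.zero_apply, enorm_zero_multilinear,
      add_zero, Nat.sub_self, pow_zero, one_mul]
    refine (hfG x hx).trans (le_trans ?_ (mul_le_mul_left (one_le_pow₀ hc1) _))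
    rw [one_mul]
    exact le_self_add
  · have hT : ∀ y, ContDiff ℝ ∞ (taylorPoly k f y) := contDiff_taylorPoly k f
    obtain ⟨q, hq⟩ : ∃ q, k = q + l + 1 := ⟨k - l - 1, by omega⟩
    have hself : iteratedFDeriv ℝ l (fun y => f y - taylorPoly k f x y) x = 0 := by
      rw [hq]
      exact iteratedFDeriv_sub_taylorPoly_self hU hf l q hx
    -- The route goes through `x + u` because each leg is then a translate of a fixed segment: for
    -- fixed `u`, the leg from `x` to `x + u` moves with `x`; for fixed `x`, the leg from `z + u` to
    -- `x + u` moves with `u`. The function minus its Taylor polynomial at `x` contributes nothing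
    -- at `x`.
    have hsplit : (fun y => f y - taylorPoly k f (z + u) y) = fun y =>
        (f y - taylorPoly k f x y) - ((taylorPoly k f (x + u) y - taylorPoly k f x y) -
          (taylorPoly k f (x + u) y - taylorPoly k f (z + u) y)) := by
      ext y; abel
    have h1 := enorm_taylorPoly_transport_le hU hf hG hfG
      (fun s => if s = 0 then x else x + u) 1 0 x hρ hc (by simpa using hx)
      (by simpa using hin (x + u) (by simpa using (hmem 1 (by simp)).trans (by linarith)))
      (fun s hs t ht => by
        obtain rfl : s = 0 := by omega
        simpa using hin _ ((hmem t ht).trans (by linarith)))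
      (fun s hs t ht => by
        obtain rfl : s = 0 := by omega
        simpa using (hmem t ht).trans (by linarith)) hl.le
    have h2 := enorm_taylorPoly_transport_le hU hf hG hfG
      (fun s => if s = 0 then z else x) 1 u x hρ hc (by simpa using hzu)
      (by simpa using hin (x + u) (by simpa using (hmem 1 (by simp)).trans (by linarith)))
      (fun s hs t ht => by
        obtain rfl : s = 0 := by omega
        simpa using hin _ (hmem' t ht))
      (fun s hs t ht => by
        obtain rfl : s = 0 := by omega
        simpa using hmem' t ht) hl.le
    simp only [polyMeasure, Finset.range_one, Finset.sum_singleton, add_zero, if_true, zero_add,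
      one_ne_zero, if_false] at h1 h2
    rw [lintegral_segMeasure _ _ hG, add_sub_cancel_left] at h1
    rw [lintegral_segMeasure (G := fun y => G (y + u)) _ _ (hG.comp (measurable_add_const u))] at h2
    have hle : ∀ v : V, ‖v‖ ≤ c * ρ / 2 → ENNReal.ofReal ρ⁻¹ * ‖v‖ₑ ≤ ENNReal.ofReal c := by
      intro v hv
      rw [← ofReal_norm, ← ENNReal.ofReal_mul (by positivity)]
      refine ENNReal.ofReal_le_ofReal ?_
      rw [inv_mul_le_iff₀ hρ]
      linarith
    rw [hsplit]
    refine (enorm_iteratedFDeriv_sub_le (hfx.sub (hT _).contDiffAt)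
      (((hT _).sub (hT _)).sub ((hT _).sub (hT _))).contDiffAt l).trans ?_
    rw [hself, enorm_zero_multilinear, zero_add]
    refine (enorm_iteratedFDeriv_sub_le ((hT _).sub (hT _)).contDiffAt
      ((hT _).sub (hT _)).contDiffAt l).trans ((add_le_add h1 h2).trans ?_)
    rw [← mul_add, ← mul_add, pow_succ, mul_assoc (ENNReal.ofReal c ^ k)]
    refine mul_le_mul' le_rfl (mul_le_mul' le_rfl ?_)
    rw [← mul_assoc, ← mul_assoc, mul_add, mul_add]
    refine le_trans (add_le_add ?_ ?_) le_add_self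
    · exact mul_le_mul' (hle u hu) le_rfl
    · exact mul_le_mul' (hle (x - z) (by rwa [norm_sub_rev])) le_rfl

end GluedTaylor

/-! ### Integration over the patches -/

section Patches

variable {V : Type*} [NormedAddCommGroup V] [NormedSpace ℝ V] [MeasurableSpace V] [BorelSpace V]

/-- The uniform probability measure on the segment from `a` to `a + v`. -/
def unitSegMeasure (a v : V) : Measure V :=
  (volume.restrict (Icc (0 : ℝ) 1)).map fun t => a + t • v

lemma measurable_segment_map (a v : V) : Measurable fun t : ℝ => a + t • v :=
  (by fun_prop : Continuous fun t : ℝ => a + t • v).measurable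

lemma lintegral_unitSegMeasure (a v : V) {G : V → ENNReal} (hG : Measurable G) :
    ∫⁻ y, G y ∂unitSegMeasure a v = ∫⁻ t in Icc (0 : ℝ) 1, G (a + t • v) :=
  lintegral_map hG (measurable_segment_map a v)

lemma unitSegMeasure_univ (a v : V) : unitSegMeasure a v univ = 1 := by
  simpa using lintegral_unitSegMeasure a v (measurable_const (a := (1 : ENNReal)))

instance (a v : V) : IsFiniteMeasure (unitSegMeasure a v) :=
  ⟨by rw [unitSegMeasure_univ]; exact ENNReal.one_lt_top⟩

lemma ae_unitSegMeasure {a v : V} {K : Set V} (hK : MeasurableSet K)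
    (h : ∀ t ∈ Icc (0 : ℝ) 1, a + t • v ∈ K) : ∀ᵐ y ∂unitSegMeasure a v, y ∈ K := by
  rw [unitSegMeasure, ae_map_iff (p := fun y => y ∈ K) (measurable_segment_map a v).aemeasurable hK]
  exact (ae_restrict_iff' measurableSet_Icc).2 (Filter.Eventually.of_forall h)

/-- The quantity that bounds the error of the approximation on a patch with base point `z`. -/
def patchBound (G : V → ENNReal) (z : V) (μ : Measure V) (x u : V) : ENNReal :=
  G x + (∫⁻ t in Icc (0 : ℝ) 1, G (x + t • u)) +
    (∫⁻ t in Icc (0 : ℝ) 1, G (z + t • (x - z) + u)) + ∫⁻ q, G (q + u) ∂μ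

variable [SecondCountableTopology V]

lemma measurable_lintegral_segment {G : V → ENNReal} (hG : Measurable G) :
    Measurable fun y : V × V => ∫⁻ t in Icc (0 : ℝ) 1, G (y.1 + t • y.2) := by
  refine Measurable.lintegral_prod_right' (f := fun y : (V × V) × ℝ => G (y.1.1 + y.2 • y.1.2)) ?_
  exact hG.comp
    (by fun_prop : Continuous fun y : (V × V) × ℝ => y.1.1 + y.2 • y.1.2).measurable

lemma measurable_lintegral_segment' {G : V → ENNReal} (hG : Measurable G) (z : V) :
    Measurable fun y : V × V => ∫⁻ t in Icc (0 : ℝ) 1, G (z + t • (y.1 - z) + y.2) := by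
  refine Measurable.lintegral_prod_right'
    (f := fun y : (V × V) × ℝ => G (z + y.2 • (y.1.1 - z) + y.1.2)) ?_
  exact hG.comp
    (by fun_prop : Continuous fun y : (V × V) × ℝ => z + y.2 • (y.1.1 - z) + y.1.2).measurable

lemma measurable_lintegral_translate {V : Type*} [NormedAddCommGroup V] [MeasurableSpace V]
    [BorelSpace V] [SecondCountableTopology V] {G : V → ENNReal} (hG : Measurable G) (μ : Measure V)
    [SFinite μ] : Measurable fun u : V => ∫⁻ q, G (q + u) ∂μ := by
  refine Measurable.lintegral_prod_right' (f := fun y : V × V => G (y.2 + y.1)) ?_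
  exact hG.comp (continuous_snd.add continuous_fst).measurable

lemma measurable_patchBound {G : V → ENNReal} (hG : Measurable G) (z : V) (μ : Measure V)
    [SFinite μ] : Measurable fun y : V × V => patchBound G z μ y.1 y.2 :=
  (((hG.comp measurable_fst).add (measurable_lintegral_segment hG)).add
    (measurable_lintegral_segment' hG z)).add
    ((measurable_lintegral_translate hG μ).comp measurable_snd)

lemma add_four_rpow_le {p : ℝ} (hp : 1 ≤ p) (a b c e : ENNReal) :
    (a + b + c + e) ^ p ≤ 4 ^ (p - 1) * (a ^ p + b ^ p + c ^ p + e ^ p) := by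
  have := ENNReal.rpow_sum_le_const_mul_sum_rpow (s := (Finset.univ : Finset (Fin 4)))
    ![a, b, c, e] hp
  simpa [Fin.sum_univ_four] using this

/-- Each of the four terms of `patchBound` is handled by Tonelli and a translation: by `x` for the
segment from `x` to `x + u`, by `u` for the segment near `z` and for the measure `μ`. The term `G x`
needs neither. -/
lemma lintegral_patchBound_rpow_le (ν : Measure V) [SFinite ν] [ν.IsAddLeftInvariant]
    (μ : Measure V) [IsFiniteMeasure μ] {G : V → ENNReal} (hG : Measurable G)
    {p : ℝ} (hp : 1 ≤ p) {c z : V} {r s S : ℝ} (hr : 0 < r)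
    (hsS : s + r ≤ S) (hz : dist z c < s)
    (hμ : ∀ᵐ q ∂μ, ∀ u ∈ Metric.ball (0 : V) r, q + u ∈ Metric.ball c S) :
    ∫⁻ x in Metric.ball c s, ∫⁻ u in Metric.ball 0 r, patchBound G z μ x u ^ p ∂ν ∂ν ≤
      4 ^ (p - 1) * (2 * ν (Metric.ball 0 r) + (1 + μ univ ^ p) * ν (Metric.ball c s)) *
        ∫⁻ y in Metric.ball c S, G y ^ p ∂ν := by
  set B := Metric.ball (0 : V) r with hB
  set Q := Metric.ball c s with hQ
  set I := ∫⁻ y in Metric.ball c S, G y ^ p ∂ν with hI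
  have hBm : MeasurableSet B := Metric.isOpen_ball.measurableSet
  have hQm : MeasurableSet Q := Metric.isOpen_ball.measurableSet
  have hp0 : 0 ≤ p := zero_le_one.trans hp
  have hadd : ∀ q u : V, dist q c < s → ‖u‖ < r → q + u ∈ Metric.ball c S := by
    intro q u hq hu
    rw [Metric.mem_ball, dist_eq_norm] at *
    have : q + u - c = (q - c) + u := by abel
    rw [this]
    linarith [norm_add_le (q - c) u]
  have h1 : ∫⁻ x in Q, ∫⁻ _ in B, G x ^ p ∂ν ∂ν ≤ ν B * I := by
    simp only [lintegral_const, Measure.restrict_apply_univ]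
    rw [lintegral_mul_const _ (hG.pow_const p), mul_comm]
    gcongr
    refine lintegral_mono_set (Metric.ball_subset_ball ?_)
    linarith
  have h2 : ∫⁻ x in Q, ∫⁻ u in B, (∫⁻ t in Icc (0 : ℝ) 1, G (x + t • u)) ^ p ∂ν ∂ν ≤
      ν B * I := by
    -- Here `u` is frozen first, and `x` plays the role of the translation of the segment from `0`
    -- to `u`.
    rw [lintegral_lintegral_swap ((measurable_lintegral_segment hG).pow_const p).aemeasurable]
    calc ∫⁻ u in B, ∫⁻ x in Q, (∫⁻ t in Icc (0 : ℝ) 1, G (x + t • u)) ^ p ∂ν ∂ν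
        ≤ ∫⁻ _ in B, I ∂ν := by
          refine setLIntegral_mono' hBm fun u hu => ?_
          have h := lintegral_rpow_lintegral_translate_le ν (unitSegMeasure 0 u) hG hp hQm
            (S := Metric.ball c S) (by
              refine (ae_unitSegMeasure (K := Metric.ball 0 r) hBm fun t ht => ?_).mono
                fun q hq x hx => ?_
              · rw [zero_add, mem_ball_zero_iff, norm_smul, Real.norm_of_nonneg ht.1]
                exact (mul_le_of_le_one_left (norm_nonneg u) ht.2).trans_lt
                  (mem_ball_zero_iff.1 hu)
              · rw [add_comm]
                exact hadd x q hx (mem_ball_zero_iff.1 hq))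
          rw [unitSegMeasure_univ, ENNReal.one_rpow, one_mul] at h
          refine le_trans (le_of_eq ?_) h
          refine lintegral_congr fun x => ?_
          rw [lintegral_unitSegMeasure (G := fun q => G (q + x)) _ _
            (hG.comp (measurable_add_const x))]
          simp only [zero_add, add_comm x]
      _ = ν B * I := by
          rw [lintegral_const, Measure.restrict_apply_univ, mul_comm]
  have h3 : ∫⁻ x in Q, ∫⁻ u in B, (∫⁻ t in Icc (0 : ℝ) 1, G (z + t • (x - z) + u)) ^ p ∂ν ∂ν ≤
      ν Q * I := by
    calc _ ≤ ∫⁻ _ in Q, I ∂ν := by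
          refine setLIntegral_mono' hQm fun x hx => ?_
          have h := lintegral_rpow_lintegral_translate_le ν (unitSegMeasure z (x - z)) hG hp hBm
            (S := Metric.ball c S) (by
              refine (ae_unitSegMeasure (K := Q) hQm fun t ht => ?_).mono
                fun q hq u hu => hadd q u hq (mem_ball_zero_iff.1 hu)
              refine (convex_ball c s).segment_subset (Metric.mem_ball.2 hz) hx ?_
              rw [segment_eq_image']
              exact ⟨t, ht, rfl⟩)
          rw [unitSegMeasure_univ, ENNReal.one_rpow, one_mul] at h
          refine le_trans (le_of_eq ?_) h
          refine lintegral_congr fun u => ?_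
          rw [lintegral_unitSegMeasure (G := fun q => G (q + u)) _ _
            (hG.comp (measurable_add_const u))]
      _ = ν Q * I := by
          rw [lintegral_const, Measure.restrict_apply_univ, mul_comm]
  have h4 : ∫⁻ _ in Q, ∫⁻ u in B, (∫⁻ q, G (q + u) ∂μ) ^ p ∂ν ∂ν ≤ μ univ ^ p * ν Q * I := by
    rw [lintegral_const, Measure.restrict_apply_univ, mul_right_comm]
    gcongr
    exact lintegral_rpow_lintegral_translate_le ν μ hG hp hBm hμ
  have hm1 : Measurable fun y : V × V => G y.1 ^ p := (hG.comp measurable_fst).pow_const p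
  have hm2 := (measurable_lintegral_segment hG).pow_const p
  have hm3 := (measurable_lintegral_segment' hG z).pow_const p
  have hc4 : (4 : ENNReal) ^ (p - 1) ≠ ⊤ :=
    ENNReal.rpow_ne_top_of_nonneg (by linarith) (by norm_num)
  calc ∫⁻ x in Q, ∫⁻ u in B, patchBound G z μ x u ^ p ∂ν ∂ν
      ≤ ∫⁻ x in Q, ∫⁻ u in B, 4 ^ (p - 1) * (G x ^ p +
          (∫⁻ t in Icc (0 : ℝ) 1, G (x + t • u)) ^ p +
          (∫⁻ t in Icc (0 : ℝ) 1, G (z + t • (x - z) + u)) ^ p +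
          (∫⁻ q, G (q + u) ∂μ) ^ p) ∂ν ∂ν :=
        lintegral_mono fun x => lintegral_mono fun u => add_four_rpow_le hp _ _ _ _
    _ = 4 ^ (p - 1) * ((∫⁻ x in Q, ∫⁻ _ in B, G x ^ p ∂ν ∂ν) +
          (∫⁻ x in Q, ∫⁻ u in B, (∫⁻ t in Icc (0 : ℝ) 1, G (x + t • u)) ^ p ∂ν ∂ν) +
          (∫⁻ x in Q, ∫⁻ u in B, (∫⁻ t in Icc (0 : ℝ) 1, G (z + t • (x - z) + u)) ^ p ∂ν ∂ν) +
          ∫⁻ _ in Q, ∫⁻ u in B, (∫⁻ q, G (q + u) ∂μ) ^ p ∂ν ∂ν) := by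
        simp_rw [lintegral_const_mul' _ _ hc4]
        congr 1
        have hin : ∀ x, ∫⁻ u in B, (G x ^ p +
            (∫⁻ t in Icc (0 : ℝ) 1, G (x + t • u)) ^ p +
            (∫⁻ t in Icc (0 : ℝ) 1, G (z + t • (x - z) + u)) ^ p +
            (∫⁻ q, G (q + u) ∂μ) ^ p) ∂ν = (∫⁻ _ in B, G x ^ p ∂ν) +
            (∫⁻ u in B, (∫⁻ t in Icc (0 : ℝ) 1, G (x + t • u)) ^ p ∂ν) +
            (∫⁻ u in B, (∫⁻ t in Icc (0 : ℝ) 1, G (z + t • (x - z) + u)) ^ p ∂ν) +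
            ∫⁻ u in B, (∫⁻ q, G (q + u) ∂μ) ^ p ∂ν := by
          intro x
          have e2 := hm2.comp (measurable_prodMk_left (x := x))
          have e3 := hm3.comp (measurable_prodMk_left (x := x))
          rw [lintegral_add_left, lintegral_add_left, lintegral_add_left measurable_const]
          · exact measurable_const.add e2
          · exact (measurable_const.add e2).add e3
        simp_rw [hin]
        have f1 : Measurable fun x => ∫⁻ _ in B, G x ^ p ∂ν := hm1.lintegral_prod_right'
        have f2 := hm2.lintegral_prod_right' (ν := ν.restrict B)
        have f3 := hm3.lintegral_prod_right' (ν := ν.restrict B)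
        rw [lintegral_add_left, lintegral_add_left, lintegral_add_left f1]
        · exact f1.add f2
        · exact (f1.add f2).add f3
    _ ≤ 4 ^ (p - 1) * (ν B * I + ν B * I + ν Q * I + μ univ ^ p * ν Q * I) := by gcongr
    _ = _ := by ring

end Patches

/-! ### Zero extension across the Dirichlet part -/

section ZeroExtension

variable {d : ℕ} {W : Type*} [NormedAddCommGroup W] [NormedSpace ℝ W]
  {Ω D : Set (EuclideanSpace ℝ (Fin d))} {F : EuclideanSpace ℝ (Fin d) → W} {κ : ℝ}

lemma eventuallyEq_zero_of_dist_lt {W : Type*} [Zero W] {F : EuclideanSpace ℝ (Fin d) → W} (hFD : ∀ x, ∀ w ∈ D, dist x w < κ → F x = 0)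
    {x w : EuclideanSpace ℝ (Fin d)} (hw : w ∈ D) (hx : dist x w < κ) :
    F =ᶠ[nhds x] fun _ => 0 := by
  filter_upwards [Metric.isOpen_ball.mem_nhds (Metric.mem_ball.2 hx)] with y hy
  exact hFD y w hw hy

/-- Such a point lies either off the closure of `Ω` or in `D`, and `F` vanishes near both. -/
lemma eventuallyEq_zero_of_notMem {W : Type*} [Zero W] {F : EuclideanSpace ℝ (Fin d) → W} (hF0 : ∀ x ∉ Ω, F x = 0) (hκ : 0 < κ)
    (hFD : ∀ x, ∀ w ∈ D, dist x w < κ → F x = 0) (hΩ : IsOpen Ω) {x : EuclideanSpace ℝ (Fin d)}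
    (hx : x ∉ closure (neumannPart Ω D)) (hxΩ : x ∉ Ω) : F =ᶠ[nhds x] fun _ => 0 := by
  by_cases hcl : x ∈ closure Ω
  · have hxD : x ∈ D := by
      by_contra hxD
      exact hx (subset_closure ⟨⟨hcl, by rwa [hΩ.interior_eq]⟩, hxD⟩)
    exact eventuallyEq_zero_of_dist_lt hFD hxD (by simpa using hκ)
  · filter_upwards [isClosed_closure.isOpen_compl.mem_nhds hcl] with y hy
    exact hF0 y fun h => hy (subset_closure h)

lemma contDiffOn_zeroExtension (hF0 : ∀ x ∉ Ω, F x = 0) (hκ : 0 < κ)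
    (hFD : ∀ x, ∀ w ∈ D, dist x w < κ → F x = 0) (hΩ : IsOpen Ω) (hF : ContDiffOn ℝ ∞ F Ω) :
    ContDiffOn ℝ ∞ F (closure (neumannPart Ω D))ᶜ := by
  intro x hx
  by_cases hxΩ : x ∈ Ω
  · exact (hF.contDiffAt (hΩ.mem_nhds hxΩ)).contDiffWithinAt
  · exact (contDiffAt_const.congr_of_eventuallyEq
      (eventuallyEq_zero_of_notMem hF0 hκ hFD hΩ hx hxΩ)).contDiffWithinAt

lemma Filter.EventuallyEq.iteratedFDeriv_eq_zero {x : EuclideanSpace ℝ (Fin d)}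
    (h : F =ᶠ[nhds x] fun _ => 0) (j : ℕ) : iteratedFDeriv ℝ j F x = 0 := by
  rw [(h.iteratedFDeriv ℝ j).eq_of_nhds, iteratedFDeriv_fun_zero]
  rfl

lemma taylorPoly_eq_zero_of_eventuallyEq {x : EuclideanSpace ℝ (Fin d)}
    (h : F =ᶠ[nhds x] fun _ => 0) (k : ℕ) : taylorPoly k F x = fun _ => 0 := by
  ext y
  simp [taylorPoly, h.iteratedFDeriv_eq_zero]

/-- The sum of the norms of the derivatives up to order `k`, cut off outside `Ω`. -/
def derivSum (Ω : Set (EuclideanSpace ℝ (Fin d))) (k : ℕ) (F : EuclideanSpace ℝ (Fin d) → W) :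
    EuclideanSpace ℝ (Fin d) → ENNReal :=
  Ω.indicator fun x => ∑ j ∈ Finset.range (k + 1), ‖iteratedFDeriv ℝ j F x‖ₑ

lemma continuousOn_iteratedFDeriv (hΩ : IsOpen Ω) (hF : ContDiffOn ℝ ∞ F Ω) (j : ℕ) :
    ContinuousOn (iteratedFDeriv ℝ j F) Ω :=
  (hF.continuousOn_iteratedFDerivWithin (natCast_le_infty j) hΩ.uniqueDiffOn).congr
    fun _ hz => (iteratedFDerivWithin_of_isOpen j hΩ hz).symm

lemma continuousOn_enorm_iteratedFDeriv (hΩ : IsOpen Ω) (hF : ContDiffOn ℝ ∞ F Ω) (j : ℕ) :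
    ContinuousOn (fun x => ‖iteratedFDeriv ℝ j F x‖ₑ) Ω := by
  simp_rw [← ofReal_norm]
  exact ENNReal.continuous_ofReal.comp_continuousOn (continuousOn_iteratedFDeriv hΩ hF j).norm

lemma measurable_derivSum (hΩ : IsOpen Ω) (hF : ContDiffOn ℝ ∞ F Ω) (k : ℕ) :
    Measurable (derivSum Ω k F) := by
  classical
  rw [derivSum, ← piecewise_eq_indicator]
  refine ContinuousOn.measurable_piecewise ?_ continuousOn_const hΩ.measurableSet
  exact continuousOn_finsetSum _ fun j _ => continuousOn_enorm_iteratedFDeriv hΩ hF j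

/-- Off the closure of `Γ` the cutoff in `derivSum` loses nothing, because `F` vanishes near the
points outside `Ω`. Thus `derivSum` serves as a globally measurable majorant along paths that leave
`Ω`. -/
lemma sum_enorm_iteratedFDeriv_le_derivSum (hF0 : ∀ x ∉ Ω, F x = 0) (hκ : 0 < κ)
    (hFD : ∀ x, ∀ w ∈ D, dist x w < κ → F x = 0) (hΩ : IsOpen Ω) (k : ℕ)
    {x : EuclideanSpace ℝ (Fin d)} (hx : x ∈ (closure (neumannPart Ω D))ᶜ) :
    ∑ j ∈ Finset.range (k + 1), ‖iteratedFDeriv ℝ j F x‖ₑ ≤ derivSum Ω k F x := by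
  by_cases hxΩ : x ∈ Ω
  · rw [derivSum, indicator_of_mem hxΩ]
  · refine (Finset.sum_eq_zero fun j _ => ?_).trans_le zero_le
    rw [(eventuallyEq_zero_of_notMem hF0 hκ hFD hΩ hx hxΩ).iteratedFDeriv_eq_zero]
    exact enorm_zero_multilinear

lemma lintegral_derivSum_lt_top (hΩ : IsOpen Ω) (hF : ContDiffOn ℝ ∞ F Ω) {k : ℕ} {p : ℝ}
    (hp : 1 ≤ p) (hFp : ∀ j ≤ k, ∫⁻ x in Ω, ‖iteratedFDeriv ℝ j F x‖ₑ ^ p < ⊤) :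
    ∫⁻ x, derivSum Ω k F x ^ p < ⊤ := by
  have hp0 : 0 < p := zero_lt_one.trans_le hp
  have h1 : ∀ x, derivSum Ω k F x ^ p = Ω.indicator
      (fun x => (∑ j ∈ Finset.range (k + 1), ‖iteratedFDeriv ℝ j F x‖ₑ) ^ p) x := by
    intro x
    by_cases hx : x ∈ Ω
    · simp [derivSum, hx]
    · simp [derivSum, hx, hp0]
  simp_rw [h1]
  rw [lintegral_indicator hΩ.measurableSet]
  have hm : ∀ j ∈ Finset.range (k + 1), AEMeasurable (fun x => ‖iteratedFDeriv ℝ j F x‖ₑ ^ p)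
      (volume.restrict Ω) := fun j _ =>
    ((continuousOn_enorm_iteratedFDeriv hΩ hF j).aemeasurable hΩ.measurableSet).pow_const p
  refine (lintegral_mono fun x => ENNReal.rpow_sum_le_const_mul_sum_rpow _ _ hp).trans_lt ?_
  have hc : ((Finset.range (k + 1)).card : ENNReal) ^ (p - 1) ≠ ⊤ :=
    ENNReal.rpow_ne_top_of_nonneg (by linarith) (ENNReal.natCast_ne_top _)
  rw [lintegral_const_mul' _ _ hc, lintegral_finsetSum' _ hm]
  refine ENNReal.mul_lt_top hc.lt_top (ENNReal.sum_lt_top.2 fun j hj => ?_)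
  exact hFp j (Nat.lt_succ_iff.1 (Finset.mem_range.1 hj))

/-- The energy of `F` near the Neumann part is small. -/
lemma tendsto_lintegral_thickening (hΩ : IsOpen Ω) {k : ℕ} {p : ℝ} (hp : 0 < p)
    (hfin : ∫⁻ x, derivSum Ω k F x ^ p < ⊤) :
    Filter.Tendsto (fun s => ∫⁻ x in Metric.thickening s (neumannPart Ω D), derivSum Ω k F x ^ p)
      (nhdsWithin 0 (Ioi 0)) (nhds 0) := by
  let ν : Measure (EuclideanSpace ℝ (Fin d)) := volume.withDensity fun x => derivSum Ω k F x ^ p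
  have hν : ∀ s, ν (Metric.thickening s (neumannPart Ω D)) =
      ∫⁻ x in Metric.thickening s (neumannPart Ω D), derivSum Ω k F x ^ p := fun s =>
    withDensity_apply _ Metric.isOpen_thickening.measurableSet
  -- The closure of `Γ` may have positive Lebesgue measure, but it is disjoint from the open set
  -- `Ω`, off which the density is zero.
  have hνcl : ν (closure (neumannPart Ω D)) = 0 := by
    rw [withDensity_apply _ isClosed_closure.measurableSet]
    rw [setLIntegral_congr_fun (g := 0) isClosed_closure.measurableSet, Pi.zero_def,
      lintegral_zero]
    intro x hx
    have hxΩ : x ∉ Ω := by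
      intro hxΩ
      obtain ⟨y, hyΩ, hy⟩ := mem_closure_iff.1 hx Ω hΩ hxΩ
      exact hy.1.2 (by rwa [hΩ.interior_eq])
    simp [derivSum, hxΩ, hp]
  have := tendsto_measure_thickening (μ := ν) (s := neumannPart Ω D) ⟨1, one_pos, by
    rw [hν]
    exact ((setLIntegral_le_lintegral _ _).trans_lt hfin).ne⟩
  rw [hνcl] at this
  simpa only [hν] using this

end ZeroExtension

/-! ### The approximation at a fixed scale -/

section Scale

variable {d : ℕ} {W : Type*} [NormedAddCommGroup W] [NormedSpace ℝ W]
  {Ω D : Set (EuclideanSpace ℝ (Fin d))} {F : EuclideanSpace ℝ (Fin d) → W}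

/-- `F` is smooth in `Ω`, vanishes outside `Ω` and near `D`. -/
structure IsZeroExtension (Ω D : Set (EuclideanSpace ℝ (Fin d))) (κ : ℝ)
    (F : EuclideanSpace ℝ (Fin d) → W) : Prop where
  isOpen : IsOpen Ω
  pos : 0 < κ
  eq_zero : ∀ x ∉ Ω, F x = 0
  eq_zero_near : ∀ x, ∀ w ∈ D, dist x w < κ → F x = 0
  contDiffOn : ContDiffOn ℝ ∞ F Ω

/-- A partition of unity at scale `ρ`. -/
structure IsLatticePartition (ρ R : ℝ) (C : ℕ → ℝ)
    (φ : (Fin d → ℤ) → EuclideanSpace ℝ (Fin d) → ℝ) : Prop where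
  contDiff : ∀ i, ContDiff ℝ ∞ (φ i)
  dist_lt : ∀ i x, φ i x ≠ 0 → dist x (latticePoint ρ i) < R * ρ
  finsum_eq : ∀ x, ∑ᶠ i, φ i x = 1
  norm_le : ∀ m i x, ‖iteratedFDeriv ℝ m (φ i) x‖ ≤ C m * ρ⁻¹ ^ m

/-- The indices of the patches near `Γ` and away from `D`. -/
def activeSet (Ω D : Set (EuclideanSpace ℝ (Fin d))) (κ R ρ : ℝ) : Set (Fin d → ℤ) :=
  {i | ∃ x ∈ Ω, dist x (latticePoint ρ i) < (R + 1) * ρ ∧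
    (∃ w ∈ neumannPart Ω D, dist x w < (4 * R + 7) * ρ) ∧ ∀ w ∈ D, κ / 2 ≤ dist x w}

/-- Base points in `Ω` for the active patches and polygons joining those of adjacent ones. -/
structure ScaleGeometry (Ω D : Set (EuclideanSpace ℝ (Fin d))) (κ R ρ b L : ℝ) where
  z : (Fin d → ℤ) → EuclideanSpace ℝ (Fin d)
  P : (Fin d → ℤ) → (Fin d → ℤ) → ℕ → EuclideanSpace ℝ (Fin d)
  N : (Fin d → ℤ) → (Fin d → ℤ) → ℕ
  dist_z : ∀ i ∈ activeSet Ω D κ R ρ, dist (z i) (latticePoint ρ i) ≤ (R + 2) * ρ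
  far_z : ∀ i ∈ activeSet Ω D κ R ρ, ∀ w ∈ neumannPart Ω D, 2 * b * ρ ≤ dist (z i) w
  path : ∀ i ∈ activeSet Ω D κ R ρ, ∀ j ∈ activeSet Ω D κ R ρ,
    dist (latticePoint ρ i) (latticePoint ρ j) < (2 * (R + 1)) * ρ →
      P i j 0 = z i ∧ P i j (N i j) = z j ∧
      ∑ s ∈ Finset.range (N i j), ‖P i j (s + 1) - P i j s‖ₑ ≤ ENNReal.ofReal (L * ρ) ∧
      ∀ s < N i j, ∀ t ∈ Icc (0 : ℝ) 1,
        (∀ w ∈ neumannPart Ω D, 2 * b * ρ ≤ dist (P i j s + t • (P i j (s + 1) - P i j s)) w) ∧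
        dist (P i j s + t • (P i j (s + 1) - P i j s)) (z i) ≤ L * ρ

lemma exists_scaleGeometry (hΩ : IsOpen Ω) {ε : ℝ} {δ : ENNReal} (hε : 0 < ε) (hε1 : ε ≤ 1)
    (hcar : CarrotCondition Ω D ε δ) {lam : ℝ}
    (hcomp : ∀ x ∈ Ω, (frontier (connectedComponentIn Ω x) ∩ neumannPart Ω D).Nonempty →
        ENNReal.ofReal lam * δ ≤ Metric.ediam (connectedComponentIn Ω x))
    {κ R ρ b : ℝ} (hR : 0 ≤ R) (hρ : 0 < ρ) (hb : 0 < b) (hbε : 3 * b ≤ ε / 4 / 2)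
    (hbM : 3 * b * (4 * R + 6) ≤ ε * (ε / 4 / 2) ^ 2)
    (hρκ : ε⁻¹ * ρ < κ / 2) (hρδ : ENNReal.ofReal ((4 * R + 6) * ρ) < δ)
    (hρlam : ENNReal.ofReal (2 * ρ) < ENNReal.ofReal lam * δ) :
    Nonempty (ScaleGeometry Ω D κ R ρ b (ε⁻¹ * (4 * R + 6))) := by
  have hρδ' : ENNReal.ofReal ρ < δ :=
    (ENNReal.ofReal_le_ofReal (by nlinarith)).trans_lt hρδ
  have hz : ∀ i, ∃ z, i ∈ activeSet Ω D κ R ρ → z ∈ Ω ∧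
      dist z (latticePoint ρ i) ≤ (R + 2) * ρ ∧ ∀ w ∈ neumannPart Ω D, ε / 4 * ρ ≤ dist z w := by
    intro i
    by_cases hi : i ∈ activeSet Ω D κ R ρ
    · obtain ⟨x, hxΩ, hxi, -, hxD⟩ := hi
      obtain ⟨z, hzΩ, hzx, hzΓ⟩ :=
        exists_interior_point hΩ hε hε1 hcar hcomp hρ hρκ hρδ' hρlam hxΩ hxD
      refine ⟨z, fun _ => ⟨hzΩ, ?_, hzΓ⟩⟩
      have := dist_triangle z x (latticePoint ρ i)
      linarith
    · exact ⟨0, fun h => absurd h hi⟩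
  choose z hz using hz
  have hP : ∀ i j, ∃ (P : ℕ → EuclideanSpace ℝ (Fin d)) (N : ℕ),
      i ∈ activeSet Ω D κ R ρ → j ∈ activeSet Ω D κ R ρ →
      dist (latticePoint ρ i) (latticePoint ρ j) < (2 * (R + 1)) * ρ →
      P 0 = z i ∧ P N = z j ∧
      ∑ s ∈ Finset.range N, ‖P (s + 1) - P s‖ₑ ≤
        ENNReal.ofReal (ε⁻¹ * ((4 * R + 6) * ρ)) ∧
      ∀ s < N, ∀ t ∈ Icc (0 : ℝ) 1,
        (∀ w ∈ neumannPart Ω D, 2 * b * ρ ≤ dist (P s + t • (P (s + 1) - P s)) w) ∧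
        dist (P s + t • (P (s + 1) - P s)) (z i) ≤ ε⁻¹ * ((4 * R + 6) * ρ) := by
    intro i j
    by_cases h : i ∈ activeSet Ω D κ R ρ ∧ j ∈ activeSet Ω D κ R ρ ∧
      dist (latticePoint ρ i) (latticePoint ρ j) < (2 * (R + 1)) * ρ
    · obtain ⟨hi, hj, hij⟩ := h
      obtain ⟨hi1, hi2, hi3⟩ := hz i hi
      obtain ⟨hj1, hj2, hj3⟩ := hz j hj
      -- Twice `R + 2` from base points to lattice points, plus `2 * (R + 1)` between the lattice
      -- points, gives `4 * R + 6`.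
      have hdist : dist (z i) (z j) ≤ (4 * R + 6) * ρ := by
        have h1 := dist_triangle4_right (z i) (z j) (latticePoint ρ i) (latticePoint ρ j)
        linarith
      obtain ⟨P, N, h⟩ := exists_polygon hε hcar hρ (by positivity) hb (by positivity)
        hbε hbM hρδ hi1 hj1 hdist hi3 hj3
      exact ⟨P, N, fun _ _ _ => h⟩
    · exact ⟨fun _ => 0, 0, fun h1 h2 h3 => absurd ⟨h1, h2, h3⟩ h⟩
  choose P N hP using hP
  simp only [← mul_assoc ε⁻¹] at hP
  refine ⟨⟨z, P, N, fun i hi => (hz i hi).2.1, fun i hi w hw => ?_, fun i hi j hj => hP i j hi hj⟩⟩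
  refine le_trans ?_ ((hz i hi).2.2 w hw)
  gcongr
  linarith

variable {κ R ρ b L : ℝ}

/-- A clearance of `2 * b * ρ` survives every translation by less than `b * ρ`, so all translated
base points and paths stay where `F` is smooth. -/
lemma mem_compl_closure_of_dist (hb : 0 < b) (hρ : 0 < ρ) {q u : EuclideanSpace ℝ (Fin d)}
    (hq : ∀ w ∈ neumannPart Ω D, 2 * b * ρ ≤ dist q w) (hu : ‖u‖ < b * ρ) :
    q + u ∈ (closure (neumannPart Ω D))ᶜ := by
  intro h
  obtain ⟨w, hw, hqw⟩ := Metric.mem_closure_iff.1 h (b * ρ) (by positivity)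
  have h1 := dist_triangle q (q + u) w
  rw [dist_self_add_right] at h1
  linarith [hq w hw]

namespace ScaleGeometry

variable (S : ScaleGeometry Ω D κ R ρ b L)

/-- The measure on the path points that controls the active patch `i`. -/
def patchMeasure (Nb : Finset (Fin d → ℤ)) (i : Fin d → ℤ) : Measure (EuclideanSpace ℝ (Fin d)) :=
  Measure.dirac (S.z i) + ENNReal.ofReal ρ⁻¹ • ∑ j ∈ Nb, polyMeasure (S.P i j) (S.N i j)

/-- The weight `ρ⁻¹` offsets the polygon lengths `L * ρ`, so the total mass is bounded uniformly in
the scale. -/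
lemma patchMeasure_univ_le (hρ : 0 < ρ) {Nb : Finset (Fin d → ℤ)} {i : Fin d → ℤ}
    (hi : i ∈ activeSet Ω D κ R ρ)
    (hNb : ∀ j ∈ Nb, j ∈ activeSet Ω D κ R ρ ∧
      dist (latticePoint ρ i) (latticePoint ρ j) < (2 * (R + 1)) * ρ) :
    S.patchMeasure Nb i univ ≤ 1 + Nb.card * ENNReal.ofReal L := by
  simp only [patchMeasure, Measure.coe_add, Pi.add_apply, Measure.smul_apply, smul_eq_mul,
    measure_univ, Measure.coe_finsetSum, Finset.sum_apply, polyMeasure_univ]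
  refine add_le_add le_rfl ?_
  rw [Finset.mul_sum, ← nsmul_eq_mul]
  refine Finset.sum_le_card_nsmul _ _ _ fun j hj => ?_
  calc ENNReal.ofReal ρ⁻¹ * ∑ s ∈ Finset.range (S.N i j), ‖S.P i j (s + 1) - S.P i j s‖ₑ
      ≤ ENNReal.ofReal ρ⁻¹ * ENNReal.ofReal (L * ρ) := by
        gcongr
        exact (S.path i hi j (hNb j hj).1 (hNb j hj).2).2.2.1
    _ = ENNReal.ofReal L := by
        rw [← ENNReal.ofReal_mul (by positivity)]
        congr 1
        field_simp

lemma lintegral_patchMeasure (Nb : Finset (Fin d → ℤ)) (i : Fin d → ℤ)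
    {G : EuclideanSpace ℝ (Fin d) → ENNReal} (hG : Measurable G) :
    ∫⁻ q, G q ∂S.patchMeasure Nb i = G (S.z i) +
      ENNReal.ofReal ρ⁻¹ * ∑ j ∈ Nb, ∫⁻ q, G q ∂polyMeasure (S.P i j) (S.N i j) := by
  rw [patchMeasure, lintegral_add_measure, lintegral_dirac' _ hG, lintegral_smul_measure,
    lintegral_finsetSum_measure, smul_eq_mul]

lemma dist_path_lt (hρ : 0 < ρ) {i j : Fin d → ℤ}
    (hi : i ∈ activeSet Ω D κ R ρ) (hj : j ∈ activeSet Ω D κ R ρ)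
    (hij : dist (latticePoint ρ i) (latticePoint ρ j) < (2 * (R + 1)) * ρ)
    {s : ℕ} (hs : s < S.N i j) {t : ℝ} (ht : t ∈ Icc (0 : ℝ) 1) :
    dist (S.P i j s + t • (S.P i j (s + 1) - S.P i j s)) (latticePoint ρ i) <
      (R + 3 + L) * ρ := by
  have h1 := ((S.path i hi j hj hij).2.2.2 s hs t ht).2
  have h2 := S.dist_z i hi
  have h3 := dist_triangle (S.P i j s + t • (S.P i j (s + 1) - S.P i j s)) (S.z i)
    (latticePoint ρ i)
  linarith

lemma ae_patchMeasure (hρ : 0 < ρ) (hb1 : b ≤ 1) (hL : 0 ≤ L) {Nb : Finset (Fin d → ℤ)}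
    {i : Fin d → ℤ} (hi : i ∈ activeSet Ω D κ R ρ)
    (hNb : ∀ j ∈ Nb, j ∈ activeSet Ω D κ R ρ ∧
      dist (latticePoint ρ i) (latticePoint ρ j) < (2 * (R + 1)) * ρ) :
    ∀ᵐ q ∂S.patchMeasure Nb i, ∀ u ∈ Metric.ball (0 : EuclideanSpace ℝ (Fin d)) (b * ρ),
      q + u ∈ Metric.ball (latticePoint ρ i) ((R + 4 + L) * ρ) := by
  have hm : MeasurableSet (Metric.ball (latticePoint (d := d) ρ i) ((R + 3 + L) * ρ)) :=
    Metric.isOpen_ball.measurableSet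
  have hzero : S.patchMeasure Nb i (Metric.ball (latticePoint ρ i) ((R + 3 + L) * ρ))ᶜ = 0 := by
    simp only [patchMeasure, Measure.coe_add, Pi.add_apply, Measure.smul_apply, smul_eq_mul,
      Measure.coe_finsetSum, Finset.sum_apply, add_eq_zero, mul_eq_zero, Finset.sum_eq_zero_iff]
    constructor
    · rw [Measure.dirac_apply' _ hm.compl, indicator_of_notMem]
      rw [mem_compl_iff, not_not, Metric.mem_ball]
      have := S.dist_z i hi
      nlinarith
    · right
      intro j hj
      refine polyMeasure_compl_eq_zero hm fun s hs t ht => Metric.mem_ball.2 ?_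
      exact S.dist_path_lt hρ hi (hNb j hj).1 (hNb j hj).2 hs ht
  have hae : ∀ᵐ q ∂S.patchMeasure Nb i,
      q ∈ Metric.ball (latticePoint ρ i) ((R + 3 + L) * ρ) := mem_ae_iff.2 hzero
  filter_upwards [hae] with q hq u hu
  rw [mem_ball_zero_iff] at hu
  rw [Metric.mem_ball] at hq ⊢
  have h1 := dist_triangle (q + u) q (latticePoint ρ i)
  rw [dist_self_add_left] at h1
  nlinarith

end ScaleGeometry

open Classical in
/-- The function glued from Taylor polynomials on the active patches and `F` elsewhere. -/
def glued (I : Set (Fin d → ℤ)) (φ : (Fin d → ℤ) → EuclideanSpace ℝ (Fin d) → ℝ) (k : ℕ)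
    (F : EuclideanSpace ℝ (Fin d) → W) (y : (Fin d → ℤ) → EuclideanSpace ℝ (Fin d))
    (x : EuclideanSpace ℝ (Fin d)) : W :=
  ∑ᶠ i, φ i x • if i ∈ I then taylorPoly k F (y i) x else F x

section Glued

variable {C : ℕ → ℝ} {φ : (Fin d → ℤ) → EuclideanSpace ℝ (Fin d) → ℝ}
  {y : (Fin d → ℤ) → EuclideanSpace ℝ (Fin d)}

/-- An active term is a smooth cutoff times a polynomial. In an inactive term `F` is smooth off the
closure of `Γ`, and near a point of this closure the term vanishes identically. -/
lemma contDiff_glued (hF : IsZeroExtension Ω D κ F) (hφ : IsLatticePartition ρ R C φ)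
    (hρ : 0 < ρ) (hR : 0 ≤ R) (k : ℕ) : ContDiff ℝ ∞ (glued (activeSet Ω D κ R ρ) φ k F y) := by
  classical
  refine contDiff_finsum_of_lattice (R := R) hρ (fun i x hx => hφ.dist_lt i x fun h => hx ?_)
    fun i => ?_
  · rw [h, zero_smul]
  split_ifs with hi
  · exact (hφ.contDiff i).smul (contDiff_taylorPoly k F _)
  rw [contDiff_iff_contDiffAt]
  intro x
  by_cases hx : x ∈ closure (neumannPart Ω D)
  swap
  · exact (hφ.contDiff i).contDiffAt.smul ((contDiffOn_zeroExtension hF.eq_zero hF.pos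
      hF.eq_zero_near hF.isOpen hF.contDiffOn).contDiffAt
        (isClosed_closure.isOpen_compl.mem_nhds hx))
  refine (contDiffAt_const (c := (0 : W))).congr_of_eventuallyEq ?_
  filter_upwards [Metric.ball_mem_nhds x hρ] with v hv
  by_cases hφv : φ i v = 0
  · rw [hφv, zero_smul]
  by_cases hvΩ : v ∈ Ω
  swap
  · rw [hF.eq_zero v hvΩ, smul_zero]
  -- The patch meets `Ω` close to `Γ`; it can be inactive only because the point `v` is near `D`,
  -- where `F` is zero.
  have hnot : ∃ w ∈ D, dist v w < κ / 2 := by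
    by_contra! hcon
    refine hi ⟨v, hvΩ, ?_, ?_, hcon⟩
    · have := hφ.dist_lt i v hφv
      linarith
    · rw [Metric.mem_ball, dist_comm] at hv
      obtain ⟨w, hw, hxw⟩ := Metric.mem_closure_iff.1 hx ρ hρ
      refine ⟨w, hw, ?_⟩
      have h1 := dist_triangle_left v w x
      nlinarith
  obtain ⟨w, hw, hvw⟩ := hnot
  rw [hF.eq_zero_near v w hw (by linarith [hF.pos]), smul_zero]

/-- If `x` is this close to `D`, the base point of every active patch seen at `x` is within `κ` of
`D`. Then `F` vanishes near that base point, and so does its Taylor polynomial. -/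
lemma glued_eq_zero (hF : IsZeroExtension Ω D κ F) (hφ : IsLatticePartition ρ R C φ) (k : ℕ)
    {r : ℝ} (hr : 0 ≤ r) (hy : ∀ i ∈ activeSet Ω D κ R ρ, dist (y i) (latticePoint ρ i) ≤ r)
    {x w : EuclideanSpace ℝ (Fin d)} (hw : w ∈ D) (hxw : dist x w < κ - (R * ρ + r))
    (hRρ : 0 ≤ R * ρ) : glued (activeSet Ω D κ R ρ) φ k F y x = 0 := by
  classical
  refine finsum_eq_zero_of_forall_eq_zero fun i => ?_
  by_cases hφx : φ i x = 0
  · rw [hφx, zero_smul]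
  split_ifs with hi
  · have h1 := dist_triangle4 (y i) (latticePoint ρ i) x w
    have h2 := hφ.dist_lt i x hφx
    have h3 := hy i hi
    rw [dist_comm _ x] at h1
    rw [taylorPoly_eq_zero_of_eventuallyEq
      (eventuallyEq_zero_of_dist_lt hF.eq_zero_near hw (by linarith)) k, smul_zero]
  · rw [hF.eq_zero_near x w hw (by linarith), smul_zero]

end Glued

end Scale

/-! ### Pointwise error estimates at a fixed scale. -/

section ScalePointwise

variable {d : ℕ} {W : Type*} [NormedAddCommGroup W] [NormedSpace ℝ W]
  {Ω D : Set (EuclideanSpace ℝ (Fin d))} {F : EuclideanSpace ℝ (Fin d) → W}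
  {κ R ρ b L : ℝ} {C : ℕ → ℝ} {φ : (Fin d → ℤ) → EuclideanSpace ℝ (Fin d) → ℝ}

/-- The constant in the pointwise error estimate. -/
def gluingConst (C : ℕ → ℝ) (k : ℕ) (R L : ℝ) : ENNReal :=
  1 + ENNReal.ofReal (2 * (R + 4 + L)) ^ k +
    leibnizConst C k * ENNReal.ofReal (2 * (R + 4 + L)) ^ k +
    leibnizConst C k * ENNReal.ofReal (4 * R + 6) ^ (k + 1)

lemma gluingConst_ne_top (C : ℕ → ℝ) (k : ℕ) (R L : ℝ) : gluingConst C k R L ≠ ⊤ := by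
  have h : leibnizConst C k ≠ ⊤ :=
    ENNReal.sum_ne_top.2 fun m _ => ENNReal.sum_ne_top.2 fun i _ => by finiteness
  unfold gluingConst
  finiteness

lemma sum_eventually_eq_one (hφ : IsLatticePartition ρ R C φ) (hρ : 0 < ρ)
    {x : EuclideanSpace ℝ (Fin d)} {J : Finset (Fin d → ℤ)}
    (hJ : ∀ i, i ∈ J ↔ dist x (latticePoint ρ i) < (R + 1) * ρ) :
    ∀ᶠ y in nhds x, ∑ i ∈ J, φ i y = 1 := by
  filter_upwards [Metric.ball_mem_nhds x hρ] with y hy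
  rw [← hφ.finsum_eq y, finsum_eq_sum_of_lattice hφ.dist_lt hy fun i hi => (hJ i).2 hi]

open Classical in
lemma glued_eventuallyEq (hφ : IsLatticePartition ρ R C φ) (hρ : 0 < ρ) (I : Set (Fin d → ℤ))
    (k : ℕ) (y : (Fin d → ℤ) → EuclideanSpace ℝ (Fin d)) {x : EuclideanSpace ℝ (Fin d)}
    {J : Finset (Fin d → ℤ)} (hJ : ∀ i, i ∈ J ↔ dist x (latticePoint ρ i) < (R + 1) * ρ) :
    glued I φ k F y =ᶠ[nhds x]
      fun v => ∑ i ∈ J, φ i v • if i ∈ I then taylorPoly k F (y i) v else F v := by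
  filter_upwards [Metric.ball_mem_nhds x hρ] with v hv
  exact finsum_eq_sum_of_lattice
    (F := fun i v => φ i v • if i ∈ I then taylorPoly k F (y i) v else F v)
    (fun i x hx => hφ.dist_lt i x fun h => hx (by simp only [h, zero_smul])) hv
    fun i hi => (hJ i).2 hi

lemma IsZeroExtension.contDiffOn_compl (hF : IsZeroExtension Ω D κ F) :
    ContDiffOn ℝ ∞ F (closure (neumannPart Ω D))ᶜ :=
  contDiffOn_zeroExtension hF.eq_zero hF.pos hF.eq_zero_near hF.isOpen hF.contDiffOn

lemma IsZeroExtension.sum_le_derivSum (hF : IsZeroExtension Ω D κ F) (k : ℕ)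
    {x : EuclideanSpace ℝ (Fin d)} (hx : x ∈ (closure (neumannPart Ω D))ᶜ) :
    ∑ j ∈ Finset.range (k + 1), ‖iteratedFDeriv ℝ j F x‖ₑ ≤ derivSum Ω k F x :=
  sum_enorm_iteratedFDeriv_le_derivSum hF.eq_zero hF.pos hF.eq_zero_near hF.isOpen k hx

lemma IsZeroExtension.enorm_le_derivSum (hF : IsZeroExtension Ω D κ F) {j k : ℕ} (hj : j ≤ k)
    {x : EuclideanSpace ℝ (Fin d)} (hx : x ∈ (closure (neumannPart Ω D))ᶜ) :
    ‖iteratedFDeriv ℝ j F x‖ₑ ≤ derivSum Ω k F x :=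
  (Finset.single_le_sum (f := fun j => ‖iteratedFDeriv ℝ j F x‖ₑ) (fun _ _ => zero_le)
    (Finset.mem_range.2 (Nat.lt_succ_of_le hj))).trans (hF.sum_le_derivSum k hx)

variable [CompleteSpace W]

/-- Error estimate at points near the Neumann part, where all patches are active. -/
lemma enorm_iteratedFDeriv_sub_glued_le_near (hF : IsZeroExtension Ω D κ F)
    (hφ : IsLatticePartition ρ R C φ) (S : ScaleGeometry Ω D κ R ρ b L) (hρ : 0 < ρ) (hρ1 : ρ ≤ 1)
    (hR : 0 ≤ R) (hb : 0 < b) (hb1 : b ≤ 1) (hL : 0 ≤ L) {k : ℕ}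
    {u x : EuclideanSpace ℝ (Fin d)} (hu : ‖u‖ < b * ρ)
    (hx : x ∈ (closure (neumannPart Ω D))ᶜ) {J : Finset (Fin d → ℤ)}
    (hJ : ∀ i, i ∈ J ↔ dist x (latticePoint ρ i) < (R + 1) * ρ)
    (hact : ∀ i ∈ J, i ∈ activeSet Ω D κ R ρ) {i₀ : Fin d → ℤ} (hi₀ : i₀ ∈ J)
    {Nb : Finset (Fin d → ℤ)} (hNb : ∀ j ∈ activeSet Ω D κ R ρ,
      dist (latticePoint ρ i₀) (latticePoint ρ j) < (2 * (R + 1)) * ρ → j ∈ Nb)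
    {m : ℕ} (hm : m ≤ k) :
    ‖iteratedFDeriv ℝ m (fun y => F y - glued (activeSet Ω D κ R ρ) φ k F
      (fun i => S.z i + u) y) x‖ₑ ≤ gluingConst C k R L *
        patchBound (derivSum Ω k F) (S.z i₀) (S.patchMeasure Nb i₀) x u := by
  classical
  set G := derivSum Ω k F with hGdef
  have hG : Measurable G := measurable_derivSum hF.isOpen hF.contDiffOn k
  have hGu : Measurable fun q => G (q + u) := hG.comp (measurable_add_const u)
  have hU : IsOpen (closure (neumannPart Ω D))ᶜ := isClosed_closure.isOpen_compl
  have hFU := hF.contDiffOn_compl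
  have hi₀I := hact i₀ hi₀
  -- The point `x` is within `(R + 1) * ρ` of the lattice point, path points are within `(R + 3 + L)
  -- * ρ`, and the translation adds at most `ρ`; `c` dominates the sum.
  set c := 2 * (R + 4 + L) with hc
  have hc1 : 1 ≤ c := by linarith
  have hzU : ∀ i ∈ activeSet Ω D κ R ρ, S.z i + u ∈ (closure (neumannPart Ω D))ᶜ := fun i hi =>
    mem_compl_closure_of_dist hb hρ (S.far_z i hi) hu
  have hbρ : b * ρ ≤ ρ := mul_le_of_le_one_left hρ.le hb1
  have hx₀ := (hJ i₀).1 hi₀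
  have hclose : ∀ q, dist q (latticePoint ρ i₀) < (R + 3 + L) * ρ → ‖x - (q + u)‖ ≤ c * ρ := by
    intro q hq
    have h1 := dist_triangle4_right x (q + u) (latticePoint ρ i₀) q
    have h2 := dist_triangle_right x (q + u) (latticePoint ρ i₀)
    have h3 := dist_triangle (q + u) q (latticePoint ρ i₀)
    rw [dist_self_add_left] at h3
    rw [← dist_eq_norm]
    nlinarith
  have hij : ∀ j ∈ J, dist (latticePoint ρ i₀) (latticePoint ρ j) < (2 * (R + 1)) * ρ := by
    intro j hj
    have := dist_triangle_left (latticePoint ρ i₀) (latticePoint ρ j) x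
    linarith [(hJ j).1 hj]
  have hev : (fun y => F y - glued (activeSet Ω D κ R ρ) φ k F (fun i => S.z i + u) y) =ᶠ[nhds x]
      fun y => F y - ∑ i ∈ J, φ i y • taylorPoly k F (S.z i + u) y := by
    filter_upwards [glued_eventuallyEq (F := F) hφ hρ (activeSet Ω D κ R ρ) k
      (fun i => S.z i + u) hJ] with v hv
    rw [hv]
    congr 1
    exact Finset.sum_congr rfl fun i hi => by rw [if_pos (hact i hi)]
  rw [(hev.iteratedFDeriv ℝ m).eq_of_nhds]
  have key := enorm_iteratedFDeriv_sub_glued_taylor_le J hU hFU hφ.contDiff hx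
    (sum_eventually_eq_one hφ hρ hJ) hρ hρ1 hφ.norm_le (y := fun i => S.z i + u) (i₀ := i₀)
    (hzU i₀ hi₀I) hc1
    ((hclose (S.z i₀) (by have := S.dist_z i₀ hi₀I; nlinarith)).trans
      (mul_le_of_le_one_right (by linarith) hρ1))
    (A := fun i => ENNReal.ofReal c ^ k * (ENNReal.ofReal ρ⁻¹ *
      ∫⁻ q, G (q + u) ∂polyMeasure (S.P i₀ i) (S.N i₀ i)))
    (fun i hi l hl => by
      obtain ⟨hP0, hPN, -, hP⟩ := S.path i₀ hi₀I i (hact i hi) (hij i hi)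
      have := enorm_taylorPoly_transport_le hU hFU hG (k := k)
        (fun y hy => hF.enorm_le_derivSum le_rfl hy)
        (S.P i₀ i) (S.N i₀ i) u x hρ hc1 (by rw [hP0]; exact hzU i₀ hi₀I)
        (by rw [hPN]; exact hzU i (hact i hi))
        (fun s hs t ht => mem_compl_closure_of_dist hb hρ (hP s hs t ht).1 hu)
        (fun s hs t ht => hclose _ (S.dist_path_lt hρ hi₀I (hact i hi) (hij i hi) hs ht)) hl
      rwa [hP0, hPN] at this) hm
  refine key.trans ?_
  have hint : ∫⁻ q, G (q + u) ∂S.patchMeasure Nb i₀ = G (S.z i₀ + u) + ENNReal.ofReal ρ⁻¹ *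
      ∑ j ∈ Nb, ∫⁻ q, G (q + u) ∂polyMeasure (S.P i₀ j) (S.N i₀ j) :=
    S.lintegral_patchMeasure Nb i₀ hGu
  set T := patchBound G (S.z i₀) (S.patchMeasure Nb i₀) x u with hT
  have hT1 : G x ≤ T := by
    rw [hT, patchBound, add_assoc, add_assoc]
    exact le_self_add
  have hT2 : ∫⁻ q, G (q + u) ∂S.patchMeasure Nb i₀ ≤ T := le_add_self
  have e1 : ‖iteratedFDeriv ℝ m F x‖ₑ ≤ T := (hF.enorm_le_derivSum hm hx).trans hT1
  have e2 : ∑ j ∈ Finset.range k, ‖iteratedFDeriv ℝ j F (S.z i₀ + u)‖ₑ ≤ T := by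
    refine (Finset.sum_le_sum_of_subset (Finset.range_mono k.le_succ)).trans
      ((hF.sum_le_derivSum k (hzU i₀ hi₀I)).trans (le_trans ?_ hT2))
    rw [hint]
    exact le_self_add
  -- `J` depends on `x`, whereas `Nb` depends only on `i₀`. Enlarging the sum to `Nb` makes the
  -- measure in `patchBound` independent of `x`.
  have e3 : ∑ i ∈ J, ENNReal.ofReal c ^ k * (ENNReal.ofReal ρ⁻¹ *
      ∫⁻ q, G (q + u) ∂polyMeasure (S.P i₀ i) (S.N i₀ i)) ≤ ENNReal.ofReal c ^ k * T := by
    rw [← Finset.mul_sum, ← Finset.mul_sum]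
    refine mul_le_mul' le_rfl (le_trans ?_ hT2)
    rw [hint]
    refine le_trans (mul_le_mul' le_rfl ?_) le_add_self
    exact Finset.sum_le_sum_of_subset fun j hj => hNb j (hact j hj) (hij j hj)
  calc _ ≤ T + ENNReal.ofReal c ^ k * T + leibnizConst C k * (ENNReal.ofReal c ^ k * T) :=
        add_le_add (add_le_add e1 (mul_le_mul' le_rfl e2)) (mul_le_mul' le_rfl e3)
    _ = (1 + ENNReal.ofReal c ^ k + leibnizConst C k * ENNReal.ofReal c ^ k) * T := by ring
    _ ≤ gluingConst C k R L * T := mul_le_mul' le_self_add le_rfl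

/-- Error estimate at points away from the Neumann part. -/
lemma enorm_iteratedFDeriv_sub_glued_le_far (hF : IsZeroExtension Ω D κ F)
    (hφ : IsLatticePartition ρ R C φ) (S : ScaleGeometry Ω D κ R ρ b L) (hρ : 0 < ρ) (hρ1 : ρ ≤ 1)
    (hR : 0 ≤ R) (hb1 : b ≤ 1) {k : ℕ}
    {u x : EuclideanSpace ℝ (Fin d)} (hu : ‖u‖ < b * ρ)
    (hfar : ∀ w ∈ neumannPart Ω D, (4 * R + 7) * ρ ≤ dist x w) {J : Finset (Fin d → ℤ)}
    (hJ : ∀ i, i ∈ J ↔ dist x (latticePoint ρ i) < (R + 1) * ρ)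
    {J' : Finset (Fin d → ℤ)} (hJ' : ∀ i, i ∈ J' ↔ i ∈ J ∧ i ∈ activeSet Ω D κ R ρ)
    (μ : (Fin d → ℤ) → Measure (EuclideanSpace ℝ (Fin d))) {m : ℕ} (hm : m ≤ k) :
    ‖iteratedFDeriv ℝ m (fun y => F y - glued (activeSet Ω D κ R ρ) φ k F
      (fun i => S.z i + u) y) x‖ₑ ≤ gluingConst C k R L *
        ∑ i ∈ J', patchBound (derivSum Ω k F) (S.z i) (μ i) x u := by
  classical
  set G := derivSum Ω k F with hGdef
  have hG : Measurable G := measurable_derivSum hF.isOpen hF.contDiffOn k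
  have hU : IsOpen (closure (neumannPart Ω D))ᶜ := isClosed_closure.isOpen_compl
  have hFU := hF.contDiffOn_compl
  -- The radius is twice `(2 * R + 3) * ρ`, the bound for the distance from `x` to the base point of
  -- a patch seen at `x`, as `enorm_sub_taylorPoly_le` requires. The threshold `4 * R + 7` leaves
  -- one further `ρ` to `Γ`.
  have hball : Metric.closedBall x ((4 * R + 6) * ρ) ⊆ (closure (neumannPart Ω D))ᶜ := by
    intro q hq hq'
    obtain ⟨w, hw, hqw⟩ := Metric.mem_closure_iff.1 hq' ρ hρ
    have h1 := dist_triangle_left x w q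
    rw [Metric.mem_closedBall] at hq
    linarith [hfar w hw]
  have hx : x ∈ (closure (neumannPart Ω D))ᶜ :=
    hball (Metric.mem_closedBall_self (by positivity))
  -- Writing `F` as the sum of the `φ i • F` cancels all inactive patches.
  have hev : (fun y => F y - glued (activeSet Ω D κ R ρ) φ k F (fun i => S.z i + u) y) =ᶠ[nhds x]
      fun y => ∑ i ∈ J', φ i y • (F y - taylorPoly k F (S.z i + u) y) := by
    filter_upwards [glued_eventuallyEq (F := F) hφ hρ (activeSet Ω D κ R ρ) k
      (fun i => S.z i + u) hJ, sum_eventually_eq_one hφ hρ hJ] with v hv hv1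
    have hJJ : J' = J.filter (· ∈ activeSet Ω D κ R ρ) := by
      ext i; simp [hJ']
    have hFv : F v = ∑ i ∈ J, φ i v • F v := by rw [← Finset.sum_smul, hv1, one_smul]
    rw [hv]
    nth_rw 1 [hFv]
    rw [← Finset.sum_sub_distrib, hJJ, Finset.sum_filter]
    refine Finset.sum_congr rfl fun i _ => ?_
    split_ifs
    · rw [smul_sub]
    · rw [sub_self]
  rw [(hev.iteratedFDeriv ℝ m).eq_of_nhds]
  have hbρ : b * ρ ≤ ρ := mul_le_of_le_one_left hρ.le hb1
  have key := enorm_iteratedFDeriv_sum_smul_le J' hU hφ.contDiff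
    (h := fun i y => F y - taylorPoly k F (S.z i + u) y)
    (fun i _ => hFU.sub (contDiff_taylorPoly _ _ _).contDiffOn) hx hρ hρ1 hφ.norm_le
    (A := fun i => ENNReal.ofReal (4 * R + 6) ^ (k + 1) *
        (G x + ((∫⁻ t in Icc (0 : ℝ) 1, G (x + t • u)) +
          ∫⁻ t in Icc (0 : ℝ) 1, G (S.z i + t • (x - S.z i) + u))))
    (fun i hi l hl => enorm_sub_taylorPoly_le hU hFU hG
      (fun y hy => hF.enorm_le_derivSum le_rfl hy) hρ (by linarith) hball (by nlinarith) (by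
        rw [← dist_eq_norm]
        have h1 := S.dist_z i ((hJ' i).1 hi).2
        have h2 := (hJ i).1 ((hJ' i).1 hi).1
        have h3 := dist_triangle_right (S.z i) x (latticePoint ρ i)
        linarith) hl) hm
  refine key.trans ?_
  rw [← Finset.mul_sum, ← mul_assoc]
  refine mul_le_mul' le_add_self (Finset.sum_le_sum fun i _ => ?_)
  rw [patchBound, ← add_assoc]
  exact le_self_add

/-- Within `κ / 2` of `D` both functions vanish. Away from `D` but near `Γ`, every patch seen at `x`
is active, and any one of them provides the bound. The remaining points fall under the far estimate.
-/
lemma exists_patchBound (hF : IsZeroExtension Ω D κ F)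
    (hφ : IsLatticePartition ρ R C φ) (S : ScaleGeometry Ω D κ R ρ b L) (hρ : 0 < ρ) (hρ1 : ρ ≤ 1)
    (hR : 0 ≤ R) (hb : 0 < b) (hb1 : b ≤ 1) (hL : 0 ≤ L) (hκ : (2 * R + 3) * ρ < κ / 2) (k : ℕ)
    {u x : EuclideanSpace ℝ (Fin d)} (hu : ‖u‖ < b * ρ) (hx : x ∈ Ω) {J : Finset (Fin d → ℤ)}
    (hJ : ∀ i, i ∈ J ↔ dist x (latticePoint ρ i) < (R + 1) * ρ)
    {Nb : (Fin d → ℤ) → Finset (Fin d → ℤ)} (hNb : ∀ i, ∀ j ∈ activeSet Ω D κ R ρ,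
      dist (latticePoint ρ i) (latticePoint ρ j) < (2 * (R + 1)) * ρ → j ∈ Nb i)
    {m : ℕ} (hm : m ≤ k) {J' : Finset (Fin d → ℤ)}
    (hJ' : ∀ i, i ∈ J' ↔ i ∈ J ∧ i ∈ activeSet Ω D κ R ρ) :
    ‖iteratedFDeriv ℝ m (fun y => F y - glued (activeSet Ω D κ R ρ) φ k F
        (fun i => S.z i + u) y) x‖ₑ ≤ gluingConst C k R L *
          ∑ i ∈ J', patchBound (derivSum Ω k F) (S.z i) (S.patchMeasure (Nb i) i) x u := by
  classical
  have hxU : x ∈ (closure (neumannPart Ω D))ᶜ := by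
    intro h
    obtain ⟨y, hyΩ, hy⟩ := mem_closure_iff.1 h Ω hF.isOpen hx
    exact hy.1.2 (by rwa [hF.isOpen.interior_eq])
  by_cases hxD : ∃ w ∈ D, dist x w < κ / 2
  · obtain ⟨w, hw, hxw⟩ := hxD
    have hev : (fun y => F y - glued (activeSet Ω D κ R ρ) φ k F (fun i => S.z i + u) y)
        =ᶠ[nhds x] fun _ => 0 := by
      filter_upwards [Metric.isOpen_ball.mem_nhds (Metric.mem_ball.2 hxw)] with y hy
      rw [Metric.mem_ball] at hy
      rw [hF.eq_zero_near y w hw (by linarith [hF.pos]),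
        glued_eq_zero hF hφ k (r := (R + 3) * ρ) (by positivity) (fun i hi => ?_) hw
          (by linarith) (by positivity), sub_zero]
      have h1 := dist_triangle (S.z i + u) (S.z i) (latticePoint ρ i)
      rw [dist_self_add_left] at h1
      have h2 := S.dist_z i hi
      nlinarith
    rw [Filter.EventuallyEq.iteratedFDeriv_eq_zero hev, enorm_zero_multilinear]
    exact zero_le
  push Not at hxD
  by_cases hnear : ∃ w ∈ neumannPart Ω D, dist x w < (4 * R + 7) * ρ
  · have hact : ∀ i ∈ J, i ∈ activeSet Ω D κ R ρ := fun i hi => ⟨x, hx, (hJ i).1 hi, hnear, hxD⟩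
    have hne : J.Nonempty := by
      by_contra hne
      rw [Finset.not_nonempty_iff_eq_empty] at hne
      have := (sum_eventually_eq_one hφ hρ hJ).self_of_nhds
      simp [hne] at this
    obtain ⟨i₀, hi₀⟩ := hne
    refine (enorm_iteratedFDeriv_sub_glued_le_near hF hφ S hρ hρ1 hR hb hb1 hL hu hxU hJ hact hi₀
        (hNb i₀) hm).trans (mul_le_mul' le_rfl ?_)
    exact Finset.single_le_sum (f := fun i => patchBound (derivSum Ω k F) (S.z i)
      (S.patchMeasure (Nb i) i) x u) (fun _ _ => zero_le) ((hJ' i₀).2 ⟨hi₀, hact i₀ hi₀⟩)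
  · push Not at hnear
    exact enorm_iteratedFDeriv_sub_glued_le_far hF hφ S hρ hρ1 hR hb1 hu hnear hJ hJ' _ hm

end ScalePointwise

/-! ### Averaging over the base points -/

lemma tsum_setLIntegral_le_of_overlap {X ι : Type*} [MeasurableSpace X] (ν : Measure X)
    [Countable ι] {B : ι → Set X} (hB : ∀ i, MeasurableSet (B i)) {T : Set X}
    (hT : MeasurableSet T) (hBT : ∀ i, B i ⊆ T) {N : ℕ}
    (hN : ∀ x, ∃ J : Finset ι, J.card ≤ N ∧ ∀ i, x ∈ B i → i ∈ J)
    {H : X → ENNReal} (hH : Measurable H) :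
    ∑' i, ∫⁻ x in B i, H x ∂ν ≤ N * ∫⁻ x in T, H x ∂ν := by
  simp_rw [← lintegral_indicator (hB _), ← lintegral_indicator hT]
  rw [← lintegral_tsum fun i => (hH.indicator (hB i)).aemeasurable,
    ← lintegral_const_mul' _ _ (ENNReal.natCast_ne_top N)]
  refine lintegral_mono fun x => ?_
  obtain ⟨J, hJN, hJ⟩ := hN x
  rw [tsum_eq_sum (s := J) fun i hi => indicator_of_notMem (fun h => hi (hJ i h)) _]
  refine (Finset.sum_le_card_nsmul _ _ (T.indicator H x) fun i _ =>
    indicator_le_indicator_of_subset (hBT i) (fun _ => zero_le) x).trans ?_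
  rw [nsmul_eq_mul]
  gcongr

section Averaging

variable {d : ℕ} {W : Type*} [NormedAddCommGroup W] [NormedSpace ℝ W]
  {Ω D : Set (EuclideanSpace ℝ (Fin d))} {F : EuclideanSpace ℝ (Fin d) → W}
  {κ R ρ b L : ℝ} {C : ℕ → ℝ} {φ : (Fin d → ℤ) → EuclideanSpace ℝ (Fin d) → ℝ}

/-- An active patch has a point within `(4 * R + 7) * ρ` of `Γ` and within `(R + 1) * ρ` of its
lattice point, which accounts for the width `s + (5 * R + 8)`; the balls overlap at most `N` times.
-/
lemma tsum_active_lintegral_le {s : ℝ} {N : ℕ}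
    (hN : ∀ x : EuclideanSpace ℝ (Fin d), ∃ J : Finset (Fin d → ℤ), J.card ≤ N ∧
      ∀ i, i ∈ J ↔ dist x (latticePoint ρ i) < s * ρ)
    {H : EuclideanSpace ℝ (Fin d) → ENNReal} (hH : Measurable H) :
    ∑' i : activeSet Ω D κ R ρ, ∫⁻ x in Metric.ball (latticePoint ρ i) (s * ρ), H x ≤
      N * ∫⁻ x in Metric.thickening ((s + (5 * R + 8)) * ρ) (neumannPart Ω D), H x := by
  classical
  refine tsum_setLIntegral_le_of_overlap volume (fun i => Metric.isOpen_ball.measurableSet)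
    Metric.isOpen_thickening.measurableSet (fun i q hq => ?_) (fun x => ?_) hH
  · obtain ⟨x, -, hx, ⟨w, hw, hxw⟩, -⟩ := i.2
    rw [Metric.mem_thickening_iff]
    refine ⟨w, hw, ?_⟩
    rw [Metric.mem_ball] at hq
    have h1 := dist_triangle4_right q w (latticePoint ρ (i : Fin d → ℤ)) x
    have h2 := dist_triangle q (latticePoint ρ (i : Fin d → ℤ)) w
    have h3 := dist_triangle_left (latticePoint ρ (i : Fin d → ℤ)) w x
    nlinarith
  · obtain ⟨J, hJN, hJ⟩ := hN x
    refine ⟨J.subtype (· ∈ activeSet Ω D κ R ρ), ?_, fun i hi => ?_⟩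
    · rw [Finset.card_subtype]
      exact (Finset.card_filter_le _ _).trans hJN
    · rw [Finset.mem_subtype]
      exact (hJ i).2 hi

/-- The constant in the averaged error estimate. -/
def averagingConst (d : ℕ) (C : ℕ → ℝ) (k : ℕ) (R L b p : ℝ) (N₁ N₂ N₃ : ℕ) : ENNReal :=
  gluingConst C k R L ^ p * (N₁ : ENNReal) ^ (p - 1) *
    (4 ^ (p - 1) * (2 + (1 + (1 + N₂ * ENNReal.ofReal L) ^ p) *
      ENNReal.ofReal (((R + 3) / b) ^ d)) * N₃)

lemma averagingConst_ne_top {p : ℝ} (hp : 1 ≤ p) (C : ℕ → ℝ) (k : ℕ) (R L b : ℝ)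
    (N₁ N₂ N₃ : ℕ) : averagingConst d C k R L b p N₁ N₂ N₃ ≠ ⊤ := by
  have h0 : 0 ≤ p := zero_le_one.trans hp
  have h1 : 0 ≤ p - 1 := sub_nonneg.2 hp
  have := gluingConst_ne_top C k R L
  unfold averagingConst
  refine ENNReal.mul_ne_top (ENNReal.mul_ne_top (ENNReal.rpow_ne_top_of_nonneg h0 this)
    (ENNReal.rpow_ne_top_of_nonneg h1 (by finiteness))) (ENNReal.mul_ne_top (ENNReal.mul_ne_top
      (ENNReal.rpow_ne_top_of_nonneg h1 (by finiteness)) (ENNReal.add_ne_top.2 ⟨by finiteness,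
        ENNReal.mul_ne_top (ENNReal.add_ne_top.2 ⟨by finiteness,
          ENNReal.rpow_ne_top_of_nonneg h0 (by finiteness)⟩) (by finiteness)⟩)) (by finiteness))

variable [CompleteSpace W]

/-- The total patch error is a function of the translation `u`, with average bounded by the energy
near `Γ`; some `u` does not exceed the average. One `u` serves all patches at once, and all orders
`m ≤ k` because `patchBound` does not depend on `m`. -/
lemma exists_lintegral_sub_glued_le (hF : IsZeroExtension Ω D κ F) {p : ℝ} (hp : 1 ≤ p)
    (hφ : IsLatticePartition ρ R C φ) (S : ScaleGeometry Ω D κ R ρ b L) (hρ : 0 < ρ) (hρ1 : ρ ≤ 1)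
    (hR : 0 ≤ R) (hb : 0 < b) (hb1 : b ≤ 1) (hL : 0 ≤ L) (hκ : (2 * R + 3) * ρ < κ / 2) (k : ℕ)
    {N₁ N₂ N₃ : ℕ}
    (hN₁ : ∀ x : EuclideanSpace ℝ (Fin d), ∃ J : Finset (Fin d → ℤ), J.card ≤ N₁ ∧
      ∀ i, i ∈ J ↔ dist x (latticePoint ρ i) < (R + 1) * ρ)
    (hN₂ : ∀ x : EuclideanSpace ℝ (Fin d), ∃ J : Finset (Fin d → ℤ), J.card ≤ N₂ ∧
      ∀ i, i ∈ J ↔ dist x (latticePoint ρ i) < (2 * (R + 1)) * ρ)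
    (hN₃ : ∀ x : EuclideanSpace ℝ (Fin d), ∃ J : Finset (Fin d → ℤ), J.card ≤ N₃ ∧
      ∀ i, i ∈ J ↔ dist x (latticePoint ρ i) < (R + 4 + L) * ρ) :
    ∃ u : EuclideanSpace ℝ (Fin d), ‖u‖ < b * ρ ∧ ∀ m ≤ k,
      ∫⁻ x in Ω, ‖iteratedFDeriv ℝ m (fun y => F y - glued (activeSet Ω D κ R ρ) φ k F
        (fun i => S.z i + u) y) x‖ₑ ^ p ≤ averagingConst d C k R L b p N₁ N₂ N₃ *
          ∫⁻ x in Metric.thickening ((R + 4 + L + (5 * R + 8)) * ρ) (neumannPart Ω D),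
            derivSum Ω k F x ^ p := by
  classical
  have hp0 : 0 ≤ p := zero_le_one.trans hp
  set G := derivSum Ω k F with hGdef
  have hG : Measurable G := measurable_derivSum hF.isOpen hF.contDiffOn k
  choose J₂ hJ₂N hJ₂ using hN₂
  let Nb : (Fin d → ℤ) → Finset (Fin d → ℤ) := fun i =>
    (J₂ (latticePoint ρ i)).filter (· ∈ activeSet Ω D κ R ρ)
  have hNb : ∀ i, ∀ j ∈ Nb i, j ∈ activeSet Ω D κ R ρ ∧
      dist (latticePoint ρ i) (latticePoint ρ j) < (2 * (R + 1)) * ρ := fun i j hj =>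
    ⟨(Finset.mem_filter.1 hj).2, (hJ₂ _ j).1 (Finset.mem_filter.1 hj).1⟩
  have hNb' : ∀ i, ∀ j ∈ activeSet Ω D κ R ρ,
      dist (latticePoint ρ i) (latticePoint ρ j) < (2 * (R + 1)) * ρ → j ∈ Nb i := fun i j hj h =>
    Finset.mem_filter.2 ⟨(hJ₂ _ j).2 h, hj⟩
  set M : ENNReal := 1 + N₂ * ENNReal.ofReal L with hM
  have hμM : ∀ i : activeSet Ω D κ R ρ, S.patchMeasure (Nb i) i univ ≤ M := fun i =>
    (S.patchMeasure_univ_le hρ i.2 (hNb i)).trans (by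
      rw [hM]
      gcongr
      exact (Finset.card_filter_le _ _).trans (hJ₂N _))
  have hfin : ∀ i : activeSet Ω D κ R ρ, IsFiniteMeasure (S.patchMeasure (Nb i) i) := fun i =>
    ⟨(hμM i).trans_lt (by rw [hM]; finiteness)⟩
  -- The radius `R + 3` makes the ball contain both the base point and all points `x` that see the
  -- patch, hence by convexity the segments between them.
  set Q : (Fin d → ℤ) → Set (EuclideanSpace ℝ (Fin d)) :=
    fun i => Metric.ball (latticePoint ρ i) ((R + 3) * ρ) with hQ
  set Bu : Set (EuclideanSpace ℝ (Fin d)) := Metric.ball 0 (b * ρ) with hBu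
  have hBu0 : volume Bu ≠ 0 := (Metric.measure_ball_pos volume _ (by positivity)).ne'
  have hBut : volume Bu ≠ ⊤ := measure_ball_lt_top.ne
  set Θ : (i : activeSet Ω D κ R ρ) → EuclideanSpace ℝ (Fin d) → EuclideanSpace ℝ (Fin d) →
    ENNReal := fun i x u => patchBound G (S.z i) (S.patchMeasure (Nb i) i) x u ^ p with hΘ
  have hΘm : ∀ i, Measurable fun y : EuclideanSpace ℝ (Fin d) × EuclideanSpace ℝ (Fin d) =>
      Θ i y.1 y.2 := fun i => (measurable_patchBound hG _ _).pow_const p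
  set H : EuclideanSpace ℝ (Fin d) → ENNReal :=
    fun u => ∑' i : activeSet Ω D κ R ρ, ∫⁻ x in Q (i : Fin d → ℤ), Θ i x u with hH
  have hHm : ∀ i : activeSet Ω D κ R ρ,
      Measurable fun u => ∫⁻ x in Q (i : Fin d → ℤ), Θ i x u := fun i =>
    (hΘm i).lintegral_prod_left'
  obtain ⟨u, hu, hHu⟩ := exists_le_setLAverage (f := H) hBu0 hBut
    (Measurable.tsum hHm).aemeasurable
  set K : ENNReal := 4 ^ (p - 1) * (2 + (1 + M ^ p) * ENNReal.ofReal (((R + 3) / b) ^ d)) with hK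
  set T := ∫⁻ x in Metric.thickening ((R + 4 + L + (5 * R + 8)) * ρ) (neumannPart Ω D), G x ^ p
    with hT
  -- Patch and translation ball have volumes in a fixed ratio, so dividing by `volume Bu` in the
  -- average leaves a constant free of `ρ`.
  have hvol : ∀ i, volume (Q i) = ENNReal.ofReal (((R + 3) / b) ^ d) * volume Bu := by
    intro i
    have e : (R + 3) * ρ = (R + 3) / b * (b * ρ) := by field_simp
    rw [hQ, hBu, Measure.addHaar_ball_center, e, Measure.addHaar_ball_mul_of_pos volume _ (by positivity), finrank_euclideanSpace_fin]
  have hHT : H u ≤ K * N₃ * T := by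
    refine hHu.trans ?_
    rw [setLAverage_eq, ENNReal.div_le_iff hBu0 hBut, hH,
      lintegral_tsum fun i => (hHm i).aemeasurable]
    calc ∑' i : activeSet Ω D κ R ρ, ∫⁻ u in Bu, ∫⁻ x in Q i, Θ i x u
        ≤ ∑' i : activeSet Ω D κ R ρ, K * volume Bu *
            ∫⁻ y in Metric.ball (latticePoint ρ i) ((R + 4 + L) * ρ), G y ^ p := by
          refine ENNReal.tsum_le_tsum fun i => ?_
          rw [lintegral_lintegral_swap (f := fun u x => Θ i x u)
            (((hΘm i).comp measurable_swap).aemeasurable)]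
          refine (lintegral_patchBound_rpow_le volume _ hG hp (by positivity) (by nlinarith)
            ((S.dist_z i i.2).trans_lt (by linarith))
            (S.ae_patchMeasure hρ hb1 hL i.2 (hNb i))).trans ?_
          refine mul_le_mul' ?_ le_rfl
          have := hvol i
          rw [hQ] at this
          dsimp only at this
          rw [this, hK, mul_assoc]
          refine mul_le_mul' le_rfl ?_
          rw [add_mul 2, mul_assoc (1 + M ^ p)]
          refine add_le_add le_rfl (mul_le_mul' (add_le_add le_rfl ?_) le_rfl)
          exact ENNReal.rpow_le_rpow (hμM i) hp0
      _ ≤ K * volume Bu * (N₃ * T) := by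
          rw [ENNReal.tsum_mul_left]
          exact mul_le_mul' le_rfl (tsum_active_lintegral_le hN₃ (hG.pow_const p))
      _ = K * N₃ * T * volume Bu := by ring
  refine ⟨u, mem_ball_zero_iff.1 hu, fun m hm => ?_⟩
  have hpt : ∀ x ∈ Ω, ‖iteratedFDeriv ℝ m (fun y => F y - glued (activeSet Ω D κ R ρ) φ k F
      (fun i => S.z i + u) y) x‖ₑ ^ p ≤ gluingConst C k R L ^ p * (N₁ : ENNReal) ^ (p - 1) *
        ∑' i : activeSet Ω D κ R ρ, (Q i).indicator (fun x => Θ i x u) x := by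
    intro x hx
    obtain ⟨J, hJN, hJ⟩ := hN₁ x
    set J' := J.filter (· ∈ activeSet Ω D κ R ρ) with hJ'
    have h1 := exists_patchBound hF hφ S hρ hρ1 hR hb hb1 hL hκ k (mem_ball_zero_iff.1 hu) hx hJ
      hNb' hm (J' := J') fun i => by rw [hJ', Finset.mem_filter]
    refine (ENNReal.rpow_le_rpow h1 hp0).trans ?_
    rw [ENNReal.mul_rpow_of_nonneg _ _ hp0, mul_assoc]
    refine mul_le_mul' le_rfl ((ENNReal.rpow_sum_le_const_mul_sum_rpow _ _ hp).trans ?_)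
    refine mul_le_mul' (ENNReal.rpow_le_rpow ?_ (sub_nonneg.2 hp)) ?_
    · exact_mod_cast (Finset.card_filter_le _ _).trans hJN
    · rw [← Finset.sum_subtype_of_mem (p := (· ∈ activeSet Ω D κ R ρ)) _
        fun i hi => (Finset.mem_filter.1 hi).2]
      refine le_trans (Finset.sum_le_sum fun i hi => ?_) (ENNReal.sum_le_tsum
        (J'.subtype (· ∈ activeSet Ω D κ R ρ)))
      rw [Finset.mem_subtype] at hi
      rw [indicator_of_mem]
      have := (hJ i).1 (Finset.mem_filter.1 hi).1
      rw [hQ, Metric.mem_ball]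
      nlinarith
  calc ∫⁻ x in Ω, ‖iteratedFDeriv ℝ m (fun y => F y - glued (activeSet Ω D κ R ρ) φ k F
        (fun i => S.z i + u) y) x‖ₑ ^ p
      ≤ ∫⁻ x in Ω, gluingConst C k R L ^ p * (N₁ : ENNReal) ^ (p - 1) *
        ∑' i : activeSet Ω D κ R ρ, (Q i).indicator (fun x => Θ i x u) x :=
        setLIntegral_mono' hF.isOpen.measurableSet hpt
    _ ≤ ∫⁻ x, gluingConst C k R L ^ p * (N₁ : ENNReal) ^ (p - 1) *
        ∑' i : activeSet Ω D κ R ρ, (Q i).indicator (fun x => Θ i x u) x :=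
        setLIntegral_le_lintegral _ _
    _ = gluingConst C k R L ^ p * (N₁ : ENNReal) ^ (p - 1) * H u := by
        have hind : ∀ i : activeSet Ω D κ R ρ, Measurable ((Q i).indicator fun x => Θ i x u) :=
          fun i => ((hΘm i).comp (measurable_id.prodMk measurable_const)).indicator
            Metric.isOpen_ball.measurableSet
        rw [lintegral_const_mul _ (Measurable.tsum hind),
          lintegral_tsum fun i => (hind i).aemeasurable, hH]
        congr 1
        exact tsum_congr fun i => lintegral_indicator Metric.isOpen_ball.measurableSet _
    _ ≤ gluingConst C k R L ^ p * (N₁ : ENNReal) ^ (p - 1) * (K * N₃ * T) :=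
        mul_le_mul' le_rfl hHT
    _ = averagingConst d C k R L b p N₁ N₂ N₃ * T := by
        rw [averagingConst, hK, hM]; ring

end Averaging

/-! ### Choice of the scale. -/

section SmoothApproximation

variable {d : ℕ} {W : Type*} [NormedAddCommGroup W] [NormedSpace ℝ W] [CompleteSpace W]
  {Ω D : Set (EuclideanSpace ℝ (Fin d))} {F : EuclideanSpace ℝ (Fin d) → W}

open Filter in
/-- Approximation by functions that are smooth in the whole space. -/
theorem exists_contDiff_approx {κ : ℝ} (hF : IsZeroExtension Ω D κ F) {p : ℝ} (hp : 1 ≤ p)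
    {k : ℕ} (hFp : ∀ j ≤ k, ∫⁻ x in Ω, ‖iteratedFDeriv ℝ j F x‖ₑ ^ p < ⊤)
    {ε : ℝ} {δ : ENNReal} (hε : 0 < ε) (hε1 : ε ≤ 1) (hδ : 0 < δ)
    (hcar : CarrotCondition Ω D ε δ) {lam : ℝ} (hlam : 0 < lam)
    (hcomp : ∀ x ∈ Ω, (frontier (connectedComponentIn Ω x) ∩ neumannPart Ω D).Nonempty →
        ENNReal.ofReal lam * δ ≤ Metric.ediam (connectedComponentIn Ω x))
    {σ : ℝ} (hσ : 0 < σ) {η : ENNReal} (hη : 0 < η) :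
    ∃ g : EuclideanSpace ℝ (Fin d) → W, ContDiff ℝ ∞ g ∧
      (∀ x, ∀ w ∈ D, dist x w < κ - σ → g x = 0) ∧
      ∀ m ≤ k, ∫⁻ x in Ω, ‖iteratedFDeriv ℝ m (F - g) x‖ₑ ^ p ≤ η := by
  obtain ⟨R, C, hR1, hφ⟩ := exists_lattice_partition d
  have hR : 0 ≤ R := by linarith
  set a := ε / 4 / 2 with ha
  have ha0 : 0 < a := by positivity
  -- The three entries are the constraints `hba` and `hbM` of `exists_polygon` and `b ≤ 1`. All of
  -- `b`, `L` and `A` are fixed before `ρ`, so `A` cannot grow as `ρ` tends to zero.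
  set b := min (a / 3) (min (ε * a ^ 2 / (3 * (4 * R + 6))) 1) with hb
  have hb0 : 0 < b := by positivity
  have hb1 : b ≤ 1 := (min_le_right _ _).trans (min_le_right _ _)
  have hbε : 3 * b ≤ a := by linarith [min_le_left (a / 3) (min (ε * a ^ 2 / (3 * (4 * R + 6))) 1)]
  have hbM : 3 * b * (4 * R + 6) ≤ ε * a ^ 2 := by
    have h := (min_le_right (a / 3) _).trans (min_le_left (ε * a ^ 2 / (3 * (4 * R + 6))) 1)
    rw [← hb, le_div_iff₀ (by positivity)] at h
    linarith
  set L := ε⁻¹ * (4 * R + 6) with hL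
  have hL0 : 0 ≤ L := by positivity
  obtain ⟨N₁, hN₁⟩ := exists_lattice_card_le d (R + 1)
  obtain ⟨N₂, hN₂⟩ := exists_lattice_card_le d (2 * (R + 1))
  obtain ⟨N₃, hN₃⟩ := exists_lattice_card_le d (R + 4 + L)
  set A := averagingConst d C k R L b p N₁ N₂ N₃ with hA
  have hAt : A ≠ ⊤ := averagingConst_ne_top hp C k R L b N₁ N₂ N₃
  have hsmall : ∀ c : ℝ, ∀ t : ℝ, 0 < t → ∀ᶠ ρ in nhdsWithin (0 : ℝ) (Ioi 0), c * ρ < t := by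
    intro c t ht
    have : Tendsto (fun ρ : ℝ => c * ρ) (nhdsWithin 0 (Ioi 0)) (nhds 0) := by
      refine Tendsto.mono_left ?_ nhdsWithin_le_nhds
      exact (continuous_const_mul c).tendsto' 0 0 (mul_zero c)
    exact this.eventually_lt_const ht
  have hsmall' : ∀ c : ℝ, ∀ t : ENNReal, 0 < t →
      ∀ᶠ ρ in nhdsWithin (0 : ℝ) (Ioi 0), ENNReal.ofReal (c * ρ) < t := by
    intro c t ht
    have : Tendsto (fun ρ : ℝ => ENNReal.ofReal (c * ρ)) (nhdsWithin 0 (Ioi 0)) (nhds 0) := by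
      refine Tendsto.mono_left ?_ nhdsWithin_le_nhds
      exact (ENNReal.continuous_ofReal.comp (continuous_const_mul c)).tendsto' 0 0 (by simp)
    exact this.eventually_lt_const ht
  set c := R + 4 + L + (5 * R + 8) with hc
  have hc0 : 0 < c := by positivity
  -- This is where the error becomes small: a fixed constant times the energy in a shrinking
  -- neighbourhood of `Γ`.
  have hthick : ∀ᶠ ρ in nhdsWithin (0 : ℝ) (Ioi 0),
      A * ∫⁻ x in Metric.thickening (c * ρ) (neumannPart Ω D), derivSum Ω k F x ^ p < η := by
    have h1 := tendsto_lintegral_thickening (D := D) hF.isOpen (by linarith)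
      (lintegral_derivSum_lt_top hF.isOpen hF.contDiffOn hp hFp)
    have h2 : Tendsto (fun ρ : ℝ => c * ρ) (nhdsWithin 0 (Ioi 0)) (nhdsWithin 0 (Ioi 0)) := by
      refine tendsto_nhdsWithin_iff.2 ⟨Tendsto.mono_left
        ((continuous_const_mul c).tendsto' 0 0 (mul_zero c)) nhdsWithin_le_nhds, ?_⟩
      filter_upwards [self_mem_nhdsWithin] with ρ hρ
      exact mul_pos hc0 hρ
    have h3 := ENNReal.Tendsto.const_mul (h1.comp h2) (Or.inr hAt)
    rw [mul_zero] at h3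
    exact h3.eventually_lt_const hη
  obtain ⟨ρ, hρ, h1, h2, h3, h4, h5, h6, h7⟩ := ((eventually_mem_nhdsWithin (a := (0 : ℝ)) (s := Ioi 0)).and <|
    (hsmall 1 1 one_pos).and <| (hsmall ε⁻¹ (κ / 2) (half_pos hF.pos)).and <|
    (hsmall (2 * R + 3) (κ / 2) (half_pos hF.pos)).and <| (hsmall (2 * R + 3) σ hσ).and <|
    (hsmall' (4 * R + 6) δ hδ).and <|
    (hsmall' 2 (ENNReal.ofReal lam * δ) (ENNReal.mul_pos (by simpa using hlam) hδ.ne')).and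
    hthick).exists
  rw [mem_Ioi] at hρ
  obtain ⟨φ, hφ1, hφ2, hφ3, hφ4⟩ := hφ ρ hρ
  have hφ : IsLatticePartition ρ R C φ := ⟨hφ1, hφ2, hφ3, hφ4⟩
  obtain ⟨S⟩ := exists_scaleGeometry hF.isOpen hε hε1 hcar hcomp hR hρ hb0 hbε hbM h2 h5 h6
  obtain ⟨u, hu, hle⟩ := exists_lintegral_sub_glued_le hF hp hφ S hρ (by linarith) hR hb0 hb1 hL0
    h3 k (hN₁ ρ hρ) (hN₂ ρ hρ) (hN₃ ρ hρ)
  refine ⟨glued (activeSet Ω D κ R ρ) φ k F fun i => S.z i + u, contDiff_glued hF hφ hρ hR k,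
    fun x w hw hxw => ?_, fun m hm => (hle m hm).trans h7.le⟩
  refine glued_eq_zero hF hφ k (r := (R + 3) * ρ) (by positivity) (fun i hi => ?_) hw
    (by linarith) (by positivity)
  have h1 := dist_triangle (S.z i + u) (S.z i) (latticePoint ρ i)
  rw [dist_self_add_left] at h1
  have h2 := S.dist_z i hi
  nlinarith

end SmoothApproximation

/-! ### Classical and weak derivatives -/

lemma tsupport_dirDeriv_subset {V W : Type*} [NormedAddCommGroup V] [NormedSpace ℝ V]
    [NormedAddCommGroup W] [NormedSpace ℝ W] (l : List V) (φ : V → W) :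
    tsupport (dirDeriv l φ) ⊆ tsupport φ := by
  induction l with
  | nil => exact subset_rfl
  | cons v l ih => exact (tsupport_fderiv_apply_subset ℝ v).trans ih

/-! ### Integration by parts against test functions. -/

section Pairing

variable {V W : Type*} [NormedAddCommGroup V] [MeasurableSpace V]
  [NormedAddCommGroup W] [NormedSpace ℝ W] {μ : Measure V}

lemma integrable_smul_of_tsupport_subset [BorelSpace V] [SecondCountableTopology V] {Ω : Set V} {φ : V → ℝ}
    {g : V → W} (hg : LocallyIntegrableOn g Ω μ) (hφ : Continuous φ) (hφc : HasCompactSupport φ)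
    (hφΩ : tsupport φ ⊆ Ω) : Integrable (fun x => φ x • g x) μ := by
  rw [← integrableOn_iff_integrable_of_support_subset (s := tsupport φ)]
  · exact (hg.integrableOn_compact_subset hφΩ hφc).continuousOn_smul hφ.continuousOn hφc
  · exact fun x hx => subset_tsupport φ fun h => hx (by simp [h])

lemma setIntegral_smul_of_tsupport_subset {Ω : Set V} {φ : V → ℝ} {g : V → W}
    (hφΩ : tsupport φ ⊆ Ω) : ∫ x in Ω, φ x • g x ∂μ = ∫ x, φ x • g x ∂μ :=
  setIntegral_eq_integral_of_forall_compl_eq_zero fun x hx => by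
    rw [image_eq_zero_of_notMem_tsupport fun h => hx (hφΩ h), zero_smul]

variable [NormedSpace ℝ V] [BorelSpace V] [FiniteDimensional ℝ V] [μ.IsAddHaarMeasure]

/-- Moving the derivatives over one at a time reverses their order; symmetry of the derivatives of
`h` restores it on the support of `φ`, and off the support both integrands vanish. -/
lemma integral_dirDeriv_smul {Ω : Set V} (hΩ : IsOpen Ω) {φ : V → ℝ} (hφ : ContDiff ℝ ∞ φ)
    (hφc : HasCompactSupport φ) (hφΩ : tsupport φ ⊆ Ω) (l : List V) {h : V → W}
    (hh : ContDiffOn ℝ ∞ h Ω) :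
    ∫ x, dirDeriv l φ x • h x ∂μ = (-1 : ℝ) ^ l.length • ∫ x, φ x • dirDeriv l h x ∂μ := by
  have hloc : ∀ {g : V → W}, ContDiffOn ℝ ∞ g Ω → LocallyIntegrableOn g Ω μ := fun hg =>
    hg.continuousOn.locallyIntegrableOn hΩ.measurableSet
  have hrev : ∀ (l : List V) {h : V → W}, ContDiffOn ℝ ∞ h Ω →
      ∫ x, dirDeriv l φ x • h x ∂μ =
        (-1 : ℝ) ^ l.length • ∫ x, φ x • dirDeriv l.reverse h x ∂μ := by
    intro l
    induction l with
    | nil => intro h _; simp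
    | cons v l ih =>
      intro h hh
      have hψ : ContDiff ℝ ∞ (dirDeriv l φ) :=
        contDiffOn_univ.1 (hφ.contDiffOn.dirDeriv isOpen_univ l)
      have hψv : ContDiff ℝ ∞ (dirDeriv (v :: l) φ) :=
        contDiffOn_univ.1 (hφ.contDiffOn.dirDeriv isOpen_univ (v :: l))
      have hsub := tsupport_dirDeriv_subset l φ
      have hsubv := tsupport_dirDeriv_subset (v :: l) φ
      have hc : HasCompactSupport (dirDeriv l φ) := hφc.of_isClosed_subset (isClosed_tsupport _) hsub
      have hcv : HasCompactSupport (dirDeriv (v :: l) φ) :=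
        hφc.of_isClosed_subset (isClosed_tsupport _) hsubv
      have hhv : ContDiffOn ℝ ∞ (dirDeriv [v] h) Ω := hh.dirDeriv hΩ [v]
      have hne : ∀ x ∈ tsupport (dirDeriv l φ), DifferentiableAt ℝ h x := fun x hx =>
        (hh.contDiffAt (hΩ.mem_nhds (hφΩ (hsub hx)))).differentiableAt (by simp)
      have key : ∫ x, dirDeriv l φ x • fderiv ℝ h x v ∂μ =
          -∫ x, fderiv ℝ (dirDeriv l φ) x v • h x ∂μ := integral_smul_fderiv_eq_neg_fderiv_smul_of_integrable (μ := μ) (v := v)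
        (integrable_smul_of_tsupport_subset (hloc hh) hψv.continuous hcv (hsubv.trans hφΩ))
        (integrable_smul_of_tsupport_subset (hloc hhv) hψ.continuous hc (hsub.trans hφΩ))
        (integrable_smul_of_tsupport_subset (hloc hh) hψ.continuous hc (hsub.trans hφΩ))
        (fun x _ => hψ.differentiable (by simp) x) hne
      have key' := ih hhv
      rw [← dirDeriv_append, ← List.reverse_cons] at key'
      rw [List.length_cons, pow_succ, mul_comm, mul_smul, ← key']
      simp only [dirDeriv_cons, dirDeriv_nil, neg_one_smul]
      rw [key, neg_neg]
  rw [hrev l hh]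
  congr 1
  refine integral_congr_ae (Filter.Eventually.of_forall fun x => ?_)
  dsimp only
  by_cases hx : x ∈ tsupport φ
  · rw [dirDeriv_perm hΩ hh l.reverse_perm (hφΩ hx)]
  · rw [image_eq_zero_of_notMem_tsupport hx, zero_smul, zero_smul]

end Pairing

/-! ### Equivalence of the derivative tensor with its coordinate entries. -/

section DirDerivBounds

variable {V W : Type*} [NormedAddCommGroup V] [NormedSpace ℝ V]
  [NormedAddCommGroup W] [NormedSpace ℝ W]

lemma enorm_dirDeriv_le {U : Set V} (hU : IsOpen U) {f : V → W} (hf : ContDiffOn ℝ ∞ f U)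
    {l : List V} (hl : ∀ v ∈ l, ‖v‖ ≤ 1) {x : V} (hx : x ∈ U) :
    ‖dirDeriv l f x‖ₑ ≤ ‖iteratedFDeriv ℝ l.length f x‖ₑ := by
  have h := iteratedFDeriv_eq_dirDeriv hU hf l.get hx
  rw [List.ofFn_get] at h
  rw [← h, ← ofReal_norm, ← ofReal_norm]
  refine ENNReal.ofReal_le_ofReal ((ContinuousMultilinearMap.le_opNorm _ _).trans ?_)
  refine mul_le_of_le_one_right (norm_nonneg _) (Finset.prod_le_one (fun _ _ => norm_nonneg _) ?_)
  exact fun i _ => hl _ (List.get_mem l i)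

/-- Every argument is expanded in the standard basis. This turns integrability of the partial
derivatives into integrability of the full derivative. -/
lemma enorm_iteratedFDeriv_le_sum_dirDeriv {d : ℕ} {U : Set (EuclideanSpace ℝ (Fin d))}
    (hU : IsOpen U) {f : EuclideanSpace ℝ (Fin d) → W} (hf : ContDiffOn ℝ ∞ f U) (n : ℕ)
    {x : EuclideanSpace ℝ (Fin d)} (hx : x ∈ U) :
    ‖iteratedFDeriv ℝ n f x‖ₑ ≤ ∑ t : Fin n → Fin d,
      ‖dirDeriv ((List.ofFn t).map fun i => EuclideanSpace.single i 1) f x‖ₑ := by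
  have h : ∀ t : Fin n → Fin d,
      dirDeriv ((List.ofFn t).map fun i => EuclideanSpace.single i (1 : ℝ)) f x =
        iteratedFDeriv ℝ n f x fun j => EuclideanSpace.single (t j) 1 := by
    intro t
    rw [iteratedFDeriv_eq_dirDeriv hU hf _ hx, List.map_ofFn]
    rfl
  simp_rw [h, ← ofReal_norm]
  rw [← ENNReal.ofReal_sum_of_nonneg fun _ _ => norm_nonneg _]
  refine ENNReal.ofReal_le_ofReal (ContinuousMultilinearMap.opNorm_le_bound
    (Finset.sum_nonneg fun _ _ => norm_nonneg _) fun v => ?_)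
  have hv : v = fun j => ∑ i, v j i • (EuclideanSpace.single i (1 : ℝ) :
      EuclideanSpace ℝ (Fin d)) := by
    ext j i
    simp [Pi.single_apply]
  conv_lhs => rw [hv]
  rw [ContinuousMultilinearMap.map_sum]
  refine (norm_sum_le _ _).trans ?_
  rw [Finset.sum_mul]
  refine Finset.sum_le_sum fun t _ => ?_
  rw [ContinuousMultilinearMap.map_smul_univ (c := fun j => v j (t j)), norm_smul, mul_comm,
    norm_prod]
  gcongr with j
  exact PiLp.norm_apply_le (v j) (t j)

end DirDerivBounds

/-! ### Multi-indices as lists of directions. -/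

section MultiIndex

variable {d : ℕ}

/-- The list of indices in which `i` occurs `α i` times. -/
def indexList (α : Fin d → ℕ) : List (Fin d) :=
  (List.finRange d).flatMap fun i => List.replicate (α i) i

/-- The list of coordinate directions of a multi-index. -/
def directionList (α : Fin d → ℕ) : List (EuclideanSpace ℝ (Fin d)) :=
  (indexList α).map fun i => EuclideanSpace.single i 1

lemma length_directionList (α : Fin d → ℕ) : (directionList α).length = ∑ i, α i := by
  simp [directionList, indexList, List.length_flatMap, Fin.sum_univ_def]

lemma norm_le_one_of_mem_directionList {α : Fin d → ℕ} {v : EuclideanSpace ℝ (Fin d)}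
    (hv : v ∈ directionList α) : ‖v‖ ≤ 1 := by
  obtain ⟨i, -, rfl⟩ := List.mem_map.1 hv
  simp

lemma multiDeriv_eq_dirDeriv (α : Fin d → ℕ) (φ : EuclideanSpace ℝ (Fin d) → ℝ) :
    multiDeriv α φ = dirDeriv (directionList α) φ := by
  have hrep : ∀ (i : Fin d) (n : ℕ) (ψ : EuclideanSpace ℝ (Fin d) → ℝ),
      (partialDeriv i)^[n] ψ = dirDeriv (List.replicate n (EuclideanSpace.single i 1)) ψ := by
    intro i n ψ
    induction n with
    | zero => rfl
    | succ n ih => rw [Function.iterate_succ_apply', ih, List.replicate_succ]; rfl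
  rw [multiDeriv, directionList, indexList]
  induction List.finRange d with
  | nil => rfl
  | cons i l ih =>
    rw [List.foldr_cons, ih, hrep, List.flatMap_cons, List.map_append, dirDeriv_append,
      List.map_replicate]

/-- Counting the occurrences of each index sorts any sequence of partial derivatives into a
multi-index. -/
lemma exists_perm_indexList (l : List (Fin d)) :
    ∃ α : Fin d → ℕ, ∑ i, α i = l.length ∧ l.Perm (indexList α) := by
  have hperm : l.Perm (indexList fun i => l.count i) := by
    rw [List.perm_iff_count]
    intro a
    rw [indexList, List.count_flatMap]
    simp only [Function.comp_def, List.count_replicate]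
    rw [← Fin.sum_univ_def]
    simp
  refine ⟨fun i => l.count i, ?_, hperm⟩
  rw [← length_directionList, directionList, List.length_map, hperm.length_eq]

end MultiIndex

/-! ### Smooth functions in Sobolev spaces -/

section SobolevLemmas

variable {d : ℕ} {𝕜 : Type*} [RCLike 𝕜] {Ω : Set (EuclideanSpace ℝ (Fin d))}

lemma continuous_multiDeriv {α : Fin d → ℕ} {φ : EuclideanSpace ℝ (Fin d) → ℝ}
    (hφ : ContDiff ℝ ∞ φ) : Continuous (multiDeriv α φ) := by
  rw [multiDeriv_eq_dirDeriv]
  exact (contDiffOn_univ.1 (hφ.contDiffOn.dirDeriv isOpen_univ _)).continuous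

lemma tsupport_multiDeriv_subset (α : Fin d → ℕ) (φ : EuclideanSpace ℝ (Fin d) → ℝ) :
    tsupport (multiDeriv α φ) ⊆ tsupport φ := by
  rw [multiDeriv_eq_dirDeriv]
  exact tsupport_dirDeriv_subset _ _

lemma hasWeakDeriv_dirDeriv (hΩ : IsOpen Ω) {h : EuclideanSpace ℝ (Fin d) → 𝕜}
    (hh : ContDiffOn ℝ ∞ h Ω) (α : Fin d → ℕ) :
    HasWeakDeriv Ω α h (dirDeriv (directionList α) h) where
  locallyIntegrableOn := hh.continuousOn.locallyIntegrableOn hΩ.measurableSet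
  locallyIntegrableOn_deriv :=
    (hh.dirDeriv hΩ _).continuousOn.locallyIntegrableOn hΩ.measurableSet
  integral_eq φ hφ hφc hφΩ := by
    rw [setIntegral_smul_of_tsupport_subset hφΩ, setIntegral_smul_of_tsupport_subset
      ((tsupport_multiDeriv_subset α φ).trans hφΩ), multiDeriv_eq_dirDeriv,
      integral_dirDeriv_smul hΩ hφ hφc hφΩ _ hh, length_directionList]

namespace HasWeakDeriv

variable {α : Fin d → ℕ} {f f' g g' : EuclideanSpace ℝ (Fin d) → 𝕜}

lemma add (h : HasWeakDeriv Ω α f g) (h' : HasWeakDeriv Ω α f' g') :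
    HasWeakDeriv Ω α (f + f') (g + g') where
  locallyIntegrableOn := h.locallyIntegrableOn.add h'.locallyIntegrableOn
  locallyIntegrableOn_deriv := h.locallyIntegrableOn_deriv.add h'.locallyIntegrableOn_deriv
  integral_eq φ hφ hφc hφΩ := by
    have hsub := tsupport_multiDeriv_subset α φ
    have hint : ∀ {g : EuclideanSpace ℝ (Fin d) → 𝕜}, LocallyIntegrableOn g Ω →
        Integrable (fun x => φ x • g x) := fun hg =>
      integrable_smul_of_tsupport_subset hg hφ.continuous hφc hφΩ
    have hint' : ∀ {g : EuclideanSpace ℝ (Fin d) → 𝕜}, LocallyIntegrableOn g Ω →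
        Integrable (fun x => multiDeriv α φ x • g x) := fun hg =>
      integrable_smul_of_tsupport_subset hg (continuous_multiDeriv hφ)
        (hφc.of_isClosed_subset (isClosed_tsupport _) hsub) (hsub.trans hφΩ)
    simp only [Pi.add_apply, smul_add]
    rw [integral_add (hint' h.locallyIntegrableOn).integrableOn
      (hint' h'.locallyIntegrableOn).integrableOn,
      integral_add (hint h.locallyIntegrableOn_deriv).integrableOn
      (hint h'.locallyIntegrableOn_deriv).integrableOn, smul_add,
      h.integral_eq φ hφ hφc hφΩ, h'.integral_eq φ hφ hφc hφΩ]

/-- The fundamental lemma of the calculus of variations, applied to the difference. -/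
lemma ae_eq (hΩ : IsOpen Ω) (h : HasWeakDeriv Ω α f g) (h' : HasWeakDeriv Ω α f g') :
    g =ᵐ[volume.restrict Ω] g' := by
  have key := hΩ.ae_eq_zero_of_integral_contDiff_smul_eq_zero (μ := volume)
    (h.locallyIntegrableOn_deriv.sub h'.locallyIntegrableOn_deriv) fun φ hφ hφc hφΩ => by
      have hint : ∀ {g : EuclideanSpace ℝ (Fin d) → 𝕜}, LocallyIntegrableOn g Ω →
          Integrable (fun x => φ x • g x) := fun hg =>
        integrable_smul_of_tsupport_subset hg hφ.continuous hφc hφΩ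
      have h1 := (h.integral_eq φ hφ hφc hφΩ).symm.trans (h'.integral_eq φ hφ hφc hφΩ)
      rw [setIntegral_smul_of_tsupport_subset hφΩ, setIntegral_smul_of_tsupport_subset hφΩ] at h1
      simp only [Pi.sub_apply, smul_sub]
      rw [integral_sub (hint h.locallyIntegrableOn_deriv) (hint h'.locallyIntegrableOn_deriv),
        sub_eq_zero]
      exact smul_right_injective _ (pow_ne_zero _ (by norm_num : (-1 : ℝ) ≠ 0)) h1
  rw [Filter.EventuallyEq, ae_restrict_iff' hΩ.measurableSet]
  filter_upwards [key] with x hx hxΩ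
  exact sub_eq_zero.1 (hx hxΩ)

lemma iInf_eLpNorm_eq (hΩ : IsOpen Ω) (h : HasWeakDeriv Ω α f g) (p : ENNReal) :
    ⨅ (g' : EuclideanSpace ℝ (Fin d) → 𝕜) (_ : HasWeakDeriv Ω α f g'),
      eLpNorm g' p (volume.restrict Ω) = eLpNorm g p (volume.restrict Ω) :=
  le_antisymm (iInf₂_le g h)
    (le_iInf₂ fun _ h' => (eLpNorm_congr_ae (h.ae_eq hΩ h')).le)

end HasWeakDeriv

/-- If a summand lacks a weak derivative, its infimum is over the empty set and the right side is
`∞`. Otherwise uniqueness of weak derivatives reduces the claim to Minkowski's inequality. -/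
lemma sobolevNorm_add_le (hΩ : IsOpen Ω) (k : ℕ) {p : ENNReal} (hp : 1 ≤ p)
    (f g : EuclideanSpace ℝ (Fin d) → 𝕜) :
    sobolevNorm k p Ω (f + g) ≤ sobolevNorm k p Ω f + sobolevNorm k p Ω g := by
  rw [sobolevNorm, sobolevNorm, sobolevNorm, ← Finset.sum_add_distrib]
  refine Finset.sum_le_sum fun α _ => ?_
  by_cases hf : ∃ a, HasWeakDeriv Ω α f a
  swap
  · push Not at hf
    simp [hf]
  by_cases hg : ∃ b, HasWeakDeriv Ω α g b
  swap
  · push Not at hg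
    simp [hg]
  obtain ⟨a, ha⟩ := hf
  obtain ⟨b, hb⟩ := hg
  rw [ha.iInf_eLpNorm_eq hΩ, hb.iInf_eLpNorm_eq hΩ, (ha.add hb).iInf_eLpNorm_eq hΩ]
  exact eLpNorm_add_le ha.locallyIntegrableOn_deriv.aestronglyMeasurable
    hb.locallyIntegrableOn_deriv.aestronglyMeasurable hp

lemma le_of_mem_multiIndices {k : ℕ} {α : Fin d → ℕ} (h : α ∈ multiIndices d k) :
    ∑ i, α i ≤ k := (Finset.mem_filter.1 h).2

lemma eLpNorm_dirDeriv_le (hΩ : IsOpen Ω) {p : ENNReal} (hp : 1 ≤ p) (hp' : p ≠ ⊤)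
    {h : EuclideanSpace ℝ (Fin d) → 𝕜} (hh : ContDiffOn ℝ ∞ h Ω) (α : Fin d → ℕ) :
    eLpNorm (dirDeriv (directionList α) h) p (volume.restrict Ω) ≤
      (∫⁻ x in Ω, ‖iteratedFDeriv ℝ (∑ i, α i) h x‖ₑ ^ p.toReal) ^ (1 / p.toReal) := by
  rw [eLpNorm_eq_lintegral_rpow_enorm_toReal (zero_lt_one.trans_le hp).ne' hp']
  refine ENNReal.rpow_le_rpow (setLIntegral_mono' hΩ.measurableSet fun x hx => ?_) (by positivity)
  refine ENNReal.rpow_le_rpow ?_ ENNReal.toReal_nonneg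
  rw [← length_directionList]
  exact enorm_dirDeriv_le hΩ hh (fun v hv => norm_le_one_of_mem_directionList hv) hx

lemma memLp_dirDeriv (hΩ : IsOpen Ω) {p : ENNReal} (hp : 1 ≤ p) (hp' : p ≠ ⊤)
    {h : EuclideanSpace ℝ (Fin d) → 𝕜} (hh : ContDiffOn ℝ ∞ h Ω) (α : Fin d → ℕ)
    (hfin : ∫⁻ x in Ω, ‖iteratedFDeriv ℝ (∑ i, α i) h x‖ₑ ^ p.toReal < ⊤) :
    MemLp (dirDeriv (directionList α) h) p (volume.restrict Ω) :=
  ⟨(hh.dirDeriv hΩ _).continuousOn.aestronglyMeasurable hΩ.measurableSet,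
    (eLpNorm_dirDeriv_le hΩ hp hp' hh α).trans_lt
      (ENNReal.rpow_lt_top_of_nonneg (by positivity) hfin.ne)⟩

lemma mem_sobolevSpace_of_contDiffOn (hΩ : IsOpen Ω) {k : ℕ} {p : ENNReal} (hp : 1 ≤ p)
    (hp' : p ≠ ⊤) {h : EuclideanSpace ℝ (Fin d) → 𝕜} (hh : ContDiffOn ℝ ∞ h Ω)
    (hfin : ∀ m ≤ k, ∫⁻ x in Ω, ‖iteratedFDeriv ℝ m h x‖ₑ ^ p.toReal < ⊤) :
    h ∈ sobolevSpace 𝕜 k p Ω := by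
  refine ⟨?_, fun α hα => ⟨_, hasWeakDeriv_dirDeriv hΩ hh α,
    memLp_dirDeriv hΩ hp hp' hh α (hfin _ hα)⟩⟩
  have h0 := memLp_dirDeriv hΩ hp hp' hh 0 (hfin _ (by simp))
  have : directionList (0 : Fin d → ℕ) = [] := List.eq_nil_of_length_eq_zero (by
    simp [length_directionList])
  rwa [this, dirDeriv_nil] at h0

lemma sobolevNorm_le_of_contDiffOn (hΩ : IsOpen Ω) {k : ℕ} {p : ENNReal} (hp : 1 ≤ p)
    (hp' : p ≠ ⊤) {h : EuclideanSpace ℝ (Fin d) → 𝕜} (hh : ContDiffOn ℝ ∞ h Ω) {A : ENNReal}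
    (hA : ∀ m ≤ k, ∫⁻ x in Ω, ‖iteratedFDeriv ℝ m h x‖ₑ ^ p.toReal ≤ A) :
    sobolevNorm k p Ω h ≤ (multiIndices d k).card * A ^ (1 / p.toReal) := by
  rw [← nsmul_eq_mul]
  refine Finset.sum_le_card_nsmul _ _ _ fun α hα => ?_
  refine (iInf₂_le _ (hasWeakDeriv_dirDeriv hΩ hh α)).trans
    ((eLpNorm_dirDeriv_le hΩ hp hp' hh α).trans ?_)
  exact ENNReal.rpow_le_rpow (hA _ (le_of_mem_multiIndices hα)) (by positivity)

/-- By uniqueness the weak derivatives agree almost everywhere with the classical ones, and these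
bound the full derivative. -/
lemma lintegral_iteratedFDeriv_lt_top (hΩ : IsOpen Ω) {k : ℕ} {p : ENNReal} (hp : 1 ≤ p)
    (hp' : p ≠ ⊤) {f : EuclideanSpace ℝ (Fin d) → 𝕜} (hf : ContDiffOn ℝ ∞ f Ω)
    (hfk : f ∈ sobolevSpace 𝕜 k p Ω) {m : ℕ} (hm : m ≤ k) :
    ∫⁻ x in Ω, ‖iteratedFDeriv ℝ m f x‖ₑ ^ p.toReal < ⊤ := by
  have hp0 : p ≠ 0 := (zero_lt_one.trans_le hp).ne'
  have hp1 : 1 ≤ p.toReal := by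
    rw [← ENNReal.toReal_one]
    exact (ENNReal.toReal_le_toReal ENNReal.one_ne_top hp').2 hp
  have hmem : ∀ t : Fin m → Fin d, MemLp
      (dirDeriv ((List.ofFn t).map fun i => EuclideanSpace.single i 1) f) p
      (volume.restrict Ω) := by
    intro t
    obtain ⟨α, hα, hperm⟩ := exists_perm_indexList (List.ofFn t)
    rw [List.length_ofFn] at hα
    obtain ⟨g, hg, hgp⟩ := hfk.2 α (hα.trans_le hm)
    refine (memLp_congr_ae ?_).1 hgp
    refine (hg.ae_eq hΩ (hasWeakDeriv_dirDeriv hΩ hf α)).trans ?_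
    rw [Filter.EventuallyEq, ae_restrict_iff' hΩ.measurableSet]
    exact Filter.Eventually.of_forall fun x hx => dirDeriv_perm hΩ hf (hperm.symm.map _) hx
  refine (setLIntegral_mono' hΩ.measurableSet fun x hx => ENNReal.rpow_le_rpow
    (enorm_iteratedFDeriv_le_sum_dirDeriv hΩ hf m hx) ENNReal.toReal_nonneg).trans_lt ?_
  refine (lintegral_mono fun x => ENNReal.rpow_sum_le_const_mul_sum_rpow _ _ hp1).trans_lt ?_
  have hc : ((Finset.univ : Finset (Fin m → Fin d)).card : ENNReal) ^ (p.toReal - 1) ≠ ⊤ :=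
    ENNReal.rpow_ne_top_of_nonneg (by linarith) (ENNReal.natCast_ne_top _)
  rw [lintegral_const_mul' _ _ hc,
    lintegral_finsetSum' _ fun t _ => (hmem t).1.enorm.pow_const p.toReal]
  refine ENNReal.mul_lt_top hc.lt_top (ENNReal.sum_lt_top.2 fun t _ => ?_)
  exact lintegral_rpow_enorm_lt_top_of_eLpNorm_lt_top hp0 hp' (hmem t).2

end SobolevLemmas

/-! ### Cutoff at infinity -/

section Cutoff

variable {d : ℕ} {W : Type*} [NormedAddCommGroup W] [NormedSpace ℝ W]
  {Ω : Set (EuclideanSpace ℝ (Fin d))}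

/-- Dilating a fixed bump by `r ≥ 1` can only decrease its derivatives, so the bounds do not depend
on `r`. -/
lemma exists_cutoff (d : ℕ) : ∃ C : ℕ → ℝ, ∀ r : ℝ, 1 ≤ r →
    ∃ χ : EuclideanSpace ℝ (Fin d) → ℝ, ContDiff ℝ ∞ χ ∧ HasCompactSupport χ ∧
      (∀ x, ‖x‖ < r → χ x = 1) ∧ ∀ m x, ‖iteratedFDeriv ℝ m χ x‖ ≤ C m := by
  let ψ : ContDiffBump (0 : EuclideanSpace ℝ (Fin d)) := ⟨1, 2, one_pos, one_lt_two⟩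
  have hb : ∀ m, ∃ C : ℝ, ∀ x, ‖iteratedFDeriv ℝ m ψ x‖ ≤ C := fun m =>
    (ψ.hasCompactSupport.iteratedFDeriv m).exists_bound_of_continuous
      (ψ.contDiff.continuous_iteratedFDeriv (natCast_le_infty m))
  choose C hC using hb
  refine ⟨C, fun r hr => ⟨fun x => ψ (r⁻¹ • x), ψ.contDiff.comp (contDiff_const_smul _),
    ψ.hasCompactSupport.comp_smul (inv_ne_zero (by positivity)), fun x hx => ?_, fun m x => ?_⟩⟩
  · refine ψ.one_of_mem_closedBall ?_
    rw [mem_closedBall_zero_iff, norm_smul, norm_inv, Real.norm_of_nonneg (by positivity)]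
    exact (inv_mul_le_one₀ (by positivity)).2 hx.le
  · rw [iteratedFDeriv_comp_const_smul r⁻¹ (ψ.contDiff.of_le (natCast_le_infty m)), norm_smul,
      norm_pow, norm_inv, Real.norm_of_nonneg (by positivity)]
    exact (mul_le_of_le_one_left (norm_nonneg _)
      (pow_le_one₀ (by positivity) (inv_le_one_of_one_le₀ hr))).trans (hC m _)

lemma exists_cutoff_approx (hΩ : IsOpen Ω) {p : ℝ} (hp : 1 ≤ p) {k : ℕ}
    {g : EuclideanSpace ℝ (Fin d) → W} (hg : ContDiff ℝ ∞ g)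
    (hfin : ∀ j ≤ k, ∫⁻ x in Ω, ‖iteratedFDeriv ℝ j g x‖ₑ ^ p < ⊤) {η : ENNReal} (hη : 0 < η) :
    ∃ χ : EuclideanSpace ℝ (Fin d) → ℝ, ContDiff ℝ ∞ χ ∧ HasCompactSupport χ ∧
      ∀ m ≤ k, ∫⁻ x in Ω, ‖iteratedFDeriv ℝ m (g - fun y => χ y • g y) x‖ₑ ^ p ≤ η := by
  have hp0 : 0 < p := by linarith
  obtain ⟨C, hC⟩ := exists_cutoff d
  set A := 1 + leibnizConst C k with hA
  have hAt : A ≠ ⊤ := by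
    have h : leibnizConst C k ≠ ⊤ :=
      ENNReal.sum_ne_top.2 fun m _ => ENNReal.sum_ne_top.2 fun i _ => by finiteness
    rw [hA]
    finiteness
  have hAp : A ^ p ≠ ⊤ := ENNReal.rpow_ne_top_of_nonneg hp0.le hAt
  have hmeas := (measurable_derivSum hΩ hg.contDiffOn k).pow_const p
  let ν : Measure (EuclideanSpace ℝ (Fin d)) := volume.withDensity fun x => derivSum Ω k g x ^ p
  have hν : IsFiniteMeasure ν :=
    isFiniteMeasure_withDensity (lintegral_derivSum_lt_top hΩ hg.contDiffOn hp hfin).ne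
  -- The finite measure with density `derivSum ^ p` is tight. The cutoff is taken equal to one near
  -- `K`, so the error lives where this measure is at most `η / A ^ p`.
  obtain ⟨K, hK, hKν⟩ := isTightMeasureSet_iff_exists_isCompact_measure_compl_le.1
    (isTightMeasureSet_singleton (μ := ν)) (η / A ^ p) (ENNReal.div_pos hη.ne' hAp)
  obtain ⟨r, hr, hKr⟩ := hK.isBounded.subset_ball_lt 1 0
  obtain ⟨χ, hχ, hχc, hχ1, hχC⟩ := hC r hr.le
  refine ⟨χ, hχ, hχc, fun m hm => ?_⟩
  have hpt : ∀ x ∈ Ω, ‖iteratedFDeriv ℝ m (g - fun y => χ y • g y) x‖ₑ ^ p ≤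
      Kᶜ.indicator (fun x => A ^ p * derivSum Ω k g x ^ p) x := by
    intro x hx
    by_cases hxK : x ∈ K
    · have hev : (g - fun y => χ y • g y) =ᶠ[nhds x] fun _ => 0 := by
        filter_upwards [Metric.isOpen_ball.mem_nhds (hKr hxK)] with y hy
        rw [Pi.sub_apply, hχ1 y (mem_ball_zero_iff.1 hy), one_smul, sub_self]
      rw [Filter.EventuallyEq.iteratedFDeriv_eq_zero hev, enorm_zero_multilinear,
        ENNReal.zero_rpow_of_pos hp0]
      exact zero_le
    · rw [indicator_of_mem (by exact hxK), ← ENNReal.mul_rpow_of_nonneg _ _ hp0.le]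
      refine ENNReal.rpow_le_rpow ?_ hp0.le
      have hG : ∀ l ≤ k, ‖iteratedFDeriv ℝ l g x‖ₑ ≤ derivSum Ω k g x := by
        intro l hl
        rw [derivSum, indicator_of_mem hx]
        exact Finset.single_le_sum (f := fun j => ‖iteratedFDeriv ℝ j g x‖ₑ) (fun _ _ => zero_le)
          (Finset.mem_range.2 (Nat.lt_succ_of_le hl))
      -- Scale one suffices, as the derivatives of the cutoffs are bounded uniformly in `r`.
      have h1 := enorm_iteratedFDeriv_smul_le_of_scale hΩ hχ.contDiffOn hg.contDiffOn hx one_pos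
        le_rfl (k := k) (C := C) (fun i => by simpa using hχC i x) (A := derivSum Ω k g x)
        (by simpa using hG) hm
      refine (enorm_iteratedFDeriv_sub_le hg.contDiffAt (hχ.smul hg).contDiffAt m).trans ?_
      rw [hA, add_mul, one_mul]
      exact add_le_add (hG m hm) h1
  calc ∫⁻ x in Ω, ‖iteratedFDeriv ℝ m (g - fun y => χ y • g y) x‖ₑ ^ p
      ≤ ∫⁻ x in Ω, Kᶜ.indicator (fun x => A ^ p * derivSum Ω k g x ^ p) x :=
        setLIntegral_mono' hΩ.measurableSet hpt
    _ ≤ ∫⁻ x, Kᶜ.indicator (fun x => A ^ p * derivSum Ω k g x ^ p) x :=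
        setLIntegral_le_lintegral _ _
    _ = A ^ p * ν Kᶜ := by
        rw [lintegral_indicator hK.measurableSet.compl, lintegral_const_mul _ hmeas,
          withDensity_apply _ hK.measurableSet.compl]
    _ ≤ A ^ p * (η / A ^ p) := mul_le_mul' le_rfl (hKν ν rfl)
    _ ≤ η := ENNReal.mul_div_le

end Cutoff

/-! ### Supports and distances -/

section Distances

lemma setEDist_anti {X : Type*} [PseudoEMetricSpace X] {A A' B : Set X} (h : A ⊆ A') :
    setEDist A' B ≤ setEDist A B :=
  le_iInf₂ fun a ha => iInf₂_le a (h ha)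

lemma setEDist_le_edist {X : Type*} [PseudoEMetricSpace X] {A B : Set X} {a b : X} (ha : a ∈ A)
    (hb : b ∈ B) : setEDist A B ≤ edist a b :=
  (iInf₂_le a ha).trans (Metric.infEDist_le_edist_of_mem hb)

lemma ofReal_le_setEDist_tsupport {X W : Type*} [PseudoMetricSpace X] [Zero W] {g : X → W}
    {D : Set X} {t : ℝ} (h : ∀ x, ∀ w ∈ D, dist x w < t → g x = 0) :
    ENNReal.ofReal t ≤ setEDist (tsupport g) D := by
  refine le_iInf₂ fun x hx => Metric.le_infEDist.2 fun w hw => ?_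
  have hcl : tsupport g ⊆ {x | t ≤ dist x w} := by
    refine closure_minimal (fun y hy => ?_)
      (isClosed_le continuous_const (continuous_id.dist continuous_const))
    by_contra hlt
    exact hy (h y w hw (not_le.1 hlt))
  rw [edist_dist]
  exact ENNReal.ofReal_le_ofReal (hcl hx)

variable {d : ℕ} {𝕜 : Type*} [RCLike 𝕜] {Ω D : Set (EuclideanSpace ℝ (Fin d))}

lemma isZeroExtension_indicator (hΩ : IsOpen Ω) {f : EuclideanSpace ℝ (Fin d) → 𝕜}
    (hf : ContDiffOn ℝ ∞ f Ω) {κ : ℝ} (hκ : 0 < κ)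
    (hκf : ENNReal.ofReal κ ≤ setEDist (supportIn Ω f) D) :
    IsZeroExtension Ω D κ (Ω.indicator f) where
  isOpen := hΩ
  pos := hκ
  eq_zero _ hx := indicator_of_notMem hx f
  eq_zero_near x w hw hxw := by
    by_contra hne
    have hxΩ : x ∈ Ω := mem_of_indicator_ne_zero hne
    rw [indicator_of_mem hxΩ] at hne
    have h := hκf.trans (setEDist_le_edist ⟨hxΩ, subset_closure ⟨hxΩ, hne⟩⟩ hw)
    rw [edist_dist, ENNReal.ofReal_le_ofReal_iff dist_nonneg] at h
    exact absurd hxw (not_lt.2 h)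
  contDiffOn := hf.congr fun _ hx => indicator_of_mem hx f

end Distances

/-! ### Density of smooth functions -/

section Density

variable {d : ℕ} {𝕜 : Type*} [RCLike 𝕜] {Ω D : Set (EuclideanSpace ℝ (Fin d))}

lemma lintegral_iteratedFDeriv_lt_top_of_sub (hΩ : IsOpen Ω) {p : ℝ} (hp : 1 ≤ p)
    {f g : EuclideanSpace ℝ (Fin d) → 𝕜} (hf : ContDiffOn ℝ ∞ f Ω) (hg : ContDiffOn ℝ ∞ g Ω)
    {m : ℕ} (hfin : ∫⁻ x in Ω, ‖iteratedFDeriv ℝ m f x‖ₑ ^ p < ⊤)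
    (hsub : ∫⁻ x in Ω, ‖iteratedFDeriv ℝ m (f - g) x‖ₑ ^ p < ⊤) :
    ∫⁻ x in Ω, ‖iteratedFDeriv ℝ m g x‖ₑ ^ p < ⊤ := by
  have hp0 : 0 ≤ p := by linarith
  have h2 : (2 : ENNReal) ^ (p - 1) ≠ ⊤ :=
    ENNReal.rpow_ne_top_of_nonneg (by linarith) ENNReal.ofNat_ne_top
  have hpt : ∀ x ∈ Ω, ‖iteratedFDeriv ℝ m g x‖ₑ ^ p ≤ 2 ^ (p - 1) *
      (‖iteratedFDeriv ℝ m f x‖ₑ ^ p + ‖iteratedFDeriv ℝ m (f - g) x‖ₑ ^ p) := by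
    intro x hx
    have hfx := hf.contDiffAt (hΩ.mem_nhds hx)
    have hgx := hg.contDiffAt (hΩ.mem_nhds hx)
    have h := enorm_iteratedFDeriv_sub_le hfx (hfx.sub hgx) m
    simp only [sub_sub_cancel] at h
    exact (ENNReal.rpow_le_rpow h hp0).trans (ENNReal.rpow_add_le_mul_rpow_add_rpow _ _ hp)
  refine (setLIntegral_mono' hΩ.measurableSet hpt).trans_lt ?_
  rw [lintegral_const_mul' _ _ h2, lintegral_add_left'
    (((continuousOn_enorm_iteratedFDeriv hΩ hf m).aemeasurable hΩ.measurableSet).pow_const p)]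
  exact ENNReal.mul_lt_top h2.lt_top (ENNReal.add_lt_top.2 ⟨hfin, hsub⟩)

lemma exists_approx_of_zeroExtension (hΩ : IsOpen Ω) (hA : AdaptedEpsDelta Ω D) {k : ℕ} {p : ℝ}
    (hp : 1 ≤ p) {f : EuclideanSpace ℝ (Fin d) → 𝕜} {κ : ℝ}
    (hF : IsZeroExtension Ω D κ (Ω.indicator f))
    (hfin : ∀ m ≤ k, ∫⁻ x in Ω, ‖iteratedFDeriv ℝ m f x‖ₑ ^ p < ⊤) {σ : ℝ} (hσ : 0 < σ)
    {η : ENNReal} (hη : 0 < η) :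
    ∃ g : EuclideanSpace ℝ (Fin d) → 𝕜, ContDiff ℝ ∞ g ∧
      ENNReal.ofReal (κ - σ) ≤ setEDist (tsupport g) D ∧
      ∀ m ≤ k, ∫⁻ x in Ω, ‖iteratedFDeriv ℝ m (f - g) x‖ₑ ^ p ≤ η := by
  obtain ⟨ε, δ, K, hε, hε1, hδ, -, hcurve, lam, hlam, hcomp⟩ := hA
  have hcar : CarrotCondition Ω D ε δ := fun x hx y hy hxy => by
    obtain ⟨γ, h1, h2, h3, -⟩ := hcurve x hx y hy hxy
    exact ⟨γ, h1, h2, h3⟩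
  have heq : ∀ g : EuclideanSpace ℝ (Fin d) → 𝕜, ∀ m, ∀ x ∈ Ω,
      iteratedFDeriv ℝ m (Ω.indicator f - g) x = iteratedFDeriv ℝ m (f - g) x := by
    intro g m x hx
    refine Filter.EventuallyEq.eq_of_nhds (Filter.EventuallyEq.iteratedFDeriv ℝ ?_ m)
    filter_upwards [hΩ.mem_nhds hx] with y hy
    rw [Pi.sub_apply, Pi.sub_apply, indicator_of_mem hy]
  have hint : ∀ g : EuclideanSpace ℝ (Fin d) → 𝕜, ∀ m,
      ∫⁻ x in Ω, ‖iteratedFDeriv ℝ m (Ω.indicator f - g) x‖ₑ ^ p =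
        ∫⁻ x in Ω, ‖iteratedFDeriv ℝ m (f - g) x‖ₑ ^ p := fun g m =>
    setLIntegral_congr_fun hΩ.measurableSet fun x hx => by
      rw [heq g m x hx]
  -- `hint` with `g = 0` transfers the integrability from `f` to its zero extension.
  obtain ⟨g, hg, hgD, hle⟩ := exists_contDiff_approx hF hp (k := k)
    (fun j hj => by simpa using (hint 0 j).trans_lt (by simpa using hfin j hj)) hε hε1 hδ hcar
    hlam hcomp hσ hη
  exact ⟨g, hg, ofReal_le_setEDist_tsupport hgD, fun m hm => (hint g m).symm.trans_le (hle m hm)⟩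

lemma exists_contDiff_approx_of_smoothVanishing (hΩ : IsOpen Ω) (hA : AdaptedEpsDelta Ω D) {k : ℕ}
    {p : ℝ} (hp : 1 ≤ p) {f : EuclideanSpace ℝ (Fin d) → 𝕜} (hf : f ∈ smoothVanishing 𝕜 Ω D)
    (hfin : ∀ m ≤ k, ∫⁻ x in Ω, ‖iteratedFDeriv ℝ m f x‖ₑ ^ p < ⊤) {η : ENNReal} (hη : 0 < η) :
    ∃ g : EuclideanSpace ℝ (Fin d) → 𝕜, ContDiff ℝ ∞ g ∧
      (setEDist (supportIn Ω f) D / 2 < setEDist (tsupport g) D ∨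
        setEDist (tsupport g) D = ⊤) ∧
      (∀ m ≤ k, ∫⁻ x in Ω, ‖iteratedFDeriv ℝ m g x‖ₑ ^ p < ⊤) ∧
      ∀ m ≤ k, ∫⁻ x in Ω, ‖iteratedFDeriv ℝ m (f - g) x‖ₑ ^ p ≤ η := by
  obtain ⟨hfΩ, hfD⟩ := hf
  -- The cap `1` keeps the error finite even if `η = ∞`, so the derivatives of `g` inherit
  -- integrability from those of `f`.
  suffices H : ∃ g : EuclideanSpace ℝ (Fin d) → 𝕜, ContDiff ℝ ∞ g ∧
      (setEDist (supportIn Ω f) D / 2 < setEDist (tsupport g) D ∨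
        setEDist (tsupport g) D = ⊤) ∧
      ∀ m ≤ k, ∫⁻ x in Ω, ‖iteratedFDeriv ℝ m (f - g) x‖ₑ ^ p ≤ min η 1 by
    obtain ⟨g, hg, hgD, hle⟩ := H
    refine ⟨g, hg, hgD, fun m hm => ?_, fun m hm => (hle m hm).trans (min_le_left _ _)⟩
    exact lintegral_iteratedFDeriv_lt_top_of_sub hΩ hp hfΩ hg.contDiffOn (hfin m hm)
      (((hle m hm).trans (min_le_right _ _)).trans_lt ENNReal.one_lt_top)
  have hη' : 0 < min η 1 := lt_min hη one_pos
  -- For empty `D` any positive number is an admissible `κ`, and every distance to `D` is `∞`.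
  rcases D.eq_empty_or_nonempty with rfl | ⟨w, hw⟩
  · obtain ⟨g, hg, -, hle⟩ := exists_approx_of_zeroExtension hΩ hA hp
      (isZeroExtension_indicator hΩ hfΩ one_pos (by simp [setEDist])) hfin one_pos hη'
    exact ⟨g, hg, Or.inr (by simp [setEDist]), hle⟩
  -- An empty support also makes the distance infinite; then `f` vanishes on `Ω`, and `g = 0` works.
  rcases (supportIn Ω f).eq_empty_or_nonempty with hempty | ⟨a, ha⟩
  · refine ⟨0, contDiff_const, Or.inr (by simp [setEDist, tsupport]), fun m _ => ?_⟩
    refine le_of_eq_of_le ?_ zero_le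
    refine (setLIntegral_congr_fun hΩ.measurableSet fun x hx => ?_).trans lintegral_zero
    have hev : f - 0 =ᶠ[nhds x] fun _ => 0 := by
      filter_upwards [hΩ.mem_nhds hx] with y hy
      rw [sub_zero]
      by_contra hne
      exact hempty.subset ⟨hy, subset_closure ⟨hy, hne⟩⟩
    rw [Filter.EventuallyEq.iteratedFDeriv_eq_zero hev, enorm_zero_multilinear,
      ENNReal.zero_rpow_of_pos (by linarith)]
  set κ := (setEDist (supportIn Ω f) D).toReal with hκ
  have htop : setEDist (supportIn Ω f) D ≠ ⊤ :=
    ((setEDist_le_edist ha hw).trans_lt (edist_lt_top a w)).ne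
  have hκ0 : 0 < κ := ENNReal.toReal_pos hfD.ne' htop
  have hκe : setEDist (supportIn Ω f) D = ENNReal.ofReal κ := (ENNReal.ofReal_toReal htop).symm
  -- A loss of `κ / 4` leaves a distance of at least `3 * κ / 4`, strictly more than `κ / 2`.
  obtain ⟨g, hg, hgD, hle⟩ := exists_approx_of_zeroExtension hΩ hA hp
    (isZeroExtension_indicator hΩ hfΩ hκ0 hκe.ge) hfin (σ := κ / 4) (by positivity) hη'
  refine ⟨g, hg, Or.inl (lt_of_lt_of_le ?_ hgD), hle⟩
  rw [hκe, ← ENNReal.ofReal_ofNat 2, ← ENNReal.ofReal_div_of_pos two_pos,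
    ENNReal.ofReal_lt_ofReal_iff (by linarith)]
  linarith

lemma exists_mul_rpow_le (n : ℕ) {q : ℝ} (hq : 0 < q) {η : ℝ} (hη : 0 < η) :
    ∃ A : ENNReal, 0 < A ∧ n * A ^ (1 / q) ≤ ENNReal.ofReal η := by
  refine ⟨(ENNReal.ofReal η / (n + 1)) ^ q, ENNReal.rpow_pos
    (ENNReal.div_pos (by simpa using hη) (by finiteness)) (ENNReal.div_ne_top (by finiteness)
    (by simp)), ?_⟩
  rw [← ENNReal.rpow_mul, mul_one_div_cancel hq.ne', ENNReal.rpow_one]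
  exact (mul_le_mul' le_self_add le_rfl).trans ENNReal.mul_div_le

lemma mem_smoothVanishing_univ {g : EuclideanSpace ℝ (Fin d) → 𝕜} (hg : ContDiff ℝ ∞ g)
    (hD : 0 < setEDist (tsupport g) D) : g ∈ smoothVanishing 𝕜 univ D := by
  refine ⟨hg.contDiffOn, hD.trans_le (setEDist_anti ?_)⟩
  rintro x ⟨-, hx⟩
  exact closure_mono (fun y hy => hy.2) hx

lemma lintegral_iteratedFDeriv_lt_top_of_hasCompactSupport {p : ENNReal} (hp : 1 ≤ p)
    (hp' : p ≠ ⊤) {g : EuclideanSpace ℝ (Fin d) → 𝕜} (hg : ContDiff ℝ ∞ g)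
    (hgc : HasCompactSupport g) (m : ℕ) :
    ∫⁻ x in Ω, ‖iteratedFDeriv ℝ m g x‖ₑ ^ p.toReal < ⊤ := by
  have hmem : MemLp (iteratedFDeriv ℝ m g) p (volume : Measure (EuclideanSpace ℝ (Fin d))) :=
    (hg.continuous_iteratedFDeriv (natCast_le_infty m)).memLp_of_hasCompactSupport
      (hgc.iteratedFDeriv m)
  exact lintegral_rpow_enorm_lt_top_of_eLpNorm_lt_top (zero_lt_one.trans_le hp).ne' hp'
    (hmem.restrict Ω).2

lemma exists_approx_sobolevNorm (hΩ : IsOpen Ω) (hA : AdaptedEpsDelta Ω D) {k : ℕ} {p : ENNReal}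
    (hp : 1 ≤ p) (hp' : p ≠ ⊤) {f : EuclideanSpace ℝ (Fin d) → 𝕜}
    (hf : f ∈ smoothVanishing 𝕜 Ω D) (hfk : f ∈ sobolevSpace 𝕜 k p Ω) {η : ℝ} (hη : 0 < η) :
    ∃ g : EuclideanSpace ℝ (Fin d) → 𝕜, ContDiff ℝ ∞ g ∧
      (setEDist (supportIn Ω f) D / 2 < setEDist (tsupport g) D ∨
        setEDist (tsupport g) D = ⊤) ∧
      (∀ m ≤ k, ∫⁻ x in Ω, ‖iteratedFDeriv ℝ m g x‖ₑ ^ p.toReal < ⊤) ∧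
      sobolevNorm k p Ω (f - g) ≤ ENNReal.ofReal η := by
  have hp1 : 1 ≤ p.toReal := by
    rw [← ENNReal.toReal_one]
    exact (ENNReal.toReal_le_toReal ENNReal.one_ne_top hp').2 hp
  obtain ⟨A, hA0, hAη⟩ := exists_mul_rpow_le (multiIndices d k).card (by linarith : 0 < p.toReal) hη
  obtain ⟨g, hg, hgD, hgk, hle⟩ := exists_contDiff_approx_of_smoothVanishing hΩ hA hp1 hf
    (fun m hm => lintegral_iteratedFDeriv_lt_top hΩ hp hp' hf.1 hfk hm) hA0
  exact ⟨g, hg, hgD, hgk,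
    (sobolevNorm_le_of_contDiffOn hΩ hp hp' (hf.1.sub hg.contDiffOn) hle).trans hAη⟩

/-- Half of the error is spent on the smooth approximation and half on the cutoff. Multiplication by
a cutoff only shrinks the support, so the distance to `D` stays positive. -/
lemma exists_compactSupport_approx_sobolevNorm (hΩ : IsOpen Ω) (hA : AdaptedEpsDelta Ω D) {k : ℕ}
    {p : ENNReal} (hp : 1 ≤ p) (hp' : p ≠ ⊤) {f : EuclideanSpace ℝ (Fin d) → 𝕜}
    (hf : f ∈ smoothVanishing 𝕜 Ω D) (hfk : f ∈ sobolevSpace 𝕜 k p Ω) {η : ℝ} (hη : 0 < η) :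
    ∃ g ∈ smoothVanishing 𝕜 univ D, HasCompactSupport g ∧ g ∈ sobolevSpace 𝕜 k p Ω ∧
      sobolevNorm k p Ω (f - g) ≤ ENNReal.ofReal η := by
  have hp1 : 1 ≤ p.toReal := by
    rw [← ENNReal.toReal_one]
    exact (ENNReal.toReal_le_toReal ENNReal.one_ne_top hp').2 hp
  obtain ⟨A, hA0, hAη⟩ := exists_mul_rpow_le (multiIndices d k).card (by linarith : 0 < p.toReal)
    (half_pos hη)
  obtain ⟨g, hg, hgD, hgk, hle⟩ := exists_approx_sobolevNorm hΩ hA hp hp' hf hfk (half_pos hη)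
  obtain ⟨χ, hχ, hχc, hχle⟩ := exists_cutoff_approx hΩ hp1 hg hgk hA0
  have hχg : ContDiff ℝ ∞ fun y => χ y • g y := hχ.smul hg
  have hc : HasCompactSupport fun y => χ y • g y := hχc.smul_right
  have hD0 : 0 < setEDist (tsupport g) D := by
    rcases hgD with h | h
    · exact zero_le.trans_lt h
    · rw [h]; exact ENNReal.zero_lt_top
  refine ⟨fun y => χ y • g y, mem_smoothVanishing_univ hχg (hD0.trans_le (setEDist_anti
    (closure_mono (Function.support_smul_subset_right χ g)))), hc,
    mem_sobolevSpace_of_contDiffOn hΩ hp hp' hχg.contDiffOn fun m _ =>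
      lintegral_iteratedFDeriv_lt_top_of_hasCompactSupport hp hp' hχg hc m, ?_⟩
  rw [← sub_add_sub_cancel f g]
  refine (sobolevNorm_add_le hΩ k hp _ _).trans ((add_le_add hle
    ((sobolevNorm_le_of_contDiffOn hΩ hp hp' (hg.sub hχg).contDiffOn hχle).trans hAη)).trans ?_)
  rw [← ENNReal.ofReal_add (by positivity) (by positivity), add_halves]

lemma mem_sobolevSpaceVanishing_of_hasCompactSupport (hΩ : IsOpen Ω) {k : ℕ} {p : ENNReal}
    (hp : 1 ≤ p) (hp' : p ≠ ⊤) {g : EuclideanSpace ℝ (Fin d) → 𝕜}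
    (hg : g ∈ smoothVanishing 𝕜 univ D) (hgc : HasCompactSupport g) :
    g ∈ sobolevSpaceVanishing 𝕜 k p Ω D := by
  have hgs : ContDiff ℝ ∞ g := contDiffOn_univ.1 hg.1
  have hmem : g ∈ sobolevSpace 𝕜 k p Ω :=
    mem_sobolevSpace_of_contDiffOn hΩ hp hp' hgs.contDiffOn fun m _ =>
      lintegral_iteratedFDeriv_lt_top_of_hasCompactSupport hp hp' hgs hgc m
  have hp0 : 0 < p.toReal := ENNReal.toReal_pos (zero_lt_one.trans_le hp).ne' hp'
  -- The function approximates itself: its support in `Ω` is part of its support in the whole space,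
  -- so it already lies in the set whose closure is taken.
  refine ⟨hmem, fun η _ => ⟨g, ⟨⟨hgs.contDiffOn, hg.2.trans_le (setEDist_anti ?_)⟩, hmem⟩, ?_⟩⟩
  · rintro x ⟨-, hx⟩
    exact ⟨mem_univ x, closure_mono (fun y (hy : y ∈ {x ∈ Ω | g x ≠ 0}) =>
      (⟨mem_univ y, hy.2⟩ : y ∈ {x ∈ univ | g x ≠ 0})) hx⟩
  · rw [sub_self]
    refine (sobolevNorm_le_of_contDiffOn hΩ hp hp' (h := fun _ => 0) contDiffOn_const (A := 0)
      fun m _ => ?_).trans ?_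
    · refine (lintegral_congr fun x => ?_).trans_le (lintegral_zero (μ := volume.restrict Ω)).le
      rw [Filter.EventuallyEq.iteratedFDeriv_eq_zero (Filter.Eventually.of_forall fun _ => rfl),
        enorm_zero_multilinear, ENNReal.zero_rpow_of_pos hp0]
    · rw [ENNReal.zero_rpow_of_pos (by positivity), mul_zero]
      exact zero_le

end Density

end

theorem proposition7p1 {𝕜 : Type*} [RCLike 𝕜] {d : ℕ} (hd : 2 ≤ d)
    {Ω D : Set (EuclideanSpace ℝ (Fin d))} (hΩ : IsOpen Ω) (hD : IsClosed D)
    (hDΩ : D ⊆ frontier Ω) (hA : AdaptedEpsDelta Ω D)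
    (k : ℕ) (p : ENNReal) (hp : 1 ≤ p) (hp' : p ≠ ⊤) :
    (∀ f ∈ smoothVanishing 𝕜 Ω D ∩ sobolevSpace 𝕜 k p Ω, ∀ η : ℝ, 0 < η →
      ∃ g : EuclideanSpace ℝ (Fin d) → 𝕜, ContDiff ℝ ∞ g ∧
        (setEDist (supportIn Ω f) D / 2 < setEDist (tsupport g) D ∨
          setEDist (tsupport g) D = ⊤) ∧
        g ∈ sobolevSpace 𝕜 k p Ω ∧
        sobolevNorm k p Ω (f - g) ≤ ENNReal.ofReal η) ∧
    (∀ f ∈ smoothVanishing 𝕜 Ω D ∩ sobolevSpace 𝕜 k p Ω, ∀ η : ℝ, 0 < η →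
      ∃ g ∈ smoothVanishing 𝕜 univ D, HasCompactSupport g ∧
        g ∈ sobolevSpace 𝕜 k p Ω ∧
        sobolevNorm k p Ω (f - g) ≤ ENNReal.ofReal η) ∧
    (∀ g ∈ smoothVanishing 𝕜 univ D, HasCompactSupport g →
      g ∈ sobolevSpaceVanishing 𝕜 k p Ω D) ∧
    (∀ u ∈ sobolevSpaceVanishing 𝕜 k p Ω D, ∀ η : ℝ, 0 < η →
      ∃ g ∈ smoothVanishing 𝕜 univ D, HasCompactSupport g ∧
        sobolevNorm k p Ω (u - g) ≤ ENNReal.ofReal η) := by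

  refine ⟨fun f hf η hη => ?_, fun f hf η hη =>
    exists_compactSupport_approx_sobolevNorm hΩ hA hp hp' hf.1 hf.2 hη, fun g hg hgc =>
    mem_sobolevSpaceVanishing_of_hasCompactSupport hΩ hp hp' hg hgc, fun u hu η hη => ?_⟩
  · obtain ⟨g, hg, hgD, hgk, hle⟩ := exists_approx_sobolevNorm hΩ hA hp hp' hf.1 hf.2 hη
    exact ⟨g, hg, hgD, mem_sobolevSpace_of_contDiffOn hΩ hp hp' hg.contDiffOn hgk, hle⟩
  · obtain ⟨f, hf, hfle⟩ := hu.2 (η / 2) (half_pos hη)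
    obtain ⟨g, hg, hgc, -, hle⟩ :=
      exists_compactSupport_approx_sobolevNorm hΩ hA hp hp' hf.1 hf.2 (half_pos hη)
    refine ⟨g, hg, hgc, ?_⟩
    rw [← sub_add_sub_cancel u f]
    refine (sobolevNorm_add_le hΩ k hp _ _).trans ((add_le_add hfle hle).trans ?_)
    rw [← ENNReal.ofReal_add (by positivity) (by positivity), add_halves]
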